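/- Let $G=(V,E)$ be a finite simple undirected graph with $n$ vertices and $m$ edges. For $F\subseteq E$, let $V(F)$ be the set of end vertices of the edges in $F$. A layout of $G$ is a bijection $\pi:\{1,\dots,m\}\to E$; its width is $\max_{1\le i\le m}|V(\pi_{\le i})\cap V(E\setminus\pi_{\le i})|$, where $\pi_{\le i}=\{\pi(j):1\le j\le i\}$ (and $0$ if $m=0$); and the linear-width $\mathrm{lw}(G)$ is the minimum width of a layout of $G$. Theorem. There is a deterministic algorithm that, given an arbitrary finite simple graph $G$ by its adjacency matrix, outputs a layout $\pi$ of $G$ together with its width $k$, such that $$\mathrm{lw}(G)\le k\le \mathrm{lw}(G)+1,$$ and that runs in time $O(1.89^n)$, where $n$ is the number of vertices of $G$. Here an algorithm is a single program (the same for all $n$) of a random access machine with addition, truncated subtraction, indirect addressing, and tests for zero, and time is logarithmic cost: each instruction or test costs one plus the binary lengths of the numbers and memory addresses that it handles. -/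

import Mathlib

open Asymptotics Filter

namespace LinearWidth

/-! ### Layouts and linear-width of a graph -/

/-- `V(F)`: the set of end vertices of the edges in `F`. -/
def endVertices {V : Type*} (F : Set (Sym2 V)) : Set V :=
  {v | ∃ e ∈ F, v ∈ e}

/-- `mid(F) = V(F) ∩ V(E \ F)`, where `E` is the edge set of `G`. -/
def mid {V : Type*} (G : SimpleGraph V) (F : Set (Sym2 V)) : Set V :=
  endVertices F ∩ endVertices (G.edgeSet \ F)

/-- A layout of `G`: a bijection from the positions `0, …, m - 1` to the `m` edges of `G`. -/
abbrev Layout {V : Type*} (G : SimpleGraph V) : Type _ :=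
  Fin G.edgeSet.ncard ≃ G.edgeSet

/-- The set of edges of a layout in the positions up to and including `i`. -/
def Layout.upTo {V : Type*} {G : SimpleGraph V} (π : Layout G) (i : Fin G.edgeSet.ncard) :
    Set (Sym2 V) :=
  {e | ∃ j, j ≤ i ∧ (π j : Sym2 V) = e}

/-- The width of a layout: the maximum of `|mid(π_{≤ i})|` over all positions `i`
(and `0` if there is no edge). -/
noncomputable def Layout.width {V : Type*} {G : SimpleGraph V} (π : Layout G) : ℕ :=
  Finset.univ.sup fun i => (mid G (Layout.upTo π i)).ncard

/-- The linear-width of `G`: the minimum `k` such that `G` has a layout of width at most `k`.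
(A finite graph always has a layout.) -/
noncomputable def linearWidth {V : Type*} (G : SimpleGraph V) : ℕ :=
  sInf {k | ∃ π : Layout G, Layout.width π ≤ k}

/-! ### Random access machines with logarithmic cost -/

/-- The state of a random access machine: registers, which programs name explicitly (so that a
given program uses only finitely many of them), and a memory that is addressed indirectly. -/
structure RAMState where
  reg : ℕ → ℕ
  mem : ℕ → ℕ

/-- The instructions of the machine. -/
inductive Instr where
  /-- `r := c` -/
  | const (r c : ℕ)
  /-- `r := a + b` (registers) -/
  | add (r a b : ℕ)
  /-- `r := a - b` (registers, with `a - b = 0` if `a < b`) -/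
  | sub (r a b : ℕ)
  /-- `r := mem[a]`, with the address in register `a` -/
  | load (r a : ℕ)
  /-- `mem[a] := b`, with the address in register `a` and the value in register `b` -/
  | store (a b : ℕ)

/-- The effect of an instruction. -/
def Instr.eval : Instr → RAMState → RAMState
  | .const r c, s => { s with reg := Function.update s.reg r c }
  | .add r a b, s => { s with reg := Function.update s.reg r (s.reg a + s.reg b) }
  | .sub r a b, s => { s with reg := Function.update s.reg r (s.reg a - s.reg b) }
  | .load r a, s => { s with reg := Function.update s.reg r (s.mem (s.reg a)) }
  | .store a b, s => { s with mem := Function.update s.mem (s.reg a) (s.reg b) }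

/-- The logarithmic cost of an instruction: one, plus the binary lengths of all the numbers and
memory addresses that it handles. -/
def Instr.cost : Instr → RAMState → ℕ
  | .const _ c, _ => 1 + c.size
  | .add _ a b, s => 1 + (s.reg a).size + (s.reg b).size
  | .sub _ a b, s => 1 + (s.reg a).size + (s.reg b).size
  | .load _ a, s => 1 + (s.reg a).size + (s.mem (s.reg a)).size
  | .store a b, s => 1 + (s.reg a).size + (s.reg b).size

/-- Programs, with structured flow of control. -/
inductive Program where
  | instr (i : Instr)
  /-- `P; Q` -/
  | seq (P Q : Program)
  /-- `if r ≠ 0 then P else Q` -/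
  | cond (r : ℕ) (P Q : Program)
  /-- `while r ≠ 0 do P` -/
  | loop (r : ℕ) (P : Program)

/-- `Runs P s t s'`: started in state `s`, the program `P` halts in state `s'`, after a
computation of total cost `t`. A test of a register costs one plus its binary length. -/
inductive Runs : Program → RAMState → ℕ → RAMState → Prop
  | instr (i : Instr) (s : RAMState) : Runs (.instr i) s (i.cost s) (i.eval s)
  | seq {P Q : Program} {s s₁ s₂ : RAMState} {t₁ t₂ : ℕ} :
      Runs P s t₁ s₁ → Runs Q s₁ t₂ s₂ → Runs (.seq P Q) s (t₁ + t₂) s₂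
  | cond_pos {r : ℕ} {P Q : Program} {s s₁ : RAMState} {t : ℕ} :
      s.reg r ≠ 0 → Runs P s t s₁ → Runs (.cond r P Q) s (1 + (s.reg r).size + t) s₁
  | cond_zero {r : ℕ} {P Q : Program} {s s₁ : RAMState} {t : ℕ} :
      s.reg r = 0 → Runs Q s t s₁ → Runs (.cond r P Q) s (1 + (s.reg r).size + t) s₁
  | loop_pos {r : ℕ} {P : Program} {s s₁ s₂ : RAMState} {t₁ t₂ : ℕ} :
      s.reg r ≠ 0 → Runs P s t₁ s₁ → Runs (.loop r P) s₁ t₂ s₂ →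
        Runs (.loop r P) s (1 + (s.reg r).size + t₁ + t₂) s₂
  | loop_zero {r : ℕ} {P : Program} {s : RAMState} :
      s.reg r = 0 → Runs (.loop r P) s (1 + (s.reg r).size) s

/-! ### Input and output -/

open Classical in
/-- The initial state for the graph `G` on `n` vertices: the memory holds `n` in cell `0`, then
the adjacency matrix of `G` row by row, then zeros; all registers are zero. -/
noncomputable def inputState {n : ℕ} (G : SimpleGraph (Fin n)) : RAMState where
  reg := fun _ => 0
  mem := fun a =>
    if a = 0 then n
    else if ∃ i j : Fin n, G.Adj i j ∧ a = 1 + (i : ℕ) * n + j then 1 else 0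

/-- The memory of the state `s` presents the number `k` and the layout `π`: it holds `k` in
cell `0`, the number of edges in cell `1`, and from cell `2` on the pairs of end vertices of the
edges, in the order of `π`. -/
def Outputs {n : ℕ} {G : SimpleGraph (Fin n)} (s : RAMState) (k : ℕ) (π : Layout G) : Prop :=
  s.mem 0 = k ∧ s.mem 1 = G.edgeSet.ncard ∧
    ∀ i : Fin G.edgeSet.ncard, ∃ u v : Fin n,
      (π i : Sym2 (Fin n)) = s(u, v) ∧ s.mem (2 + 2 * i) = u ∧ s.mem (3 + 2 * i) = v

end LinearWidth

/-! Edge layouts are traded for vertex expansions: the vertices are added to `∅` one at a time, and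
every set passed has at most `k` outer neighbours. Let `p` be the least `k` for which the full set
is reached. An expansion read backwards yields a layout: when `v` is the last vertex of the current
set `X`, the edges from `v` to vertices outside `X` are put out. At any moment only `v` and the
outer neighbours of `X` can lie both on edges already put out and on others, so the width is at most
`p + 1` (`ncard_mid_le_of_emitted`). Conversely, in a layout of width `q` let a vertex enter once
all its edges have occurred, the isolated edges being settled at the start; this is an expansion
with `k = max q 1` (`Layout.reach_univ`). If `q = 0`, the edges are pairwise disjoint and every
layout has width `0`. So the emitted layout is optimal up to one
(`Layout.width_le_linearWidth_add_one`).

It remains to find an optimal expansion without inspecting all `2 ^ n` sets. The number of outer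
neighbours is submodular. Hence, if no set between `S` and `T ⊇ S` is lighter than `T`, every
expansion from `S` to the full set can be joined with `T` without exceeding the capacity, so the
full set can also be reached from `T` (`Reach.of_tight`). A search that has reached such a tight `T`
from `S` may forget `S`.

Fix a constant `K`. The weight `wt` adds `K` to the number of outer neighbours of every set but the
full one, which has weight `0`, and the capacity becomes `k + K`. The search branches only at `∅`
and at sets of weight at most `k`. After one vertex is added, a recursive search (`descend`) looks
for a tight set of weight at most `k`; one exists whenever the full set is reachable. A nested call
aims at a weight larger by at least one, and the capacity exceeds the first target by `K`, so the
depth is at most `K` and the search is polynomial for fixed `K`. The set found is enlarged further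
until no proper superset of at most its weight can be reached with slack `K` (`normalize`).

Such a stuck set `X` that is not full is `Closed`: no nonempty set of at most `K` vertices outside
`X` has all its neighbours in itself, `X` or `nb G X`. Of `X`, `nb G X` and the remaining vertices,
one part has at most `n / 3` elements. A small `X` is itself a small set. A small remainder
determines `X` (`Closed.eq_ofRest`). A small boundary determines `X` up to the choice of some
components with more than `K` vertices, since the smaller components belong to `X`
(`Closed.exists_ofSeparator`). The `n`-th root of the number of sets of size at most `n / 3` is at
most `(3 / 2) * 2 ^ (1 / 3) < 1.89`, and for large `K` the choice of components and all polynomial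
factors fit into the gap.

The search is written in a small command language with a total-correctness calculus (`Tr`) and
compiled to the machine. All numbers handled have polynomially many bits, so logarithmic cost
contributes only a polynomial factor. -/

namespace LinearWidth

/-! ### Bounded expansions of sets with respect to a submodular function -/

section Submodular

variable {α : Type*} [DecidableEq α]

/-- Submodularity of a set function. -/
def Submod (w : Finset α → ℕ) : Prop :=
  ∀ S T, w (S ∪ T) + w (S ∩ T) ≤ w S + w T

/-- `T` is obtained from `S` by adding elements one at a time, all new sets having weight at
most `c`. -/
inductive Reach (w : Finset α → ℕ) (c : ℕ) : Finset α → Finset α → Prop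
  | refl (S) : Reach w c S S
  | head {S T} (v : α) : v ∉ S → w (insert v S) ≤ c → Reach w c (insert v S) T → Reach w c S T

/-- No set between `S` and `T` has smaller weight than `T`. -/
def Tight (w : Finset α → ℕ) (S T : Finset α) : Prop :=
  ∀ X, S ⊆ X → X ⊆ T → w T ≤ w X

variable {w : Finset α → ℕ} {c : ℕ} {S T U X Y : Finset α}

theorem Reach.subset (h : Reach w c S T) : S ⊆ T := by
  induction h with
  | refl => exact Finset.Subset.refl _
  | head v _ _ _ ih => exact (Finset.subset_insert _ _).trans ih

theorem Reach.trans (h : Reach w c S T) (h' : Reach w c T U) : Reach w c S U := by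
  induction h with
  | refl => exact h'
  | head v hv hw _ ih => exact .head v hv hw (ih h')

/-- Joining a tight set to all sets of an expansion. -/
theorem Reach.union_tight (hw : Submod w) (h : Reach w c S U) (hST : Tight w X T) (hX : X ⊆ S)
    (hXT : X ⊆ T) : Reach w c (S ∪ T) (U ∪ T) := by
  induction h with
  | refl => exact .refl _
  | @head S U v hv hc _ ih =>
    have hX' : X ⊆ insert v S := hX.trans (Finset.subset_insert _ _)
    have h2 := ih hX'
    rw [Finset.insert_union] at h2
    -- If `v` already lies in `T`, the step disappears. Otherwise the intersection with `T` still
    -- lies between `X` and `T`, so it weighs at least `w T`, and submodularity bounds the union by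
    -- `w (insert v S)`.
    by_cases hvT : v ∈ S ∪ T
    · rwa [Finset.insert_eq_of_mem hvT] at h2
    · refine .head v hvT ?_ h2
      have h3 := hw (insert v S) T
      have h4 := hST (insert v S ∩ T) (Finset.subset_inter hX' hXT) Finset.inter_subset_right
      rw [← Finset.insert_union]
      omega

/-- The exchange argument behind the search: passing from `S` to a tight superset never destroys the
possibility of reaching the full set. -/
theorem Reach.of_tight [Fintype α] (hw : Submod w) (h : Reach w c S Finset.univ)
    (hT : Tight w S T) (hST : S ⊆ T) : Reach w c T Finset.univ := by
  have := h.union_tight hw hT (Finset.Subset.refl _) hST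
  rwa [Finset.union_eq_right.2 hST, Finset.union_eq_left.2 (Finset.subset_univ T)] at this

theorem Tight.union_le (hw : Submod w) (hT : Tight w S T) (hST : S ⊆ T) (hSX : S ⊆ X) :
    w (X ∪ T) ≤ w X := by
  have h1 := hw X T
  have h2 := hT (X ∩ T) (Finset.subset_inter hSX hST) Finset.inter_subset_right
  omega

theorem Tight.refl {β : Type*} {w : Finset β → ℕ} (S : Finset β) : Tight w S S := fun X h h' => by
  rw [Finset.Subset.antisymm h h']

/-- Joining `T` to a set above `S` does not make it heavier, and moves it into the range where the
second tightness applies. -/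
theorem Tight.trans (hw : Submod w) (h : Tight w S T) (hST : S ⊆ T) (h' : Tight w T U)
    (hTU : T ⊆ U) : Tight w S U := by
  intro X hX hXU
  have h1 := h.union_le hw hST hX
  exact (h' _ Finset.subset_union_right (Finset.union_subset hXU hTU)).trans h1

/-- A set of minimum weight between the ends of an expansion is reached. -/
theorem Reach.inter_of_min (hw : Submod w) (h : Reach w c S T) (hX : X ⊆ T)
    (hmin : ∀ Z, S ∩ X ⊆ Z → Z ⊆ T → w X ≤ w Z) : Reach w c (S ∩ X) X := by
  induction h with
  | refl S => rw [Finset.inter_eq_right.2 hX]; exact .refl _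
  | @head S T v hv hc h ih =>
    have ih := ih hX (fun Z hZ => hmin Z
      ((Finset.inter_subset_inter_right (Finset.subset_insert _ _)).trans hZ))
    by_cases hvX : v ∈ X
    · rw [Finset.insert_inter_of_mem hvX] at ih
      refine .head v (fun hh => hv (Finset.mem_inter.1 hh).1) ?_ ih
      -- Minimality of `w X` makes the union with `X` at least as heavy as `X`, so the intersection
      -- is no heavier than `insert v S`.
      have h1 := hw (insert v S) X
      have h2 := hmin (insert v S ∪ X)
        ((Finset.inter_subset_right).trans Finset.subset_union_right)
        (Finset.union_subset h.subset hX)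
      rw [Finset.insert_inter_of_mem hvX] at h1
      omega
    · rwa [Finset.insert_inter_of_notMem hvX] at ih

/-- `Y` has no reachable proper superset within `W` of at most the same weight. -/
def Stuck (w : Finset α → ℕ) (c : ℕ) (W Y : Finset α) : Prop :=
  ∀ X, Y ⊂ X → X ⊆ W → Reach w c Y X → w Y < w X

theorem stuck_of_forall {W : Finset α}
    (h : ∀ v ∈ W, v ∉ Y → ∀ X, insert v Y ⊆ X → X ⊆ W → w (insert v Y) ≤ c →
      Reach w c (insert v Y) X → w Y < w X) : Stuck w c W Y := by
  intro X hYX hXW hr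
  cases hr with
  | refl => exact absurd rfl hYX.ne
  | head v hv hc hr =>
    exact h v (hXW (hr.subset (Finset.mem_insert_self _ _))) hv X hr.subset hXW hc hr

/-- If `T` is reached from `Y` and is tight over `insert v Y`, and nothing light is reached
below `T` without `v`, then `T` is tight over `Y`. -/
theorem Tight.of_stuck (hw : Submod w) {v : α} (hT : Tight w (insert v Y) T)
    (hr : Reach w c Y T) (hle : w T ≤ w Y) (hst : Stuck w c (T.erase v) Y) : Tight w Y T := by
  classical
  obtain ⟨X, hXm, hmin⟩ := Finset.exists_min_image (Finset.Icc Y T) w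
    ⟨Y, Finset.mem_Icc.2 ⟨le_refl _, hr.subset⟩⟩
  obtain ⟨hYX, hXT⟩ := Finset.mem_Icc.1 hXm
  intro Z hYZ hZT
  refine le_trans ?_ (hmin Z (Finset.mem_Icc.2 ⟨hYZ, hZT⟩))
  by_contra hlt
  push Not at hlt
  -- A lightest set `X` between `Y` and `T` that beats `T` must avoid `v`. It is reached from `Y` by
  -- `Reach.inter_of_min`, so it contradicts `hst`.
  have hvX : v ∉ X := fun hv =>
    absurd (hT X (Finset.insert_subset hv hYX) hXT) (not_le.2 hlt)
  have hne : Y ⊂ X := by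
    refine lt_of_le_of_ne hYX ?_
    rintro rfl
    omega
  have hreach := hr.inter_of_min hw hXT (fun Z h1 h2 => by
    rw [Finset.inter_eq_left.2 hYX] at h1
    exact hmin Z (Finset.mem_Icc.2 ⟨h1, h2⟩))
  rw [Finset.inter_eq_left.2 hYX] at hreach
  have := hst X hne (fun x hx => Finset.mem_erase.2 ⟨fun h => hvX (h ▸ hx), hXT hx⟩) hreach
  omega

/-- Exchanging the start of an expansion for a tight superset. -/
theorem Reach.exchange (hw : Submod w) (h : Reach w c S T) (hY : Tight w S Y) (hSY : S ⊆ Y) :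
    Reach w c Y (T ∪ Y) ∧ w (T ∪ Y) ≤ w T := by
  have := h.union_tight hw hY (Finset.Subset.refl _) hSY
  rw [Finset.union_eq_right.2 hSY] at this
  exact ⟨this, hY.union_le hw hSY h.subset⟩

end Submodular

/-! ### The weight function of a graph -/

section Weight

variable {n : ℕ} (G : SimpleGraph (Fin n))

open Classical in
/-- The vertices outside `S` that are adjacent to `S`. -/
noncomputable def nb (S : Finset (Fin n)) : Finset (Fin n) :=
  Finset.univ.filter fun v => v ∉ S ∧ ∃ u ∈ S, G.Adj u v

/-- The number of outer neighbours, shifted by `K` except for the full vertex set. -/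
noncomputable def wt (K : ℕ) (S : Finset (Fin n)) : ℕ :=
  (nb G S).card + if S = Finset.univ then 0 else K

variable {G}

theorem mem_nb {S : Finset (Fin n)} {v : Fin n} :
    v ∈ nb G S ↔ v ∉ S ∧ ∃ u ∈ S, G.Adj u v := by
  simp [nb]

theorem nb_univ : nb G Finset.univ = ∅ := by
  ext v; simp [mem_nb]

theorem wt_univ (K : ℕ) : wt G K Finset.univ = 0 := by
  simp [wt, nb_univ]

theorem wt_of_ne {K : ℕ} {S : Finset (Fin n)} (h : S ≠ Finset.univ) :
    wt G K S = (nb G S).card + K := by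
  simp [wt, h]

theorem wt_le (K : ℕ) (S : Finset (Fin n)) : wt G K S ≤ n + K := by
  have h : (nb G S).card ≤ n := by simpa using Finset.card_le_univ (nb G S)
  rw [wt]; split_ifs <;> omega

theorem card_nb_of_wt_le {K k : ℕ} {S : Finset (Fin n)} (h : wt G K S ≤ k + K) :
    (nb G S).card ≤ k := by
  by_cases hS : S = Finset.univ
  · subst hS; simp [nb_univ]
  · rw [wt_of_ne hS] at h; omega

theorem wt_le_of_card_nb {K k : ℕ} {S : Finset (Fin n)} (h : (nb G S).card ≤ k) :
    wt G K S ≤ k + K := by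
  rw [wt]; split_ifs <;> omega

/-- The neighbourhoods of union and intersection have their union and their intersection inside
those of the two given neighbourhoods. The shift is harmless because it is dropped only at the full
set: if neither set is full, neither is the intersection, and the union can only gain from the
exception. -/
theorem submod_wt (K : ℕ) : Submod (wt G K) := by
  classical
  have key : ∀ S T : Finset (Fin n),
      (nb G (S ∪ T)).card + (nb G (S ∩ T)).card ≤ (nb G S).card + (nb G T).card := by
    intro S T
    have hsub1 : nb G (S ∪ T) ∪ nb G (S ∩ T) ⊆ nb G S ∪ nb G T := by
      intro v
      simp only [Finset.mem_union, mem_nb, Finset.mem_inter]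
      rintro (⟨h1, u, h2, h3⟩ | ⟨h1, u, h2, h3⟩)
      · rcases h2 with h2 | h2
        · exact Or.inl ⟨fun h => h1 (Or.inl h), u, h2, h3⟩
        · exact Or.inr ⟨fun h => h1 (Or.inr h), u, h2, h3⟩
      · by_cases hv : v ∈ S
        · exact Or.inr ⟨fun h => h1 ⟨hv, h⟩, u, h2.2, h3⟩
        · exact Or.inl ⟨hv, u, h2.1, h3⟩
    have hsub2 : nb G (S ∪ T) ∩ nb G (S ∩ T) ⊆ nb G S ∩ nb G T := by
      intro v
      simp only [Finset.mem_inter, mem_nb, Finset.mem_union]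
      rintro ⟨⟨h1, -⟩, -, u, h2, h3⟩
      exact ⟨⟨fun h => h1 (Or.inl h), u, h2.1, h3⟩, fun h => h1 (Or.inr h), u, h2.2, h3⟩
    rw [← Finset.card_union_add_card_inter (nb G (S ∪ T)), ← Finset.card_union_add_card_inter
      (nb G S)]
    exact Nat.add_le_add (Finset.card_le_card hsub1) (Finset.card_le_card hsub2)
  intro S T
  have h := key S T
  by_cases hS : S = Finset.univ
  · subst hS; rw [Finset.union_eq_left.2 (Finset.subset_univ T), Finset.univ_inter]
  by_cases hT : T = Finset.univ
  · subst hT; rw [Finset.union_eq_right.2 (Finset.subset_univ S), Finset.inter_univ]; omega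
  have hI : S ∩ T ≠ Finset.univ := fun h => hS (Finset.univ_subset_iff.1 (h ▸ Finset.inter_subset_left))
  have : wt G K (S ∪ T) ≤ (nb G (S ∪ T)).card + K := by rw [wt]; split_ifs <;> omega
  rw [wt_of_ne hS, wt_of_ne hT, wt_of_ne hI]
  omega

end Weight

/-! ### Polynomially bounded functions -/

/-- `f` is bounded by a power of `x + 2`. -/
def PolyBdd (f : ℕ → ℕ) : Prop :=
  ∃ c, ∀ x, f x ≤ (x + 2) ^ c

namespace PolyBdd

variable {f g : ℕ → ℕ}

theorem const (a : ℕ) : PolyBdd fun _ => a :=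
  -- The base `x + 2` is at least `2` even at `x = 0`, so a constant can serve as its own exponent.
  ⟨a, fun x => (Nat.lt_pow_self (by omega : 1 < x + 2)).le⟩

theorem id : PolyBdd fun x => x :=
  ⟨1, fun x => by simp⟩

theorem mul (hf : PolyBdd f) (hg : PolyBdd g) : PolyBdd fun x => f x * g x := by
  obtain ⟨a, ha⟩ := hf
  obtain ⟨b, hb⟩ := hg
  exact ⟨a + b, fun x => by rw [pow_add]; exact Nat.mul_le_mul (ha x) (hb x)⟩

theorem add (hf : PolyBdd f) (hg : PolyBdd g) : PolyBdd fun x => f x + g x := by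
  obtain ⟨a, ha⟩ := hf
  obtain ⟨b, hb⟩ := hg
  refine ⟨a + b + 1, fun x => ?_⟩
  have h1 : (x + 2) ^ a ≤ (x + 2) ^ (a + b) := Nat.pow_le_pow_right (by omega) (by omega)
  have h2 : (x + 2) ^ b ≤ (x + 2) ^ (a + b) := Nat.pow_le_pow_right (by omega) (by omega)
  have h3 : (x + 2) ^ (a + b) * 2 ≤ (x + 2) ^ (a + b) * (x + 2) :=
    Nat.mul_le_mul_left _ (by omega)
  rw [pow_succ]
  have := ha x
  have := hb x
  show f x + g x ≤ _
  omega

end PolyBdd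

/-! ### Expressions and their compilation -/

/-- Expressions over program variables, local variables (de Bruijn indices) and the memory.
`loop a b` iterates `b` as many times as variable `0` says, starting with `a`; in `b`, local
variable `0` is the number of the iteration and local variable `1` the current value. -/
inductive Expr where
  | glob (r : ℕ)
  | var (i : ℕ)
  | const (c : ℕ)
  | add (a b : Expr)
  | sub (a b : Expr)
  | load (a : Expr)
  | ite (c a b : Expr)
  | let2 (a b body : Expr)
  | loop (a body : Expr)

/-- The values of the program variables and the memory. -/
structure Store where
  var : ℕ → ℕ
  mem : ℕ → ℕ

namespace Expr

/-- The value of an expression. -/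
def eval (s : Store) : Expr → List ℕ → ℕ
  | glob r, _ => s.var r
  | var i, ρ => ρ.getD i 0
  | const c, _ => c
  | add a b, ρ => a.eval s ρ + b.eval s ρ
  | sub a b, ρ => a.eval s ρ - b.eval s ρ
  | load a, ρ => s.mem (a.eval s ρ)
  | ite c a b, ρ => if c.eval s ρ = 0 then b.eval s ρ else a.eval s ρ
  | let2 a b e, ρ => e.eval s (b.eval s ρ :: a.eval s ρ :: ρ)
  | loop a b, ρ => Nat.rec (a.eval s ρ) (fun i x => b.eval s (i :: x :: ρ)) (s.var 0)

/-- `d := r` -/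
def copy (d r : ℕ) : Program :=
  .seq (.instr (.const d 0)) (.instr (.add d r d))

/-- The program that leaves the value of an expression in register `2 * d + 1`. Program variable
`r` is in register `2 * r`, and the local variables are in the odd registers given by `env`. -/
def compile : Expr → List ℕ → ℕ → Program
  | glob r, _, d => copy (2 * d + 1) (2 * r)
  | var i, env, d =>
    match env[i]? with
    | some l => copy (2 * d + 1) (2 * l + 1)
    | none => .instr (.const (2 * d + 1) 0)
  | const c, _, d => .instr (.const (2 * d + 1) c)
  | add a b, env, d =>
    .seq (a.compile env d) (.seq (b.compile env (d + 1))
      (.instr (.add (2 * d + 1) (2 * d + 1) (2 * d + 3))))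
  | sub a b, env, d =>
    .seq (a.compile env d) (.seq (b.compile env (d + 1))
      (.instr (.sub (2 * d + 1) (2 * d + 1) (2 * d + 3))))
  | load a, env, d => .seq (a.compile env d) (.instr (.load (2 * d + 1) (2 * d + 1)))
  | ite c a b, env, d =>
    .seq (c.compile env d) (.cond (2 * d + 1) (a.compile env d) (b.compile env d))
  | let2 a b e, env, d =>
    .seq (a.compile env d) (.seq (b.compile env (d + 1))
      (.seq (e.compile ((d + 1) :: d :: env) (d + 2)) (copy (2 * d + 1) (2 * d + 5))))
  | loop a b, env, d =>
    .seq (a.compile env d) (.seq (.instr (.const (2 * d + 3) 0)) (.seq (copy (2 * d + 5) 0)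
      (.loop (2 * d + 5) (.seq (b.compile ((d + 1) :: d :: env) (d + 3))
        (.seq (copy (2 * d + 1) (2 * d + 7)) (.seq (.instr (.const (2 * d + 7) 1))
          (.seq (.instr (.add (2 * d + 3) (2 * d + 3) (2 * d + 7)))
            (.instr (.sub (2 * d + 5) (2 * d + 5) (2 * d + 7))))))))))

/-- A bound for the growth of the binary lengths in the computation of an expression. -/
def growth (N : ℕ) : Expr → ℕ
  | glob _ => 0
  | var _ => 0
  | const c => c.size
  | add a b => a.growth N + b.growth N + 1
  | sub a b => a.growth N + b.growth N
  | load a => a.growth N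
  | ite c a b => c.growth N + a.growth N + b.growth N
  | let2 a b e => a.growth N + b.growth N + e.growth N
  | loop a b => a.growth N + N * b.growth N

/-- A bound for the cost of the computation of an expression. -/
def cost (N : ℕ) : Expr → ℕ → ℕ
  | glob _, m => m + 2
  | var _, m => m + 2
  | const c, _ => 1 + c.size
  | add a b, m => a.cost N m + b.cost N m + (1 + 2 * (m + a.growth N + b.growth N))
  | sub a b, m => a.cost N m + b.cost N m + (1 + 2 * (m + a.growth N + b.growth N))
  | load a, m => a.cost N m + (1 + 2 * (m + a.growth N))
  | ite c a b, m => c.cost N m + a.cost N m + b.cost N m + (1 + (m + c.growth N))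
  | let2 a b e, m => a.cost N m + b.cost N m + e.cost N (m + a.growth N + b.growth N) +
      (2 + (m + a.growth N + b.growth N + e.growth N))
  | loop a b, m => a.cost N m + (m + 4) +
      N * (b.cost N (m + a.growth N + N * b.growth N) +
        (m + a.growth N + N * b.growth N) + 3 * m + 10)

theorem polyBdd_growth (e : Expr) {p : ℕ → ℕ} (hp : PolyBdd p) :
    PolyBdd fun x => e.growth (p x) := by
  induction e with
  | glob r => exact .const 0
  | var i => exact .const 0
  | const c => exact .const _
  | add a b ha hb => exact (ha.add hb).add (.const 1)
  | sub a b ha hb => exact ha.add hb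
  | load a ha => exact ha
  | ite c a b hc ha hb => exact (hc.add ha).add hb
  | let2 a b e ha hb he => exact (ha.add hb).add he
  | loop a b ha hb => exact ha.add (hp.mul hb)

/-- The bit bound `q` has to vary in the induction, since inner expressions see local values longer
than the initial ones. -/
theorem polyBdd_cost (e : Expr) {p q : ℕ → ℕ} (hp : PolyBdd p) (hq : PolyBdd q) :
    PolyBdd fun x => e.cost (p x) (q x) := by
  induction e generalizing q with
  | glob r => exact hq.add (.const 2)
  | var i => exact hq.add (.const 2)
  | const c => exact .const _
  | add a b ha hb =>
    exact ((ha hq).add (hb hq)).add ((PolyBdd.const 1).add ((PolyBdd.const 2).mul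
      ((hq.add (a.polyBdd_growth hp)).add (b.polyBdd_growth hp))))
  | sub a b ha hb =>
    exact ((ha hq).add (hb hq)).add ((PolyBdd.const 1).add ((PolyBdd.const 2).mul
      ((hq.add (a.polyBdd_growth hp)).add (b.polyBdd_growth hp))))
  | load a ha =>
    exact (ha hq).add ((PolyBdd.const 1).add ((PolyBdd.const 2).mul
      (hq.add (a.polyBdd_growth hp))))
  | ite c a b hc ha hb =>
    exact (((hc hq).add (ha hq)).add (hb hq)).add ((PolyBdd.const 1).add
      (hq.add (c.polyBdd_growth hp)))
  | let2 a b e ha hb he =>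
    have h := (hq.add (a.polyBdd_growth hp)).add (b.polyBdd_growth hp)
    exact (((ha hq).add (hb hq)).add (he h)).add ((PolyBdd.const 2).add
      (h.add (e.polyBdd_growth hp)))
  | loop a b ha hb =>
    have h := (hq.add (a.polyBdd_growth hp)).add (hp.mul (b.polyBdd_growth hp))
    exact ((ha hq).add (hq.add (.const 4))).add (hp.mul ((((hb h).add h).add
      ((PolyBdd.const 3).mul hq)).add (.const 10)))

end Expr

/-! ### Correctness and cost of compiled expressions -/

theorem size_le_of_lt {a m : ℕ} (h : a < 2 ^ m) : a.size ≤ m :=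
  Nat.size_le.2 h

theorem lt_two_pow_of_le {a m m' : ℕ} (h : a < 2 ^ m) (hm : m ≤ m') : a < 2 ^ m' :=
  h.trans_le (Nat.pow_le_pow_right (by omega) hm)

theorem runs_copy {d r m : ℕ} (hdr : d ≠ r) (s : RAMState) (h : s.reg r < 2 ^ m) :
    ∃ t s', Runs (Expr.copy d r) s t s' ∧ t ≤ m + 2 ∧ s'.mem = s.mem ∧
      s'.reg = Function.update s.reg d (s.reg r) := by
  refine ⟨_, _, .seq (.instr _ _) (.instr _ _), ?_, ?_, ?_⟩
  · have := size_le_of_lt h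
    simp [Instr.cost, Instr.eval, Function.update_of_ne hdr.symm]
    omega
  · simp [Instr.eval]
  · simp [Instr.eval, Function.update_of_ne hdr.symm]

namespace Expr

/-- The local variables have the values `ρ`. -/
def Env (s : RAMState) (d : ℕ) (env ρ : List ℕ) : Prop :=
  List.Forall₂ (fun l x => l < d ∧ s.reg (2 * l + 1) = x) env ρ

theorem Env.mono {s s' : RAMState} {d d' : ℕ} {env ρ : List ℕ} (h : Env s d env ρ)
    (hd : d ≤ d') (hs : ∀ l < d, s'.reg (2 * l + 1) = s.reg (2 * l + 1)) :
    Env s' d' env ρ :=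
  List.Forall₂.imp (fun _ _ h => ⟨h.1.trans_le hd, (hs _ h.1).trans h.2⟩) h

theorem Env.getElem {s : RAMState} {d : ℕ} {env ρ : List ℕ} (h : Env s d env ρ) (i : ℕ) :
    (env[i]? = none ∧ ρ.getD i 0 = 0) ∨
      ∃ l, env[i]? = some l ∧ l < d ∧ s.reg (2 * l + 1) = ρ.getD i 0 := by
  induction h generalizing i with
  | nil => simp
  | cons h _ ih =>
    cases i with
    | zero => right; simpa using h
    | succ i => simpa using ih i

/-- The effect of a compiled expression. -/
structure Computes (P : Program) (s : RAMState) (d T v : ℕ) (s' : RAMState) : Prop where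
  runs : ∃ t, Runs P s t s' ∧ t ≤ T
  mem : s'.mem = s.mem
  vars : ∀ r, s'.reg (2 * r) = s.reg (2 * r)
  locals : ∀ l < d, s'.reg (2 * l + 1) = s.reg (2 * l + 1)
  value : s'.reg (2 * d + 1) = v

/-- Each iteration lengthens the value by at most `b.growth N` bits, whatever the current bit bound
is; hence growth in a loop is additive and stays polynomial. -/
theorem iterate_lt {a b : Expr} {s : Store} {N m : ℕ} {ρ : List ℕ} (hN : N < 2 ^ m)
    (ha : a.eval s ρ < 2 ^ (m + a.growth N))
    (hv : ∀ r, s.var r < 2 ^ m) (hm : ∀ a, s.mem a < 2 ^ m) (hρ : ∀ x ∈ ρ, x < 2 ^ m)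
    (hb : ∀ {m : ℕ} {ρ : List ℕ}, (∀ r, s.var r < 2 ^ m) → (∀ a, s.mem a < 2 ^ m) →
      (∀ x ∈ ρ, x < 2 ^ m) → b.eval s ρ < 2 ^ (m + b.growth N)) (j : ℕ) (hj : j ≤ N) :
    Nat.rec (motive := fun _ => ℕ) (a.eval s ρ) (fun i x => b.eval s (i :: x :: ρ)) j <
      2 ^ (m + (a.growth N + j * b.growth N)) := by
  induction j with
  | zero => simpa using ha
  | succ j ih =>
    have ih := ih (by omega)
    refine lt_two_pow_of_le (hb (m := m + (a.growth N + j * b.growth N))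
      (fun r => lt_two_pow_of_le (hv r) (by omega))
      (fun r => lt_two_pow_of_le (hm r) (by omega)) ?_) (by rw [Nat.succ_mul]; omega)
    simp only [List.mem_cons]
    rintro x (rfl | rfl | h)
    · exact lt_two_pow_of_le (show x < 2 ^ m by omega) (by omega)
    · exact ih
    · exact lt_two_pow_of_le (hρ _ h) (by omega)

theorem eval_lt (e : Expr) (s : Store) {N m : ℕ} {ρ : List ℕ} (hN : s.var 0 = N)
    (hv : ∀ r, s.var r < 2 ^ m) (hm : ∀ a, s.mem a < 2 ^ m) (hρ : ∀ x ∈ ρ, x < 2 ^ m) :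
    e.eval s ρ < 2 ^ (m + e.growth N) := by
  induction e generalizing m ρ with
  | glob r => simpa [eval, growth] using hv r
  | var i =>
    simp only [eval, growth, add_zero]
    rcases lt_or_ge i ρ.length with h | h
    · rw [List.getD_eq_getElem _ _ h]; exact hρ _ (List.getElem_mem h)
    · rw [List.getD_eq_default _ _ h]; positivity
  | const c =>
    exact lt_two_pow_of_le (Nat.lt_size_self c) (by simp [growth])
  | add a b ha hb =>
    have h1 := lt_two_pow_of_le (ha hv hm hρ) (show m + a.growth N ≤
      m + a.growth N + b.growth N by omega)
    have h2 := lt_two_pow_of_le (hb hv hm hρ) (show m + b.growth N ≤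
      m + a.growth N + b.growth N by omega)
    simp only [eval, growth]
    rw [← add_assoc, ← add_assoc, pow_succ]
    omega
  | sub a b ha hb =>
    have h1 := lt_two_pow_of_le (ha hv hm hρ) (show m + a.growth N ≤
      m + (a.growth N + b.growth N) by omega)
    simp only [eval, growth]
    omega
  | load a ha => exact lt_two_pow_of_le (hm _) (by omega)
  | ite c a b hc ha hb =>
    simp only [eval, growth]
    split_ifs
    · exact lt_two_pow_of_le (hb hv hm hρ) (by omega)
    · exact lt_two_pow_of_le (ha hv hm hρ) (by omega)
  | let2 a b e ha hb he =>
    simp only [eval, growth]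
    refine lt_two_pow_of_le (he (m := m + a.growth N + b.growth N)
      (fun r => lt_two_pow_of_le (hv r) (by omega))
      (fun r => lt_two_pow_of_le (hm r) (by omega)) ?_) (by omega)
    simp only [List.mem_cons]
    rintro x (rfl | rfl | h)
    · exact lt_two_pow_of_le (hb hv hm hρ) (by omega)
    · exact lt_two_pow_of_le (ha hv hm hρ) (by omega)
    · exact lt_two_pow_of_le (hρ _ h) (by omega)
  | loop a b ha hb =>
    simp only [eval, growth]
    rw [hN]
    have hN2 : N < 2 ^ m := hN ▸ hv 0
    exact iterate_lt hN2 (ha hv hm hρ) hv hm hρ hb N le_rfl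

/-- The iterations of a loop. -/
theorem runs_loop {b : Expr} {st : Store} {N m B d : ℕ} {env ρ : List ℕ}
    (hNm : N < 2 ^ m) (T : ℕ)
    (x : ℕ → ℕ) (hx : ∀ i, x (i + 1) = b.eval st (i :: x i :: ρ)) (hxB : ∀ i ≤ N, x i < 2 ^ B)
    (hb : ∀ s : RAMState, (∀ r, s.reg (2 * r) = st.var r) → s.mem = st.mem →
      ∀ i < N, Env s (d + 3) ((d + 1) :: d :: env) (i :: x i :: ρ) →
      ∃ s', Computes (b.compile ((d + 1) :: d :: env) (d + 3)) s (d + 3) T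
        (b.eval st (i :: x i :: ρ)) s')
    (j : ℕ) (hj : j ≤ N) (s : RAMState) (hs : ∀ r, s.reg (2 * r) = st.var r)
    (hmem : s.mem = st.mem) (henv : Env s d env ρ) (hacc : s.reg (2 * d + 1) = x (N - j))
    (hidx : s.reg (2 * d + 3) = N - j) (hcnt : s.reg (2 * d + 5) = j) :
    ∃ s', Computes (.loop (2 * d + 5) (.seq (b.compile ((d + 1) :: d :: env) (d + 3))
        (.seq (copy (2 * d + 1) (2 * d + 7)) (.seq (.instr (.const (2 * d + 7) 1))
          (.seq (.instr (.add (2 * d + 3) (2 * d + 3) (2 * d + 7)))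
            (.instr (.sub (2 * d + 5) (2 * d + 5) (2 * d + 7)))))))) s d
      (j * (T + B + 3 * m + 10) + 1) (x N) s' := by
  induction j generalizing s with
  | zero =>
    refine ⟨s, ⟨_, .loop_zero hcnt, by simp [hcnt]⟩, rfl, fun _ => rfl, fun _ _ => rfl, ?_⟩
    simpa using hacc
  | succ j ih =>
    -- The counter holds the number of iterations still to come, so the present one has index `N -
    -- (j + 1)`.
    have e1 : N - (j + 1) + 1 = N - j := by omega
    obtain ⟨s1, ⟨t1, hr1, ht1⟩, hm1, hv1, hl1, hval1⟩ := hb s hs hmem (N - (j + 1)) (by omega)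
      (.cons ⟨by omega, hidx⟩ (.cons ⟨by omega, hacc⟩ (henv.mono (by omega) fun _ _ => rfl)))
    rw [← hx, e1] at hval1
    obtain ⟨t2, s2, hr2, ht2, hm2, hreg2⟩ := runs_copy (d := 2 * d + 1) (r := 2 * d + 7) (m := B)
      (by omega) s1 (by rw [show 2 * d + 7 = 2 * (d + 3) + 1 by ring, hval1]; exact hxB _ (by omega))
    have hidx2 : s2.reg (2 * d + 3) = N - (j + 1) := by
      rw [hreg2, Function.update_of_ne (by omega), ← hidx]
      exact hl1 (d + 1) (by omega)
    have hcnt2 : s2.reg (2 * d + 5) = j + 1 := by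
      rw [hreg2, Function.update_of_ne (by omega), ← hcnt]
      exact hl1 (d + 2) (by omega)
    obtain ⟨s3, hs3⟩ : ∃ s3, s3 = Instr.eval (.sub (2 * d + 5) (2 * d + 5) (2 * d + 7))
      (Instr.eval (.add (2 * d + 3) (2 * d + 3) (2 * d + 7))
        (Instr.eval (.const (2 * d + 7) 1) s2)) := ⟨_, rfl⟩
    have hreg3 : ∀ r, r ≠ 2 * d + 3 → r ≠ 2 * d + 5 → r ≠ 2 * d + 7 → s3.reg r = s2.reg r := by
      intro r h1 h2 h3
      simp [hs3, Instr.eval, Function.update_of_ne h1, Function.update_of_ne h2,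
        Function.update_of_ne h3]
    have hreg3' : ∀ r, r ≠ 2 * d + 1 → r ≠ 2 * d + 3 → r ≠ 2 * d + 5 → r ≠ 2 * d + 7 →
        s3.reg r = s1.reg r := by
      intro r h0 h1 h2 h3
      rw [hreg3 r h1 h2 h3, hreg2, Function.update_of_ne h0]
    have hm3 : s3.mem = st.mem := by
      rw [hs3]
      simp only [Instr.eval]
      rw [hm2, hm1, hmem]
    obtain ⟨s4, ⟨t4, hr4, ht4⟩, hm4, hv4, hl4, hval4⟩ := ih (by omega) s3
      (fun r => by rw [hreg3' _ (by omega) (by omega) (by omega) (by omega), hv1, hs]) hm3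
      (henv.mono le_rfl fun l hl => by
        rw [hreg3' _ (by omega) (by omega) (by omega) (by omega), hl1 _ (by omega)])
      (by
        rw [hreg3 _ (by omega) (by omega) (by omega), hreg2, Function.update_self]
        exact hval1)
      (by
        simp only [hs3, Instr.eval]
        rw [Function.update_of_ne (by omega), Function.update_self,
          Function.update_of_ne (by omega), Function.update_self, hidx2]
        exact e1)
      (by
        simp only [hs3, Instr.eval]
        rw [Function.update_self, Function.update_of_ne (by omega),
          Function.update_of_ne (by omega), Function.update_of_ne (by omega),
          Function.update_self, hcnt2]
        rfl)
    refine ⟨s4, ⟨_, .loop_pos (by omega) (.seq hr1 (.seq hr2 (.seq (.instr _ _)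
      (.seq (.instr _ _) (.instr _ _))))) (hs3 ▸ hr4), ?_⟩, ?_, ?_, ?_, hval4⟩
    · have k1 : (s.reg (2 * d + 5)).size ≤ m := size_le_of_lt (by omega)
      have k2 : (N - (j + 1)).size ≤ m := size_le_of_lt (by omega)
      have k3 : (j + 1).size ≤ m := size_le_of_lt (by omega)
      simp only [Instr.cost, Instr.eval, Function.update_self]
      rw [Function.update_of_ne (by omega), hidx2, Function.update_of_ne (by omega),
        Function.update_of_ne (by omega), Function.update_of_ne (by omega), hcnt2,
        Function.update_self]
      simp only [Nat.size_one]
      have k4 := Nat.add_one_mul j (T + B + 3 * m + 10)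
      omega
    · rw [hm4, hm3, hmem]
    · intro r
      rw [hv4, hreg3' _ (by omega) (by omega) (by omega) (by omega), hv1]
    · intro l hl
      rw [hl4 l hl, hreg3' _ (by omega) (by omega) (by omega) (by omega), hl1 _ (by omega)]

theorem compile_computes (e : Expr) (st : Store) {N m d : ℕ} {env ρ : List ℕ} {s : RAMState}
    (hN : st.var 0 = N) (hs : ∀ r, s.reg (2 * r) = st.var r) (hmem : s.mem = st.mem)
    (henv : Env s d env ρ)
    (hv : ∀ r, st.var r < 2 ^ m) (hm : ∀ a, st.mem a < 2 ^ m) (hρ : ∀ x ∈ ρ, x < 2 ^ m) :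
    ∃ s', Computes (e.compile env d) s d (e.cost N m) (e.eval st ρ) s' := by
  induction e generalizing m d env ρ s with
  | glob r =>
    obtain ⟨t, s', h1, h2, h3, h4⟩ := runs_copy (d := 2 * d + 1) (r := 2 * r) (by omega) s
      ((hs r).trans_lt (hv r))
    refine ⟨s', ⟨t, h1, h2⟩, h3, fun q => ?_, fun l hl => ?_, ?_⟩
    · rw [h4, Function.update_of_ne (by omega)]
    · rw [h4, Function.update_of_ne (by omega)]
    · rw [h4, Function.update_self, hs]; rfl
  | var i =>
    rcases henv.getElem i with ⟨h1, h2⟩ | ⟨l, h1, h2, h3⟩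
    · have hc : (var i).compile env d = .instr (.const (2 * d + 1) 0) := by simp [compile, h1]
      rw [hc]
      refine ⟨_, ⟨_, .instr _ _, ?_⟩, rfl, fun q => ?_, fun l hl => ?_, ?_⟩
      · simp only [Instr.cost, cost, Nat.size_zero]; omega
      · exact Function.update_of_ne (by omega) _ _
      · exact Function.update_of_ne (by omega) _ _
      · simp only [Instr.eval, eval, h2]; exact Function.update_self _ _ _
    · have hlt : ρ.getD i 0 < 2 ^ m := by
        simpa [eval, growth] using eval_lt (.var i) st hN hv hm hρ
      obtain ⟨t, s', k1, k2, k3, k4⟩ := runs_copy (d := 2 * d + 1) (r := 2 * l + 1) (by omega) s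
        (h3.trans_lt hlt)
      refine ⟨s', ⟨t, by rw [compile, h1]; exact k1, k2⟩, k3, fun q => ?_, fun l hl => ?_, ?_⟩
      · rw [k4, Function.update_of_ne (by omega)]
      · rw [k4, Function.update_of_ne (by omega)]
      · rw [k4, Function.update_self, h3]; rfl
  | const c =>
    refine ⟨_, ⟨_, .instr _ _, le_rfl⟩, rfl, fun q => ?_, fun l hl => ?_, ?_⟩
    · exact Function.update_of_ne (by omega) _ _
    · exact Function.update_of_ne (by omega) _ _
    · exact Function.update_self _ _ _
  | add a b ha hb =>
    obtain ⟨s1, ⟨t1, hr1, ht1⟩, hm1, hv1, hl1, hval1⟩ := ha hs hmem henv hv hm hρ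
    obtain ⟨s2, ⟨t2, hr2, ht2⟩, hm2, hv2, hl2, hval2⟩ := hb (d := d + 1) (s := s1)
      (fun r => by rw [hv1, hs]) (by rw [hm1, hmem]) (henv.mono (by omega) hl1) hv hm hρ
    have g1 := size_le_of_lt (eval_lt a st hN hv hm hρ)
    have g2 := size_le_of_lt (eval_lt b st hN hv hm hρ)
    rw [← hl2 d (by omega)] at hval1
    refine ⟨_, ⟨_, .seq hr1 (.seq hr2 (.instr _ _)), ?_⟩, ?_, fun q => ?_, fun l hl => ?_, ?_⟩
    · simp only [Instr.cost, cost]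
      rw [hval1, show 2 * d + 3 = 2 * (d + 1) + 1 by ring, hval2]
      omega
    · rw [← hm1, ← hm2]; rfl
    · rw [← hv1, ← hv2]; exact Function.update_of_ne (by omega) _ _
    · rw [← hl1 l hl, ← hl2 l (by omega)]; exact Function.update_of_ne (by omega) _ _
    · refine (Function.update_self _ _ _).trans ?_
      rw [hval1, show 2 * d + 3 = 2 * (d + 1) + 1 by ring, hval2]; rfl
  | sub a b ha hb =>
    obtain ⟨s1, ⟨t1, hr1, ht1⟩, hm1, hv1, hl1, hval1⟩ := ha hs hmem henv hv hm hρ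
    obtain ⟨s2, ⟨t2, hr2, ht2⟩, hm2, hv2, hl2, hval2⟩ := hb (d := d + 1) (s := s1)
      (fun r => by rw [hv1, hs]) (by rw [hm1, hmem]) (henv.mono (by omega) hl1) hv hm hρ
    have g1 := size_le_of_lt (eval_lt a st hN hv hm hρ)
    have g2 := size_le_of_lt (eval_lt b st hN hv hm hρ)
    rw [← hl2 d (by omega)] at hval1
    refine ⟨_, ⟨_, .seq hr1 (.seq hr2 (.instr _ _)), ?_⟩, ?_, fun q => ?_, fun l hl => ?_, ?_⟩
    · simp only [Instr.cost, cost]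
      rw [hval1, show 2 * d + 3 = 2 * (d + 1) + 1 by ring, hval2]
      omega
    · rw [← hm1, ← hm2]; rfl
    · rw [← hv1, ← hv2]; exact Function.update_of_ne (by omega) _ _
    · rw [← hl1 l hl, ← hl2 l (by omega)]; exact Function.update_of_ne (by omega) _ _
    · refine (Function.update_self _ _ _).trans ?_
      rw [hval1, show 2 * d + 3 = 2 * (d + 1) + 1 by ring, hval2]; rfl
  | load a ha =>
    obtain ⟨s1, ⟨t1, hr1, ht1⟩, hm1, hv1, hl1, hval1⟩ := ha hs hmem henv hv hm hρ
    have g1 := size_le_of_lt (eval_lt a st hN hv hm hρ)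
    refine ⟨_, ⟨_, .seq hr1 (.instr _ _), ?_⟩, hm1, fun q => ?_, fun l hl => ?_, ?_⟩
    · have g2 := size_le_of_lt (hm (a.eval st ρ))
      simp only [Instr.cost, cost]
      rw [hval1, hm1, hmem]
      omega
    · rw [← hv1]; exact Function.update_of_ne (by omega) _ _
    · rw [← hl1 l hl]; exact Function.update_of_ne (by omega) _ _
    · refine (Function.update_self _ _ _).trans ?_
      rw [hval1, hm1, hmem]; rfl
  | ite c a b hc ha hb =>
    obtain ⟨s1, ⟨t1, hr1, ht1⟩, hm1, hv1, hl1, hval1⟩ := hc hs hmem henv hv hm hρ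
    have g1 := size_le_of_lt (eval_lt c st hN hv hm hρ)
    have hs1 : ∀ r, s1.reg (2 * r) = st.var r := fun r => by rw [hv1, hs]
    have hmem1 : s1.mem = st.mem := by rw [hm1, hmem]
    have henv1 := henv.mono (s' := s1) le_rfl hl1
    by_cases h0 : c.eval st ρ = 0
    · obtain ⟨s2, ⟨t2, hr2, ht2⟩, hm2, hv2, hl2, hval2⟩ := hb hs1 hmem1 henv1 hv hm hρ
      refine ⟨s2, ⟨_, .seq hr1 (.cond_zero (hval1.trans h0) hr2), ?_⟩, hm2.trans hm1, fun r => ?_, fun l hl => ?_,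
        ?_⟩
      · simp only [cost]; rw [hval1]; omega
      · rw [hv2, hv1]
      · rw [hl2 l hl, hl1 l hl]
      · rw [hval2, eval, if_pos h0]
    · obtain ⟨s2, ⟨t2, hr2, ht2⟩, hm2, hv2, hl2, hval2⟩ := ha hs1 hmem1 henv1 hv hm hρ
      refine ⟨s2, ⟨_, .seq hr1 (.cond_pos (hval1.trans_ne h0) hr2), ?_⟩, hm2.trans hm1,
        fun r => ?_, fun l hl => ?_, ?_⟩
      · simp only [cost]; rw [hval1]; omega
      · rw [hv2, hv1]
      · rw [hl2 l hl, hl1 l hl]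
      · rw [hval2, eval, if_neg h0]
  | let2 a b e ha hb he =>
    obtain ⟨s1, ⟨t1, hr1, ht1⟩, hm1, hv1, hl1, hval1⟩ := ha hs hmem henv hv hm hρ
    obtain ⟨s2, ⟨t2, hr2, ht2⟩, hm2, hv2, hl2, hval2⟩ := hb (d := d + 1) (s := s1)
      (fun r => by rw [hv1, hs]) (by rw [hm1, hmem]) (henv.mono (by omega) hl1) hv hm hρ
    rw [← hl2 d (by omega)] at hval1
    have hρ' : ∀ x ∈ b.eval st ρ :: a.eval st ρ :: ρ, x < 2 ^ (m + a.growth N + b.growth N) := by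
      simp only [List.mem_cons]
      rintro x (rfl | rfl | h)
      · exact lt_two_pow_of_le (b.eval_lt st hN hv hm hρ) (by omega)
      · exact lt_two_pow_of_le (a.eval_lt st hN hv hm hρ) (by omega)
      · exact lt_two_pow_of_le (hρ _ h) (by omega)
    have hv' : ∀ r, st.var r < 2 ^ (m + a.growth N + b.growth N) :=
      fun r => lt_two_pow_of_le (hv r) (by omega)
    have hm' : ∀ r, st.mem r < 2 ^ (m + a.growth N + b.growth N) :=
      fun r => lt_two_pow_of_le (hm r) (by omega)
    obtain ⟨s3, ⟨t3, hr3, ht3⟩, hm3, hv3, hl3, hval3⟩ := he (d := d + 2) (s := s2)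
      (env := (d + 1) :: d :: env)
      (ρ := b.eval st ρ :: a.eval st ρ :: ρ)
      (fun r => by rw [hv2, hv1, hs]) (by rw [hm2, hm1, hmem])
      (.cons ⟨by omega, hval2⟩ (.cons ⟨by omega, hval1⟩ ((henv.mono (by omega) hl1).mono
        (by omega) hl2))) hv' hm' hρ'
    have g3 := e.eval_lt st hN hv' hm' hρ'
    rw [← hval3] at g3
    obtain ⟨t4, s4, k1, k2, k3, k4⟩ := runs_copy (d := 2 * d + 1) (r := 2 * d + 5) (by omega) s3 g3
    refine ⟨s4, ⟨_, .seq hr1 (.seq hr2 (.seq hr3 k1)), ?_⟩, ?_, fun r => ?_, fun l hl => ?_, ?_⟩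
    · simp only [cost]; omega
    · rw [k3, hm3, hm2, hm1]
    · rw [k4, Function.update_of_ne (by omega), hv3, hv2, hv1]
    · rw [k4, Function.update_of_ne (by omega), hl3 _ (by omega), hl2 _ (by omega), hl1 _ hl]
    · rw [k4, Function.update_self]
      exact hval3
  | loop a b ha hb =>
    obtain ⟨s1, ⟨t1, hr1, ht1⟩, hm1, hv1, hl1, hval1⟩ := ha hs hmem henv hv hm hρ
    have hN2 : N < 2 ^ m := hN ▸ hv 0
    obtain ⟨s2, hs2⟩ : ∃ s2, s2 = Instr.eval (.const (2 * d + 3) 0) s1 := ⟨_, rfl⟩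
    have hreg2 : s2.reg = Function.update s1.reg (2 * d + 3) 0 := by rw [hs2]; rfl
    have hreg0 : s2.reg 0 = N := by
      rw [hreg2, Function.update_of_ne (by omega), show (0 : ℕ) = 2 * 0 from rfl, hv1, hs, hN]
    obtain ⟨t3, s3, k1, k2, k3, k4⟩ := runs_copy (d := 2 * d + 5) (r := 0) (m := m) (by omega) s2
      (by rw [hreg0]; exact hN2)
    have hreg3 : ∀ r, r ≠ 2 * d + 3 → r ≠ 2 * d + 5 → s3.reg r = s1.reg r := by
      intro r h1 h2
      rw [k4, Function.update_of_ne h2, hreg2, Function.update_of_ne h1]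
    -- One bit bound for all intermediate values; the induction hypothesis for the body is applied
    -- at this larger bound.
    have hlt : ∀ j ≤ N, Nat.rec (motive := fun _ => ℕ) (a.eval st ρ)
        (fun i x => b.eval st (i :: x :: ρ)) j < 2 ^ (m + a.growth N + N * b.growth N) := by
      intro j hj
      refine lt_two_pow_of_le (iterate_lt hN2 (a.eval_lt st hN hv hm hρ) hv hm hρ
        (fun h1 h2 h3 => b.eval_lt st hN h1 h2 h3) j hj) ?_
      have := Nat.mul_le_mul_right (b.growth N) hj
      omega
    obtain ⟨s4, ⟨t4, hr4, ht4⟩, hm4, hv4, hl4, hval4⟩ := runs_loop (b := b) (st := st) (N := N) (m := m)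
      (B := m + a.growth N + N * b.growth N) (d := d) (env := env) (ρ := ρ)
      hN2 (b.cost N (m + a.growth N + N * b.growth N))
      (fun j => Nat.rec (a.eval st ρ) (fun i x => b.eval st (i :: x :: ρ)) j) (fun i => rfl)
      hlt (fun s hs hmem i hi henv => hb hs hmem henv
        (fun r => lt_two_pow_of_le (hv r) (by omega))
        (fun r => lt_two_pow_of_le (hm r) (by omega)) (by
          simp only [List.mem_cons]
          rintro x (rfl | rfl | h)
          · exact lt_two_pow_of_le (show x < 2 ^ m by omega) (by omega)
          · exact hlt i (by omega)
          · exact lt_two_pow_of_le (hρ _ h) (by omega))) N le_rfl s3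
      (fun r => by rw [hreg3 _ (by omega) (by omega), hv1, hs])
      (by rw [k3, hs2]; exact hm1.trans hmem)
      (henv.mono le_rfl fun l hl => by rw [hreg3 _ (by omega) (by omega), hl1 l hl])
      (by rw [hreg3 _ (by omega) (by omega), hval1, Nat.sub_self]; rfl)
      (by rw [k4, Function.update_of_ne (by omega), hreg2, Function.update_self, Nat.sub_self])
      (by rw [k4, Function.update_self, hreg0])
    refine ⟨s4, ⟨_, .seq hr1 (.seq (.instr _ _) (.seq (hs2 ▸ k1) hr4)), ?_⟩, ?_, fun r => ?_,
      fun l hl => ?_, ?_⟩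
    · simp only [cost, Instr.cost, Nat.size_zero]
      omega
    · rw [hm4, k3, hs2]; exact hm1
    · rw [hv4, hreg3 _ (by omega) (by omega), hv1]
    · rw [hl4 l hl, hreg3 _ (by omega) (by omega), hl1 l hl]
    · rw [hval4, eval, hN]

end Expr

/-! ### Commands over program variables -/

/-- Commands; `asg` assigns to a program variable, `sto` to a memory cell. -/
inductive Cmd where
  | skip
  | asg (r : ℕ) (e : Expr)
  | sto (a e : Expr)
  | seq (p q : Cmd)
  | ite (e : Expr) (p q : Cmd)
  | whl (e : Expr) (p : Cmd)

/-- Change of a program variable. -/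
def Store.setVar (s : Store) (r x : ℕ) : Store :=
  { s with var := Function.update s.var r x }

/-- Change of a memory cell. -/
def Store.setMem (s : Store) (a x : ℕ) : Store :=
  { s with mem := Function.update s.mem a x }

namespace Cmd

/-- Executions with the number of steps, all assigned values having at most `M` bits. -/
inductive Exec (M : ℕ) : Cmd → Store → ℕ → Store → Prop
  | skip (s : Store) : Exec M .skip s 1 s
  | asg {r : ℕ} {e : Expr} {s : Store} : r ≠ 0 → e.eval s [] < 2 ^ M →
      Exec M (.asg r e) s 1 (s.setVar r (e.eval s []))
  | sto {a e : Expr} {s : Store} : e.eval s [] < 2 ^ M →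
      Exec M (.sto a e) s 1 (s.setMem (a.eval s []) (e.eval s []))
  | seq {p q : Cmd} {s₁ s₂ s₃ : Store} {t₁ t₂ : ℕ} : Exec M p s₁ t₁ s₂ → Exec M q s₂ t₂ s₃ →
      Exec M (.seq p q) s₁ (t₁ + t₂) s₃
  | ite_pos {e : Expr} {p q : Cmd} {s s' : Store} {t : ℕ} : e.eval s [] ≠ 0 → Exec M p s t s' →
      Exec M (.ite e p q) s (1 + t) s'
  | ite_zero {e : Expr} {p q : Cmd} {s s' : Store} {t : ℕ} : e.eval s [] = 0 → Exec M q s t s' →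
      Exec M (.ite e p q) s (1 + t) s'
  | whl_pos {e : Expr} {p : Cmd} {s₁ s₂ s₃ : Store} {t₁ t₂ : ℕ} : e.eval s₁ [] ≠ 0 →
      Exec M p s₁ t₁ s₂ → Exec M (.whl e p) s₂ t₂ s₃ → Exec M (.whl e p) s₁ (1 + t₁ + t₂) s₃
  | whl_zero {e : Expr} {p : Cmd} {s : Store} : e.eval s [] = 0 → Exec M (.whl e p) s 1 s

/-- Translation into programs. -/
def compile : Cmd → Program
  | skip => .instr (.const 1 0)
  | asg r e => .seq (e.compile [] 0) (Expr.copy (2 * r) 1)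
  | sto a e => .seq (a.compile [] 0) (.seq (e.compile [] 1) (.instr (.store 1 3)))
  | seq p q => .seq p.compile q.compile
  | ite e p q => .seq (e.compile [] 0) (.cond 1 p.compile q.compile)
  | whl e p => .seq (e.compile [] 0) (.loop 1 (.seq p.compile (e.compile [] 0)))

/-- A bound for the cost of a step. -/
def unit (N M : ℕ) : Cmd → ℕ
  | skip => 1
  | asg _ e => e.cost N M + (M + e.growth N + 2)
  | sto a e => a.cost N M + e.cost N M + (1 + (M + a.growth N) + (M + e.growth N))
  | seq p q => p.unit N M + q.unit N M
  | ite e p q => e.cost N M + (1 + (M + e.growth N)) + p.unit N M + q.unit N M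
  | whl e p => 2 * e.cost N M + (1 + (M + e.growth N)) + p.unit N M

theorem polyBdd_unit (c : Cmd) {p q : ℕ → ℕ} (hp : PolyBdd p) (hq : PolyBdd q) :
    PolyBdd fun x => c.unit (p x) (q x) := by
  induction c with
  | skip => exact .const 1
  | asg r e =>
    exact (e.polyBdd_cost hp hq).add ((hq.add (e.polyBdd_growth hp)).add (.const 2))
  | sto a e =>
    exact ((a.polyBdd_cost hp hq).add (e.polyBdd_cost hp hq)).add (((PolyBdd.const 1).add
      (hq.add (a.polyBdd_growth hp))).add (hq.add (e.polyBdd_growth hp)))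
  | seq p q h1 h2 => exact h1.add h2
  | ite e p q h1 h2 =>
    exact (((e.polyBdd_cost hp hq).add ((PolyBdd.const 1).add
      (hq.add (e.polyBdd_growth hp)))).add h1).add h2
  | whl e p h =>
    exact (((PolyBdd.const 2).mul (e.polyBdd_cost hp hq)).add ((PolyBdd.const 1).add
      (hq.add (e.polyBdd_growth hp)))).add h

/-- All values have at most `M` bits, and variable `0` is `N`. -/
structure Fits (N M : ℕ) (s : Store) : Prop where
  zero : s.var 0 = N
  var : ∀ r, s.var r < 2 ^ M
  mem : ∀ a, s.mem a < 2 ^ M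

/-- A machine state that represents a store. -/
structure Repr (σ : RAMState) (s : Store) : Prop where
  var : ∀ r, σ.reg (2 * r) = s.var r
  mem : σ.mem = s.mem

theorem Fits.setVar {N M r x : ℕ} {s : Store} (h : Fits N M s) (hr : r ≠ 0) (hx : x < 2 ^ M) :
    Fits N M (s.setVar r x) := by
  refine ⟨by simp [Store.setVar, Function.update_of_ne hr.symm, h.zero], fun q => ?_, h.mem⟩
  by_cases hq : q = r
  · subst hq; simpa [Store.setVar] using hx
  · simpa [Store.setVar, Function.update_of_ne hq] using h.var q

theorem Fits.setMem {N M a x : ℕ} {s : Store} (h : Fits N M s) (hx : x < 2 ^ M) :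
    Fits N M (s.setMem a x) := by
  refine ⟨h.zero, h.var, fun q => ?_⟩
  by_cases hq : q = a
  · subst hq; simpa [Store.setMem] using hx
  · simpa [Store.setMem, Function.update_of_ne hq] using h.mem q

theorem runs_expr (e : Expr) {N M d : ℕ} {σ : RAMState} {s : Store} (hf : Fits N M s)
    (hσ : Repr σ s) :
    ∃ t σ', Runs (e.compile [] d) σ t σ' ∧ t ≤ e.cost N M ∧ Repr σ' s ∧
      (∀ l < d, σ'.reg (2 * l + 1) = σ.reg (2 * l + 1)) ∧
      σ'.reg (2 * d + 1) = e.eval s [] ∧ e.eval s [] < 2 ^ (M + e.growth N) := by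
  obtain ⟨σ', ⟨t, h1, h2⟩, h3, h4, h5, h6⟩ := e.compile_computes s (d := d) (env := []) (ρ := [])
    hf.zero hσ.var hσ.mem .nil hf.var hf.mem (by simp)
  exact ⟨t, σ', h1, h2, ⟨fun r => (h4 r).trans (hσ.var r), h3.trans hσ.mem⟩, h5, h6,
    e.eval_lt s hf.zero hf.var hf.mem (by simp)⟩

/-- Simulation of executions. -/
theorem Exec.runs {c : Cmd} {N M t : ℕ} {s s' : Store} (h : Exec M c s t s')
    (hf : Fits N M s) {σ : RAMState} (hσ : Repr σ s) :
    Fits N M s' ∧ ∃ t' σ', Runs c.compile σ t' σ' ∧ t' ≤ t * c.unit N M ∧ Repr σ' s' := by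
  induction c generalizing s s' t σ with
  | skip =>
    cases h
    refine ⟨hf, _, _, .instr _ _, by simp [Instr.cost, unit], fun r => ?_, hσ.mem⟩
    rw [← hσ.var]; exact Function.update_of_ne (by omega) _ _
  | asg r e =>
    cases h with
    | asg hr hlt =>
      obtain ⟨t1, σ1, h1, h2, h3, -, h5, h6⟩ := runs_expr e (d := 0) hf hσ
      obtain ⟨t2, σ2, k1, k2, k3, k4⟩ := runs_copy (d := 2 * r) (r := 1) (by omega) σ1
        (h5.trans_lt h6)
      refine ⟨hf.setVar hr hlt, _, σ2, .seq h1 k1, by simp only [unit]; omega, fun q => ?_,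
        k3.trans h3.mem⟩
      rw [k4]
      by_cases hq : q = r
      · subst hq; simp [Store.setVar]; exact h5
      · rw [Function.update_of_ne (by omega), h3.var]; simp [Store.setVar, Function.update_of_ne hq]
  | sto a e =>
    cases h with
    | sto hlt =>
      obtain ⟨t1, σ1, h1, h2, h3, -, h5, h6⟩ := runs_expr a (d := 0) hf hσ
      obtain ⟨t2, σ2, k1, k2, k3, k4, k5, k6⟩ := runs_expr e (d := 1) hf h3
      have h5' : σ2.reg 1 = a.eval s [] := (k4 0 (by omega)).trans h5
      have k5' : σ2.reg 3 = e.eval s [] := k5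
      refine ⟨hf.setMem hlt, _, _, .seq h1 (.seq k1 (.instr _ _)), ?_, fun q => k3.var q, ?_⟩
      · have := size_le_of_lt h6
        have := size_le_of_lt k6
        simp only [Instr.cost, unit, h5', k5']
        omega
      · simp only [Instr.eval, h5', k5', k3.mem, Store.setMem]
  | seq p q hp hq =>
    cases h with
    | seq h1 h2 =>
      rename_i s2 t1 t2
      obtain ⟨f1, t1', σ1, a1, a2, a3⟩ := hp h1 hf hσ
      obtain ⟨f2, t2', σ2, b1, b2, b3⟩ := hq h2 f1 a3
      refine ⟨f2, _, _, .seq a1 b1, ?_, b3⟩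
      simp only [unit]
      nlinarith [Nat.zero_le (t1 * q.unit N M), Nat.zero_le (t2 * p.unit N M)]
  | ite e p q hp hq =>
    cases h with
    | ite_pos he h =>
      rename_i t
      obtain ⟨t1, σ1, h1, h2, h3, -, h5, h6⟩ := runs_expr e (d := 0) hf hσ
      have h5' : σ1.reg 1 = e.eval s [] := h5
      obtain ⟨f2, t2', σ2, b1, b2, b3⟩ := hp h hf h3
      refine ⟨f2, _, _, .seq h1 (.cond_pos (h5'.trans_ne he) b1), ?_, b3⟩
      have := size_le_of_lt h6
      simp only [unit, h5']
      have e1 : t * p.unit N M ≤ t * (e.cost N M + (1 + (M + e.growth N)) + p.unit N M + q.unit N M) :=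
        Nat.mul_le_mul_left _ (by omega)
      rw [add_mul]
      omega
    | ite_zero he h =>
      rename_i t
      obtain ⟨t1, σ1, h1, h2, h3, -, h5, h6⟩ := runs_expr e (d := 0) hf hσ
      have h5' : σ1.reg 1 = e.eval s [] := h5
      obtain ⟨f2, t2', σ2, b1, b2, b3⟩ := hq h hf h3
      refine ⟨f2, _, _, .seq h1 (.cond_zero (h5'.trans he) b1), ?_, b3⟩
      have := size_le_of_lt h6
      simp only [unit, h5']
      have e1 : t * q.unit N M ≤ t * (e.cost N M + (1 + (M + e.growth N)) + p.unit N M + q.unit N M) :=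
        Nat.mul_le_mul_left _ (by omega)
      rw [add_mul]
      omega
  | whl e p hp =>
    -- The machine loop starts with the test already evaluated in register `1`. The first evaluation
    -- is therefore charged separately, and `1 ≤ t` is recorded to pay for it.
    have key : Fits N M s' ∧ ∀ σ, Repr σ s → σ.reg 1 = e.eval s [] → ∃ t' σ',
        Runs (.loop 1 (.seq p.compile (e.compile [] 0))) σ t' σ' ∧
        t' ≤ t * (e.cost N M + (1 + (M + e.growth N)) + p.unit N M) ∧ 1 ≤ t ∧ Repr σ' s' := by
      clear hσ σ
      generalize hc : Cmd.whl e p = c at h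
      induction h with
      | skip | asg | sto | seq | ite_pos | ite_zero => cases hc
      | whl_zero he =>
        cases hc
        refine ⟨hf, fun σ hσ hv => ⟨_, σ, .loop_zero (hv.trans he), ?_, le_rfl, hσ⟩⟩
        rw [hv, he, Nat.size_zero]
        omega
      | @whl_pos e' p' s1 s2 s3 t1 t2 he h1 h2 ih1 ih2 =>
        cases hc
        -- `Fits` does not mention the machine, so any machine state that represents `s1` will do.
        refine ⟨(ih2 (hp h1 hf (σ := ⟨fun r => s1.var (r / 2), s1.mem⟩)
          ⟨fun r => by simp, rfl⟩).1 rfl).1, fun σ hσ hv => ?_⟩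
        obtain ⟨f2, t2', σ2, b1, b2, b3⟩ := hp h1 hf hσ
        obtain ⟨t3, σ3, c1, c2, c3, -, c5, c6⟩ := runs_expr e (d := 0) f2 b3
        obtain ⟨t4, σ4, d1, d2, d3, d4⟩ := (ih2 f2 rfl).2 σ3 c3 c5
        refine ⟨_, σ4, .loop_pos (hv.trans_ne he) (.seq b1 c1) d1, ?_, by omega, d4⟩
        have g := size_le_of_lt (e.eval_lt s1 (ρ := []) hf.zero hf.var hf.mem (by simp))
        rw [hv]
        have e1 : t1 * p.unit N M ≤ t1 * (e.cost N M + (1 + (M + e.growth N)) + p.unit N M) :=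
          Nat.mul_le_mul_left _ (by omega)
        rw [add_mul, add_mul]
        omega
    obtain ⟨t1, σ1, h1, h2, h3, -, h5, h6⟩ := runs_expr e (d := 0) hf hσ
    obtain ⟨k1, k2⟩ := key
    obtain ⟨t2, σ2, b1, b2, b3, b4⟩ := k2 σ1 h3 h5
    refine ⟨k1, _, _, .seq h1 b1, ?_, b4⟩
    have e1 : 1 * e.cost N M ≤ t * e.cost N M := Nat.mul_le_mul_right _ b3
    have e2 : t * (2 * e.cost N M + (1 + (M + e.growth N)) + p.unit N M) =
      t * (e.cost N M + (1 + (M + e.growth N)) + p.unit N M) + t * e.cost N M := by ring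
    simp only [unit]
    rw [e2]
    omega

/-! ### Total correctness with step bounds -/

/-- From `s`, the command `c` terminates in at most `t` steps with a result that satisfies `Q`. -/
def Tr (M : ℕ) (c : Cmd) (s : Store) (t : ℕ) (Q : Store → Prop) : Prop :=
  ∃ t' ≤ t, ∃ s', Exec M c s t' s' ∧ Q s'

variable {M t t₁ t₂ : ℕ} {p q : Cmd} {s : Store} {Q Q' : Store → Prop}

theorem Tr.imp (h : Tr M p s t Q) (ht : t ≤ t₁) (hQ : ∀ s', Q s' → Q' s') : Tr M p s t₁ Q' :=
  let ⟨t', h1, s', h2, h3⟩ := h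
  ⟨t', h1.trans ht, s', h2, hQ s' h3⟩

theorem Tr.skip (h : Q s) : Tr M .skip s (t + 1) Q :=
  ⟨1, by omega, s, .skip s, h⟩

theorem Tr.asg {r x : ℕ} {e : Expr} (hr : r ≠ 0) (he : e.eval s [] = x) (hx : x < 2 ^ M)
    (h : ∀ s' : Store, s'.mem = s.mem → s'.var r = x → (∀ q, q ≠ r → s'.var q = s.var q) → Q s') :
    Tr M (.asg r e) s (t + 1) Q := by
  subst he
  refine ⟨1, by omega, _, .asg hr hx, h _ rfl ?_ fun q hq => ?_⟩
  · simp [Store.setVar]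
  · simp [Store.setVar, hq]

theorem Tr.sto {a e : Expr} {y x : ℕ} (ha : a.eval s [] = y) (he : e.eval s [] = x)
    (hx : x < 2 ^ M) (h : ∀ s' : Store, s'.var = s.var → s'.mem = Function.update s.mem y x → Q s') :
    Tr M (.sto a e) s (t + 1) Q := by
  subst he ha
  exact ⟨1, by omega, _, .sto hx, h _ rfl rfl⟩

theorem Tr.seq (h : Tr M p s t₁ fun s' => Tr M q s' t₂ Q) : Tr M (.seq p q) s (t₁ + t₂) Q := by
  obtain ⟨a, ha, s', h1, b, hb, s'', h2, h3⟩ := h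
  exact ⟨a + b, by omega, s'', .seq h1 h2, h3⟩

theorem Tr.asg_seq {r x : ℕ} {e : Expr} (hr : r ≠ 0) (he : e.eval s [] = x) (hx : x < 2 ^ M)
    (h : ∀ s' : Store, s'.mem = s.mem → s'.var r = x → (∀ q, q ≠ r → s'.var q = s.var q) →
      Tr M q s' t Q) : Tr M (.seq (.asg r e) q) s (t + 1) Q :=
  (Tr.seq (Tr.asg (t := 0) hr he hx h)).imp (by omega) fun _ h => h

theorem Tr.sto_seq {a e : Expr} {y x : ℕ} (ha : a.eval s [] = y) (he : e.eval s [] = x)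
    (hx : x < 2 ^ M) (h : ∀ s' : Store, s'.var = s.var → s'.mem = Function.update s.mem y x →
      Tr M q s' t Q) : Tr M (.seq (.sto a e) q) s (t + 1) Q :=
  (Tr.seq (Tr.sto (t := 0) ha he hx h)).imp (by omega) fun _ h => h

theorem Tr.ite {e : Expr} (hp : e.eval s [] ≠ 0 → Tr M p s t Q)
    (hq : e.eval s [] = 0 → Tr M q s t Q) : Tr M (.ite e p q) s (t + 1) Q := by
  by_cases h : e.eval s [] = 0
  · obtain ⟨a, ha, s', h1, h2⟩ := hq h
    exact ⟨1 + a, by omega, s', .ite_zero h h1, h2⟩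
  · obtain ⟨a, ha, s', h1, h2⟩ := hp h
    exact ⟨1 + a, by omega, s', .ite_pos h h1, h2⟩

/-- The index `m` of the invariant is a variant that bounds the number of iterations; each costs one
more step for its test, and the last test costs the final step. -/
theorem Tr.whl {e : Expr} (I : ℕ → Store → Prop)
    (hbody : ∀ m s, I m s → e.eval s [] ≠ 0 → Tr M p s t fun s' => ∃ m' < m, I m' s')
    {m : ℕ} (hI : I m s) :
    Tr M (.whl e p) s (m * (t + 1) + 1) fun s' => (∃ m', I m' s') ∧ e.eval s' [] = 0 := by
  induction m using Nat.strong_induction_on generalizing s with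
  | _ m ih =>
    by_cases h : e.eval s [] = 0
    · exact ⟨1, by omega, s, .whl_zero h, ⟨m, hI⟩, h⟩
    · obtain ⟨a, ha, s', h1, m', h2, h3⟩ := hbody m s hI h
      obtain ⟨b, hb, s'', k1, k2⟩ := ih m' h2 h3
      have := Nat.mul_le_mul_right (t + 1) (show m' + 1 ≤ m from h2)
      exact ⟨1 + a + b, by rw [Nat.add_one_mul] at this; omega, s'', .whl_pos h h1 k1, k2⟩

end Cmd

/-! ### Sets of vertices as numbers -/

section Enc

variable {n : ℕ}

/-- The number with the binary digits given by `S`. -/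
def enc (S : Finset (Fin n)) : ℕ :=
  ∑ i ∈ S, 2 ^ (i : ℕ)

theorem enc_empty : enc (∅ : Finset (Fin n)) = 0 := rfl

theorem enc_insert {S : Finset (Fin n)} {v : Fin n} (h : v ∉ S) :
    enc (insert v S) = enc S + 2 ^ (v : ℕ) := by
  rw [enc, Finset.sum_insert h, add_comm]; rfl

theorem enc_erase {S : Finset (Fin n)} {v : Fin n} (h : v ∈ S) :
    enc (S.erase v) = enc S - 2 ^ (v : ℕ) := by
  have := enc_insert (Finset.notMem_erase v S)
  rw [Finset.insert_erase h] at this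
  omega

theorem enc_eq_sum_range (S : Finset (Fin n)) :
    enc S = ∑ i ∈ Finset.range n, if h : i < n then if ⟨i, h⟩ ∈ S then 2 ^ i else 0 else 0 := by
  simp [Finset.sum_range, enc, Finset.sum_ite_mem]

/-- The digits of `enc S` below `j`. -/
def lowEnc (S : Finset (Fin n)) (j : ℕ) : ℕ :=
  ∑ i ∈ Finset.range j, if h : i < n then if ⟨i, h⟩ ∈ S then 2 ^ i else 0 else 0

theorem lowEnc_self (S : Finset (Fin n)) : lowEnc S n = enc S := (enc_eq_sum_range S).symm

theorem lowEnc_succ (S : Finset (Fin n)) {j : ℕ} (h : j < n) :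
    lowEnc S (j + 1) = lowEnc S j + if ⟨j, h⟩ ∈ S then 2 ^ j else 0 := by
  rw [lowEnc, Finset.sum_range_succ, dif_pos h]; rfl

theorem lowEnc_lt (S : Finset (Fin n)) (j : ℕ) : lowEnc S j < 2 ^ j := by
  induction j with
  | zero => simp [lowEnc]
  | succ j ih =>
    rw [lowEnc, Finset.sum_range_succ, pow_succ]
    have : lowEnc S j < 2 ^ j := ih
    rw [lowEnc] at this
    split_ifs <;> omega

theorem enc_lt (S : Finset (Fin n)) : enc S < 2 ^ n :=
  lowEnc_self S ▸ lowEnc_lt S n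

theorem enc_univ : enc (Finset.univ : Finset (Fin n)) = 2 ^ n - 1 := by
  rw [enc, Fin.sum_univ_eq_sum_range (fun i => 2 ^ i), Nat.geomSum_eq le_rfl]
  simp

/-- The bit indices of a sum of distinct powers of two give back the exponents. -/
theorem enc_injective : Function.Injective (enc : Finset (Fin n) → ℕ) := by
  intro S T h
  have key : ∀ S : Finset (Fin n), enc S = ∑ i ∈ S.map Fin.valEmbedding, 2 ^ i := by
    intro S; rw [Finset.sum_map]; rfl
  rw [key, key] at h
  have := congrArg (fun m : ℕ => m.bitIndices.toFinset) h
  simp only [Finset.toFinset_bitIndices_sum_two_pow] at this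
  exact Finset.map_injective _ this

theorem enc_eq_zero {S : Finset (Fin n)} : enc S = 0 ↔ S = ∅ := by
  rw [← enc_empty, enc_injective.eq_iff]

end Enc

/-! ### A library of expressions -/

namespace Expr

variable {s : Store} {ρ : List ℕ} {n : ℕ}

/-- Negation. -/
def not (e : Expr) : Expr := .sub (.const 1) e

/-- Conjunction. -/
def and (a b : Expr) : Expr := .ite a b (.const 0)

/-- Disjunction. -/
def or (a b : Expr) : Expr := .ite a (.const 1) b

/-- `a ≤ b` -/
def le (a b : Expr) : Expr := not (.sub a b)

/-- `a = b` -/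
def eq (a b : Expr) : Expr := and (le a b) (le b a)

theorem eval_not {e : Expr} {p : Prop} [Decidable p] (h : e.eval s ρ = if p then 1 else 0) :
    (not e).eval s ρ = if ¬ p then 1 else 0 := by
  by_cases hp : p <;> simp [not, eval, h, hp]

theorem eval_and {a b : Expr} {p q : Prop} [Decidable p] [Decidable q]
    (ha : a.eval s ρ = if p then 1 else 0) (hb : b.eval s ρ = if q then 1 else 0) :
    (and a b).eval s ρ = if p ∧ q then 1 else 0 := by
  by_cases hp : p <;> by_cases hq : q <;> simp [and, eval, ha, hb, hp, hq]

theorem eval_or {a b : Expr} {p q : Prop} [Decidable p] [Decidable q]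
    (ha : a.eval s ρ = if p then 1 else 0) (hb : b.eval s ρ = if q then 1 else 0) :
    (or a b).eval s ρ = if p ∨ q then 1 else 0 := by
  by_cases hp : p <;> by_cases hq : q <;> simp [or, eval, ha, hb, hp, hq]

theorem eval_le (a b : Expr) :
    (le a b).eval s ρ = if a.eval s ρ ≤ b.eval s ρ then 1 else 0 := by
  simp only [le, not, eval]
  split_ifs <;> omega

theorem eval_eq (a b : Expr) :
    (eq a b).eval s ρ = if a.eval s ρ = b.eval s ρ then 1 else 0 := by
  rw [eq, eval_and (eval_le a b) (eval_le b a)]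
  simp only [← le_antisymm_iff]

/-- Whether `c` holds for some value of local variable `0` below variable `0`. -/
def any (c : Expr) : Expr := .loop (.const 0) (.ite c (.const 1) (.var 1))

/-- The number of values of local variable `0` below variable `0` for which `c` holds. -/
def count (c : Expr) : Expr := .loop (.const 0) (.ite c (.add (.var 1) (.const 1)) (.var 1))

theorem eval_count {c : Expr} {p : Fin n → Prop} [DecidablePred p] (hn : s.var 0 = n)
    (hc : ∀ (i : Fin n) x, c.eval s (i :: x :: ρ) = if p i then 1 else 0) :
    (count c).eval s ρ = (Finset.univ.filter p).card := by
  simp only [count, eval, hn]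
  suffices H : ∀ j ≤ n, Nat.rec (motive := fun _ => ℕ) 0 (fun i x =>
      if c.eval s (i :: x :: ρ) = 0 then (i :: x :: ρ).getD 1 0
      else (i :: x :: ρ).getD 1 0 + 1) j = (Finset.univ.filter fun i : Fin n => i < j ∧ p i).card by
    rw [H n le_rfl]; congr 1; ext i; simp
  intro j
  induction j with
  | zero => intro _; simp
  | succ j ih =>
    intro hj
    simp only [List.getD_cons_succ, List.getD_cons_zero] at ih ⊢
    rw [ih (by omega), hc ⟨j, hj⟩]
    by_cases h : p ⟨j, hj⟩
    · have : (Finset.univ.filter fun i : Fin n => i < j + 1 ∧ p i) =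
          insert ⟨j, hj⟩ (Finset.univ.filter fun i : Fin n => i < j ∧ p i) := by
        ext i
        simp only [Finset.mem_filter, Finset.mem_univ, true_and, Finset.mem_insert, Fin.ext_iff]
        constructor
        · rintro ⟨h1, h2⟩
          by_cases hi : (i : ℕ) = j
          · exact Or.inl hi
          · exact Or.inr ⟨by omega, h2⟩
        · rintro (h1 | h1)
          · exact ⟨by omega, by rwa [show i = ⟨j, hj⟩ from Fin.ext h1]⟩
          · exact ⟨by omega, h1.2⟩
      rw [this, Finset.card_insert_of_notMem (by simp)]
      simp [h]
    · simp only [h, if_false, if_true]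
      congr 1
      ext i
      simp only [Finset.mem_filter, Finset.mem_univ, true_and]
      constructor
      · rintro ⟨h1, h2⟩; exact ⟨by omega, h2⟩
      · rintro ⟨h1, h2⟩
        refine ⟨?_, h2⟩
        by_contra hi
        exact h (by rwa [show i = ⟨j, hj⟩ from Fin.ext (show (i : ℕ) = j by omega)] at h2)

theorem eval_any {c : Expr} {p : Fin n → Prop} [DecidablePred p] [Decidable (∃ i, p i)]
    (hn : s.var 0 = n)
    (hc : ∀ (i : Fin n) x, c.eval s (i :: x :: ρ) = if p i then 1 else 0) :
    (any c).eval s ρ = if ∃ i, p i then 1 else 0 := by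
  classical
  simp only [any, eval, hn]
  suffices H : ∀ j ≤ n, Nat.rec (motive := fun _ => ℕ) 0 (fun i x =>
      if c.eval s (i :: x :: ρ) = 0 then (i :: x :: ρ).getD 1 0
      else 1) j = if ∃ i : Fin n, i < j ∧ p i then 1 else 0 by
    rw [H n le_rfl]; congr 1; simp
  intro j
  induction j with
  | zero => intro _; simp
  | succ j ih =>
    intro hj
    simp only [List.getD_cons_succ, List.getD_cons_zero] at ih ⊢
    rw [ih (by omega), hc ⟨j, hj⟩]
    by_cases h : p ⟨j, hj⟩
    · rw [if_pos h, if_neg one_ne_zero, if_pos ⟨⟨j, hj⟩, by simp, h⟩]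
    · simp only [h, if_false, if_true]
      congr 1
      refine propext (exists_congr fun i => ⟨fun ⟨h1, h2⟩ => ⟨by omega, h2⟩, fun ⟨h1, h2⟩ => ?_⟩)
      refine ⟨?_, h2⟩
      by_contra hi
      exact h (by rwa [show i = ⟨j, hj⟩ from Fin.ext (show (i : ℕ) = j by omega)] at h2)

/-- A power of `2` with an exponent of at most variable `0`. -/
def pow2 (e : Expr) : Expr :=
  .let2 e (.const 0) (.loop (.const 1)
    (.ite (.sub (.var 3) (.var 0)) (.add (.var 1) (.var 1)) (.var 1)))

/-- Every loop runs `n` times; doubling simply stops once the exponent is reached. -/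
theorem eval_pow2 {e : Expr} (hn : s.var 0 = n) (he : e.eval s ρ ≤ n) :
    (pow2 e).eval s ρ = 2 ^ e.eval s ρ := by
  simp only [pow2, eval, hn, List.getD_cons_succ, List.getD_cons_zero]
  generalize e.eval s ρ = a at *
  suffices H : ∀ j ≤ n, Nat.rec (motive := fun _ => ℕ) 1 (fun i x =>
      if a - i = 0 then x else x + x) j = 2 ^ (min a j) by
    rw [H n le_rfl, min_eq_left he]
  intro j
  induction j with
  | zero => intro _; simp
  | succ j ih =>
    intro hj
    simp only [ih (by omega : j ≤ n)]
    by_cases h : a ≤ j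
    · rw [if_pos (by omega), min_eq_left h, min_eq_left (by omega)]
    · rw [if_neg (by omega), min_eq_right (by omega), min_eq_right (by omega), pow_succ]
      omega

/-- The digit of `x` of index `v`. -/
def bit (x v : Expr) : Expr :=
  .let2 x v (.let2
    (.loop (.var 1) (.ite (.sub (.sub (.sub (.glob 0) (.const 1)) (.var 0)) (.var 2))
      (.let2 (.var 1) (pow2 (.sub (.sub (.glob 0) (.const 1)) (.var 0)))
        (.ite (le (.var 0) (.var 1)) (.sub (.var 1) (.var 0)) (.var 1)))
      (.var 1)))
    (pow2 (.var 0)) (le (.var 0) (.var 1)))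

theorem eval_bit {x v : Expr} (hn : s.var 0 = n) {S : Finset (Fin n)} {i : Fin n}
    (hx : x.eval s ρ = enc S) (hv : v.eval s ρ = i) :
    (bit x v).eval s ρ = if i ∈ S then 1 else 0 := by
  have hi := i.isLt
  simp only [bit, eval, hx, hv, hn, List.getD_cons_succ, List.getD_cons_zero]
  -- The digits above `i` are removed from the top, by subtracting each power of two that fits; a
  -- power fits exactly when its digit is one, because the lower digits sum to less. What is left at
  -- the end is compared with `2 ^ i`.
  have H : ∀ j ≤ n, Nat.rec (motive := fun _ => ℕ) (enc S) (fun t r =>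
      if n - 1 - t - i = 0 then r
      else if (le (.var 0) (.var 1)).eval s
          ((pow2 (.sub (.sub (.glob 0) (.const 1)) (.var 0))).eval s (t :: r :: i :: enc S :: ρ) ::
            r :: t :: r :: i :: enc S :: ρ) = 0 then r
        else (pow2 (.sub (.sub (.glob 0) (.const 1)) (.var 0))).eval s
          (t :: r :: i :: enc S :: ρ) |> fun p => r - p) j = lowEnc S (max (n - j) (i + 1)) := by
    intro j
    induction j with
    | zero => intro _; rw [max_eq_left (by omega), Nat.sub_zero, lowEnc_self]; rfl
    | succ j ih =>
      intro hj
      simp only [ih (by omega : j ≤ n)]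
      by_cases h : n - 1 - j ≤ i
      · rw [if_pos (by omega), max_eq_right (by omega), max_eq_right (by omega)]
      · rw [if_neg (by omega), max_eq_left (by omega), max_eq_left (by omega)]
        rw [eval_pow2 hn (by simp [eval, hn]; omega), eval_le]
        simp only [eval, hn, List.getD_cons_succ, List.getD_cons_zero]
        have hlt : n - (j + 1) < n := by omega
        rw [show n - j = n - (j + 1) + 1 by omega, lowEnc_succ S hlt,
          show n - 1 - j = n - (j + 1) by omega]
        have := lowEnc_lt S (n - (j + 1))
        by_cases hm : ⟨n - (j + 1), hlt⟩ ∈ S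
        · rw [if_pos hm, if_neg (by rw [if_pos (by omega)]; exact one_ne_zero)]; omega
        · rw [if_neg hm, if_pos (by rw [if_neg (by omega)])]; rfl
  have H2 := H n le_rfl
  simp only [] at H2
  rw [eval_le]
  simp only [eval, List.getD_cons_succ, List.getD_cons_zero]
  rw [eval_pow2 hn (by simp [eval])]
  simp only [eval, List.getD_cons_zero]
  rw [H2, max_eq_right (by omega), lowEnc_succ S hi]
  have := lowEnc_lt S i
  by_cases hm : i ∈ S
  · rw [if_pos hm, if_pos hm, if_pos (by omega)]
  · rw [if_neg hm, if_neg hm, if_neg (by omega)]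

/-- The entry of the adjacency matrix for the vertices `u` and `v`. -/
def adj (u v : Expr) : Expr :=
  .let2 u v (.load (.add (.add (.const 1) (.loop (.const 0) (.ite (.sub (.var 3) (.var 0))
    (.add (.var 1) (.glob 0)) (.var 1)))) (.var 0)))

theorem eval_adj {u v : Expr} (hn : s.var 0 = n) (hu : u.eval s ρ ≤ n) :
    (adj u v).eval s ρ = s.mem (1 + u.eval s ρ * n + v.eval s ρ) := by
  simp only [adj, eval, hn, List.getD_cons_succ, List.getD_cons_zero]
  generalize u.eval s ρ = a at *
  suffices H : ∀ j ≤ n, Nat.rec (motive := fun _ => ℕ) 0 (fun i x =>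
      if a - i = 0 then x else x + n) j = min a j * n by
    rw [H n le_rfl, min_eq_left hu]
  intro j
  induction j with
  | zero => intro _; simp
  | succ j ih =>
    intro hj
    simp only [ih (by omega : j ≤ n)]
    by_cases h : a ≤ j
    · rw [if_pos (by omega), min_eq_left h, min_eq_left (by omega)]
    · rw [if_neg (by omega), min_eq_right (by omega), min_eq_right (by omega), Nat.add_one_mul]

/-- The number of outer neighbours of a set. -/
def nbCard (x : Expr) : Expr :=
  .let2 x (.const 0) (count (and (not (bit (.var 3) (.var 0)))
    (any (and (bit (.var 5) (.var 0)) (adj (.var 0) (.var 2))))))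

/-- The weight of a set. -/
def weight (K : ℕ) (x : Expr) : Expr :=
  .add (nbCard x) (.ite (.sub (.glob 1) x) (.const K) (.const 0))

end Expr

open Classical in
/-- The parts of a store that are never changed: number of vertices, full set, block size,
and the adjacency matrix. -/
structure Ctx {n : ℕ} (G : SimpleGraph (Fin n)) (s : Store) : Prop where
  order : s.var 0 = n
  full : s.var 1 = enc (Finset.univ : Finset (Fin n))
  block : s.var 2 = 2 ^ (2 * n + 2)
  adj : ∀ i j : Fin n, s.mem (1 + i * n + j) = if G.Adj i j then 1 else 0

namespace Expr

variable {s : Store} {ρ : List ℕ} {n : ℕ} {G : SimpleGraph (Fin n)}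

open Classical in
theorem eval_adj_ctx (h : Ctx G s) {u v : Expr} {i j : Fin n} (hu : u.eval s ρ = i)
    (hv : v.eval s ρ = j) : (adj u v).eval s ρ = if G.Adj i j then 1 else 0 := by
  rw [eval_adj h.order (by rw [hu]; omega), hu, hv, h.adj]

theorem eval_nbCard (h : Ctx G s) {x : Expr} {S : Finset (Fin n)} (hx : x.eval s ρ = enc S) :
    (nbCard x).eval s ρ = (nb G S).card := by
  classical
  rw [nbCard, eval]
  refine (eval_count (p := fun v => v ∉ S ∧ ∃ u, u ∈ S ∧ G.Adj u v) h.order ?_).trans ?_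
  · intro v y
    refine eval_and (eval_not (eval_bit h.order ?_ ?_)) (eval_any h.order ?_)
    · simpa [eval] using hx
    · simp [eval]
    · intro u z
      refine eval_and (eval_bit h.order ?_ ?_) (eval_adj_ctx h ?_ ?_)
      · simpa [eval] using hx
      · simp [eval]
      · simp [eval]
      · simp [eval]
  · congr 1

theorem eval_weight (h : Ctx G s) {K : ℕ} {x : Expr} {S : Finset (Fin n)}
    (hx : x.eval s ρ = enc S) : (weight K x).eval s ρ = wt G K S := by
  simp only [weight, eval, hx, h.full]
  rw [eval_nbCard h hx, wt]
  congr 1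
  -- Encodings are at most `2 ^ n - 1`, so the truncated difference from the full set vanishes only
  -- for the full set itself.
  by_cases hS : S = Finset.univ
  · subst hS; simp
  · rw [if_neg hS, if_neg]
    have h1 : enc S ≠ enc (Finset.univ : Finset (Fin n)) := fun h => hS (enc_injective h)
    have h2 := enc_lt S
    rw [enc_univ] at h1 ⊢
    omega

end Expr

open LinearWidth.Cmd LinearWidth.Expr

/-! ### The search for light supersets -/

/-- One search step: variable `f` holds `Y` and variable `f + 1` holds `W`. Afterwards variable
`f + 3` holds a set between `Y` and `W` that is reached from `Y`, tight over `Y` and at most as heavy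
as `Y`, or `0` if there is none. The command `p` searches from supersets of `Y`. -/
def lighten (K : ℕ) (p : Cmd) (f : ℕ) : Cmd :=
  .seq (.asg (f + 3) (.const 0)) <| .seq (.asg (f + 5) (.glob (f + 1))) <|
  .seq (.asg (f + 4) (.const 0)) <|
  .whl (.sub (.glob 0) (.glob (f + 4))) <|
  .ite (.and (.bit (.glob (f + 5)) (.glob (f + 4))) (.not (.bit (.glob f) (.glob (f + 4)))))
    (.seq (.asg (f + 10) (.add (.glob f) (.pow2 (.glob (f + 4))))) <|
      .ite (.le (.weight K (.glob (f + 10))) (.glob 15))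
        (.seq (.sto (.add (.glob 2) (.glob (f + 10))) (.add (.glob (f + 4)) (.const 1))) <|
          .seq (.asg (f + 11) (.glob (f + 5))) <|
          .seq (.asg (f + 12) (.weight K (.glob f))) <|
          .seq p <|
          .ite (.le (.weight K (.glob (f + 10))) (.weight K (.glob f)))
            (.seq (.asg (f + 3) (.glob (f + 10))) <|
              .seq (.asg (f + 5) (.sub (.glob (f + 10)) (.pow2 (.glob (f + 4))))) <|
              .asg (f + 4) (.const 0))
            (.asg (f + 4) (.add (.glob (f + 4)) (.const 1))))
        (.asg (f + 4) (.add (.glob (f + 4)) (.const 1))))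
    (.asg (f + 4) (.add (.glob (f + 4)) (.const 1)))

/-- The search from the set in variable `f`, within the set in variable `f + 1`, for a set whose
weight is at most variable `f + 2`. -/
def descend (K : ℕ) : ℕ → ℕ → Cmd
  | 0, _ => .skip
  | j + 1, f =>
    .seq (.asg (f + 6) (.sub (.weight K (.glob f)) (.glob (f + 2)))) <|
    .whl (.glob (f + 6)) <|
    .seq (lighten K (descend K j (f + 10)) f) <|
    .ite (.glob (f + 3))
      (.seq (.asg f (.glob (f + 3)))
        (.asg (f + 6) (.sub (.weight K (.glob f)) (.glob (f + 2)))))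
      (.asg (f + 6) (.const 0))

/-- Number of steps of `lighten`. -/
def lightenSteps (n t : ℕ) : ℕ := ((n + 1) * (n + 1)) * (t + 13) + 4

/-- Number of steps of `descend`. -/
def descendSteps (n : ℕ) : ℕ → ℕ
  | 0 => 1
  | j + 1 => (n + 1) * (lightenSteps n (descendSteps n j) + 4) + 2

theorem polyBdd_lightenSteps {t : ℕ → ℕ} (ht : PolyBdd t) :
    PolyBdd fun n => lightenSteps n (t n) :=
  (((PolyBdd.id.add (.const 1)).mul (PolyBdd.id.add (.const 1))).mul
    (ht.add (.const 13))).add (.const 4)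

theorem polyBdd_descendSteps (j : ℕ) : PolyBdd fun n => descendSteps n j := by
  induction j with
  | zero => exact .const 1
  | succ j ih =>
    exact ((PolyBdd.id.add (.const 1)).mul ((polyBdd_lightenSteps ih).add (.const 4))).add
      (.const 2)

/-! ### The tables in memory and the specification of the searches -/

variable {n : ℕ} {G : SimpleGraph (Fin n)} {K c M : ℕ}

/-- The size of a block of the memory. -/
def blk (n : ℕ) : ℕ := 2 ^ (2 * n + 2)

/-- The set `X` is marked in the table of reached sets. -/
def Marked (m : ℕ → ℕ) (X : Finset (Fin n)) : Prop := m (blk n + enc X) ≠ 0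

/-- All marked sets are reached from the empty set; the table holds the last vertices. -/
def Table (G : SimpleGraph (Fin n)) (K c : ℕ) (m : ℕ → ℕ) : Prop :=
  ∀ X : Finset (Fin n), Marked m X → X = ∅ ∨
    ∃ v ∈ X, m (blk n + enc X) = v + 1 ∧ Marked m (X.erase v) ∧ wt G K X ≤ c

/-- The possible changes of a store in a search that uses variables from `f` on. -/
structure Step (G : SimpleGraph (Fin n)) (K c f : ℕ) (s s' : Store) : Prop where
  var : ∀ r < f, s'.var r = s.var r
  mem : ∀ a, a < blk n ∨ 2 * blk n ≤ a → s'.mem a = s.mem a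
  marked : ∀ X : Finset (Fin n), Marked s.mem X → Marked s'.mem X
  table : Table G K c s.mem → Table G K c s'.mem

theorem Step.refl (f : ℕ) (s : Store) : Step G K c f s s :=
  ⟨fun _ _ => rfl, fun _ _ => rfl, fun _ h => h, fun h => h⟩

theorem Step.trans {f : ℕ} {s s' s'' : Store} (h : Step G K c f s s') (h' : Step G K c f s' s'') :
    Step G K c f s s'' :=
  ⟨fun r hr => (h'.var r hr).trans (h.var r hr), fun a ha => (h'.mem a ha).trans (h.mem a ha),
    fun X hX => h'.marked X (h.marked X hX), fun ht => h'.table (h.table ht)⟩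

theorem Step.mono {f f' : ℕ} {s s' : Store} (h : Step G K c f' s s') (hf : f ≤ f') :
    Step G K c f s s' :=
  ⟨fun r hr => h.var r (hr.trans_le hf), h.mem, h.marked, h.table⟩

theorem Step.of_var {f r : ℕ} {s s' : Store} (hm : s'.mem = s.mem) (hr : f ≤ r)
    (hv : ∀ q, q ≠ r → s'.var q = s.var q) : Step G K c f s s' :=
  ⟨fun q hq => hv q (by omega), fun _ _ => by rw [hm], fun _ h => by rwa [hm],
    fun h => by rwa [hm]⟩

theorem enc_lt_blk (X : Finset (Fin n)) : enc X < blk n :=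
  (enc_lt X).trans_le (Nat.pow_le_pow_right (by omega) (by omega))

/-- A set is marked only through a marked predecessor with one vertex less. Overwriting an older
entry is harmless, since following last vertices always decreases the set. -/
theorem Step.of_mark {f : ℕ} {s s' : Store} {X : Finset (Fin n)} {v : Fin n}
    (hv : s'.var = s.var) (hm : s'.mem = Function.update s.mem (blk n + enc X) (v + 1))
    (hvX : v ∈ X) (hX : Marked s.mem (X.erase v)) (hw : wt G K X ≤ c) : Step G K c f s s' := by
  have hX' : s'.mem (blk n + enc X) = v + 1 := by rw [hm, Function.update_self]
  have hne : ∀ Y : Finset (Fin n), Y ≠ X → s'.mem (blk n + enc Y) = s.mem (blk n + enc Y) := by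
    intro Y hY
    rw [hm, Function.update_of_ne]
    have : enc Y ≠ enc X := fun h => hY (enc_injective h)
    omega
  have hmark : ∀ Y : Finset (Fin n), Marked s.mem Y → Marked s'.mem Y := by
    intro Y hY
    by_cases h : Y = X
    · subst h; rw [Marked, hX']; omega
    · rwa [Marked, hne Y h]
  refine ⟨fun r _ => by rw [hv], fun a ha => ?_, hmark, fun ht Y hY => ?_⟩
  · have := enc_lt_blk X
    rw [hm, Function.update_of_ne (by omega)]
  · by_cases h : Y = X
    · subst h
      exact Or.inr ⟨v, hvX, hX', hmark _ hX, hw⟩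
    · rw [Marked, hne Y h] at hY
      rcases ht Y hY with h1 | ⟨u, hu, h1, h2, h3⟩
      · exact Or.inl h1
      · exact Or.inr ⟨u, hu, by rw [hne Y h, h1], hmark _ h2, h3⟩

/-- The input fits into the first block, below the table of reached sets, the visited table, the
queue and the edges put out. -/
theorem sq_lt_blk (n : ℕ) : n * n + n + 2 < blk n := by
  have h : n < 2 ^ n := Nat.lt_two_pow_self
  have : blk n = 2 ^ n * 2 ^ n * 4 := by rw [blk, pow_add, two_mul, pow_add]; norm_num
  rw [this]
  nlinarith

theorem Ctx.of_agree {s s' : Store} (h : Ctx G s) (hv : ∀ r < 3, s'.var r = s.var r)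
    (hm : ∀ a < blk n, s'.mem a = s.mem a) : Ctx G s' := by
  refine ⟨by rw [hv 0 (by omega), h.order], by rw [hv 1 (by omega), h.full],
    by rw [hv 2 (by omega), h.block], fun i j => ?_⟩
  rw [hm, h.adj]
  have h1 := sq_lt_blk n
  have h2 : (i : ℕ) * n ≤ n * n := Nat.mul_le_mul_right n i.isLt.le
  have := j.isLt
  omega

theorem Step.ctx {f : ℕ} {s s' : Store} (h : Step G K c f s s') (hf : 3 ≤ f) (hc : Ctx G s) :
    Ctx G s' :=
  hc.of_agree (fun r hr => h.var r (by omega)) fun a ha => h.mem a (Or.inl ha)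

/-- The result of a search. -/
structure Descent (w : Finset (Fin n) → ℕ) (cap : ℕ) (S W : Finset (Fin n)) (θ : ℕ)
    (Y : Finset (Fin n)) : Prop where
  reach : Reach w cap S Y
  subset : Y ⊆ W
  tight : Tight w S Y
  complete : ∀ T, T ⊆ W → Reach w cap S T → w T ≤ θ → w Y ≤ θ

/-- Specification of a search with variables from `f` on. -/
def Descends (G : SimpleGraph (Fin n)) (K c M j f t : ℕ) (p : Cmd) : Prop :=
  ∀ (s : Store) (S W : Finset (Fin n)), Ctx G s → Table G K c s.mem → s.var 15 ≤ c →
    s.var f = enc S → s.var (f + 1) = enc W → S ⊆ W → wt G K S ≤ s.var 15 →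
    s.var 15 ≤ s.var (f + 2) + j → Marked s.mem S →
    Tr M p s t fun s' => Step G K c f s s' ∧ ∃ Y, s'.var f = enc Y ∧ Marked s'.mem Y ∧
      Descent (wt G K) (s.var 15) S W (s.var (f + 2)) Y

/-- The result of a search step. -/
structure Lighter (w : Finset (Fin n) → ℕ) (cap : ℕ) (Y W T : Finset (Fin n)) : Prop where
  ssubset : Y ⊂ T
  subset : T ⊆ W
  reach : Reach w cap Y T
  le : w T ≤ w Y
  tight : Tight w Y T

/-- The invariant of the loop in `lighten`. -/
structure LightenInv (G : SimpleGraph (Fin n)) (K c f cap : ℕ) (Y W : Finset (Fin n))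
    (s₀ : Store) (W' : Finset (Fin n)) (v : ℕ) (s : Store) : Prop where
  step : Step G K c (f + 3) s₀ s
  setVar : s.var (f + 5) = enc W'
  idxVar : s.var (f + 4) = v
  le : v ≤ n
  sub : W' ⊆ W
  sub' : Y ⊆ W'
  none : ∀ u : Fin n, (u : ℕ) < v → u ∈ W' → u ∉ Y → ∀ X, insert u Y ⊆ X → X ⊆ W' →
    wt G K (insert u Y) ≤ cap → Reach (wt G K) cap (insert u Y) X → wt G K Y < wt G K X
  res : (s.var (f + 3) = 0 ∧ W' = W) ∨ ∃ T v₀, s.var (f + 3) = enc T ∧ W' = T.erase v₀ ∧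
    v₀ ∈ T ∧ v₀ ∉ Y ∧ T ⊆ W ∧ Tight (wt G K) (insert v₀ Y) T ∧ Reach (wt G K) cap Y T ∧
    wt G K T ≤ wt G K Y ∧ Marked s.mem T

/-- Increasing the index. -/
theorem LightenInv.incr {f cap v : ℕ} {Y W W' : Finset (Fin n)} {s₀ s s' : Store}
    (h : LightenInv G K c f cap Y W s₀ W' v s) (hv : v < n) (hs : Step G K c (f + 3) s s')
    (h3 : s'.var (f + 3) = s.var (f + 3)) (h5 : s'.var (f + 5) = s.var (f + 5))
    (h4 : s'.var (f + 4) = v + 1)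
    (hnone : (⟨v, hv⟩ : Fin n) ∈ W' → (⟨v, hv⟩ : Fin n) ∉ Y →
      ∀ X, insert (⟨v, hv⟩ : Fin n) Y ⊆ X → X ⊆ W' →
      wt G K (insert (⟨v, hv⟩ : Fin n) Y) ≤ cap →
      Reach (wt G K) cap (insert (⟨v, hv⟩ : Fin n) Y) X → wt G K Y < wt G K X) :
    LightenInv G K c f cap Y W s₀ W' (v + 1) s' := by
  refine ⟨h.step.trans hs, h5.trans h.setVar, h4, by omega, h.sub, h.sub', ?_, ?_⟩
  · intro u hu
    rcases Nat.lt_succ_iff_lt_or_eq.1 hu with h1 | h1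
    · exact h.none u h1
    · have : u = ⟨v, hv⟩ := Fin.ext h1
      subst this
      exact hnone
  · rcases h.res with ⟨h1, h2⟩ | ⟨T, v₀, h1, h2⟩
    · exact Or.inl ⟨h3.trans h1, h2⟩
    · exact Or.inr ⟨T, v₀, h3.trans h1, h2.1, h2.2.1, h2.2.2.1, h2.2.2.2.1, h2.2.2.2.2.1,
        h2.2.2.2.2.2.1, h2.2.2.2.2.2.2.1, hs.marked _ h2.2.2.2.2.2.2.2⟩

theorem enc_lt_two_pow (hM : 2 * n + K + 10 ≤ M) (X : Finset (Fin n)) : enc X < 2 ^ M :=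
  lt_two_pow_of_le (enc_lt X) (by omega)

theorem small_lt_two_pow (hM : 2 * n + K + 10 ≤ M) {x : ℕ} (hx : x ≤ 2 * n + K + 10) :
    x < 2 ^ M :=
  (hx.trans hM).trans_lt Nat.lt_two_pow_self

/-- A set `T` found through `v₀` is tight only over `insert v₀ Y`; something lighter that avoids
`v₀` may lie below it. The search therefore restarts inside `T.erase v₀` and keeps `T` as a
candidate, until nothing light remains there and `Tight.of_stuck` applies. -/
theorem lighten_spec {j f t : ℕ} {p : Cmd} (hM : 2 * n + K + 10 ≤ M) (hf : 16 ≤ f)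
    (hp : Descends G K c M j (f + 10) t p) {s : Store} {Y W : Finset (Fin n)} (hctx : Ctx G s)
    (ht : Table G K c s.mem) (hcap : s.var 15 ≤ c) (hY : s.var f = enc Y)
    (hW : s.var (f + 1) = enc W) (hYW : Y ⊆ W) (hj : s.var 15 ≤ wt G K Y + j)
    (hmark : Marked s.mem Y) :
    Tr M (lighten K p f) s (lightenSteps n t) fun s' => Step G K c (f + 3) s s' ∧
      ((s'.var (f + 3) = 0 ∧ Stuck (wt G K) (s.var 15) W Y) ∨
        ∃ T, s'.var (f + 3) = enc T ∧ Marked s'.mem T ∧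
          Lighter (wt G K) (s.var 15) Y W T) := by
  have hsub := submod_wt (G := G) K
  unfold lighten
  refine (Tr.asg_seq (t := ((n + 1) * (n + 1)) * (t + 12 + 1) + 1 + 2) (x := 0) (by omega) rfl
    (by positivity) fun s1 hm1 hv1 ho1 =>
    Tr.asg_seq (x := enc W) (by omega) ?_ (enc_lt_two_pow hM W) fun s2 hm2 hv2 ho2 =>
    Tr.asg_seq (x := 0) (by omega) rfl (by positivity) fun s3 hm3 hv3 ho3 => ?_).imp
    (by rw [lightenSteps]) (fun _ h => h)
  · simp only [eval]; rw [ho1 _ (by omega), hW]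
  have hst : Step G K c (f + 3) s s3 :=
    ((Step.of_var hm1 (by omega) ho1).trans (.of_var hm2 (by omega) ho2)).trans
      (.of_var hm3 (by omega) ho3)
  have hinit : LightenInv G K c f (s.var 15) Y W s W 0 s3 := by
    refine ⟨hst, by rw [ho3 _ (by omega), hv2], hv3, by omega, Finset.Subset.refl _, hYW,
      fun u hu => by omega, Or.inl ⟨?_, rfl⟩⟩
    rw [ho3 _ (by omega), ho2 _ (by omega), hv1]
  -- The variant is lexicographic: a success shrinks `W'` and resets the index, otherwise the index
  -- increases.
  refine (Tr.whl (t := t + 12) (m := (n + 1) * (n + 1))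
    (I := fun m s' => ∃ W' v, LightenInv G K c f (s.var 15) Y W s W' v s' ∧
      W'.card * (n + 1) + (n - v) ≤ m) ?_ ?_).imp le_rfl ?_
  rotate_left 2
  · rintro s' ⟨⟨m, W', v, hI, -⟩, h0⟩
    refine ⟨hI.step, ?_⟩
    have hvn : v = n := by
      simp only [eval] at h0
      rw [hI.idxVar, hI.step.var 0 (by omega), hctx.order] at h0
      have := hI.le
      omega
    have hstuck : Stuck (wt G K) (s.var 15) W' Y :=
      stuck_of_forall fun u hu huY X h1 h2 h3 h4 =>
        hI.none u (by omega) hu huY X h1 h2 h3 h4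
    rcases hI.res with ⟨h1, h2⟩ | ⟨T, v₀, h1, rfl, h2, h3, h4, h5, h6, h7, h8⟩
    · subst h2
      exact Or.inl ⟨h1, hstuck⟩
    -- The final failed scan of `T.erase v₀` supplies the stuckness that makes the candidate tight
    -- over `Y`.
    · refine Or.inr ⟨T, h1, h8, ?_, h4, h6, h7, h5.of_stuck hsub h6 h7 hstuck⟩
      exact ⟨h6.subset, fun h => h3 (h h2)⟩
  · rintro m s' ⟨W', v, hI, hm⟩ h0
    have hctx' := hI.step.ctx (by omega) hctx
    have ht' := hI.step.table ht
    have hv4 : s'.var 15 = s.var 15 := hI.step.var 15 (by omega)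
    have hvY : s'.var f = enc Y := by rw [hI.step.var f (by omega), hY]
    have hvn : v < n := by
      simp only [eval] at h0
      rw [hI.idxVar, hctx'.order] at h0
      omega
    have hincr : ∀ (q : Store) (t : ℕ), Step G K c (f + 3) s' q →
        q.var (f + 3) = s'.var (f + 3) → q.var (f + 5) = s'.var (f + 5) → q.var (f + 4) = v →
        ((⟨v, hvn⟩ : Fin n) ∈ W' → (⟨v, hvn⟩ : Fin n) ∉ Y →
          ∀ X, insert (⟨v, hvn⟩ : Fin n) Y ⊆ X → X ⊆ W' →
          wt G K (insert (⟨v, hvn⟩ : Fin n) Y) ≤ s.var 15 →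
          Reach (wt G K) (s.var 15) (insert (⟨v, hvn⟩ : Fin n) Y) X → wt G K Y < wt G K X) →
        Tr M (.asg (f + 4) (.add (.glob (f + 4)) (.const 1))) q (t + 1) fun s'' =>
          ∃ m' < m, ∃ W' v,
            LightenInv G K c f (s.var 15) Y W s W' v s'' ∧ W'.card * (n + 1) + (n - v) ≤ m' := by
      intro q t hq h3 h5 h4 hnone
      refine Tr.asg (x := v + 1) (by omega) (by simp [eval, h4])
        (small_lt_two_pow hM (by omega)) fun q' hm' hv ho => ?_
      refine ⟨_, ?_, W', v + 1, hI.incr hvn (hq.trans (.of_var hm' (by omega) ho)) ?_ ?_ hv hnone,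
        le_rfl⟩
      · omega
      · rw [ho _ (by omega), h3]
      · rw [ho _ (by omega), h5]
    have hcond : (Expr.and (.bit (.glob (f + 5)) (.glob (f + 4)))
        (.not (.bit (.glob f) (.glob (f + 4))))).eval s' [] =
        if (⟨v, hvn⟩ : Fin n) ∈ W' ∧ ¬ (⟨v, hvn⟩ : Fin n) ∈ Y then 1 else 0 :=
      eval_and (eval_bit hctx'.order (by simp [eval, hI.setVar]) (by simp [eval, hI.idxVar]))
        (eval_not (eval_bit hctx'.order (by simp [eval, hvY]) (by simp [eval, hI.idxVar])))
    refine Tr.ite (fun h => ?_) (fun h => ?_)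
    swap
    · refine hincr s' _ (.refl _ _) rfl rfl hI.idxVar fun h1 h2 => ?_
      rw [hcond, if_pos ⟨h1, h2⟩] at h
      exact absurd h one_ne_zero
    obtain ⟨hvW, hvY'⟩ : (⟨v, hvn⟩ : Fin n) ∈ W' ∧ ¬ (⟨v, hvn⟩ : Fin n) ∈ Y := by
      by_contra hcon
      rw [hcond, if_neg hcon] at h
      exact h rfl
    set u : Fin n := ⟨v, hvn⟩ with hu
    refine Tr.asg_seq (x := enc (insert u Y)) (by omega) ?_ (enc_lt_two_pow hM _)
      fun s1 hm1 hv1 ho1 => ?_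
    · simp only [eval]
      rw [eval_pow2 hctx'.order (by simp [eval, hI.idxVar]; omega), hvY, enc_insert hvY']
      simp [eval, hI.idxVar, hu]
    have hs1 : Step G K c (f + 10) s' s1 := .of_var hm1 le_rfl ho1
    have hctx1 := hs1.ctx (by omega) hctx'
    refine Tr.ite (fun h => ?_) (fun h => ?_)
    swap
    · refine hincr s1 _ (hs1.mono (by omega)) (hs1.var _ (by omega)) (hs1.var _ (by omega))
        ((hs1.var _ (by omega)).trans hI.idxVar) fun h1 h2 X h3 h4 h5 => ?_
      rw [eval_le, eval_weight hctx1 (S := insert u Y) (by simp [eval, hv1]), if_pos] at h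
      · exact absurd h one_ne_zero
      · simp only [eval]; rw [hs1.var _ (by omega), hv4]; exact h5
    have hwu : wt G K (insert u Y) ≤ s.var 15 := by
      by_contra hcon
      rw [eval_le, eval_weight hctx1 (S := insert u Y) (by simp [eval, hv1]), if_neg] at h
      · exact h rfl
      · simp only [eval]; rw [hs1.var _ (by omega), hv4]; exact hcon
    refine Tr.sto_seq (y := blk n + enc (insert u Y)) (x := u + 1) ?_ ?_
      (small_lt_two_pow hM (by omega)) fun s2 hv2 hm2 => ?_
    · simp only [eval]; rw [hctx1.block, hv1]; rfl
    · simp only [eval]; rw [hs1.var _ (by omega), hI.idxVar]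
    have hs2 : Step G K c (f + 10) s1 s2 := by
      refine .of_mark hv2 hm2 (Finset.mem_insert_self _ _) ?_ (hwu.trans hcap)
      rw [Finset.erase_insert hvY']
      exact hs1.marked _ (hI.step.marked _ hmark)
    refine Tr.asg_seq (x := enc W') (by omega) ?_ (enc_lt_two_pow hM _) fun s3 hm3 hv3 ho3 => ?_
    · simp only [eval]; rw [hv2, hs1.var _ (by omega), hI.setVar]
    have hs3 : Step G K c (f + 10) s2 s3 := .of_var hm3 (by omega) ho3
    have hs03 := (hs1.trans hs2).trans hs3
    have hctx3 := hs03.ctx (by omega) hctx'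
    refine Tr.asg_seq (x := wt G K Y) (by omega)
      (eval_weight hctx3 (by simp only [eval]; rw [hs03.var _ (by omega), hvY]))
      (small_lt_two_pow hM ((wt_le K Y).trans (by omega))) fun s4 hm4 hv4' ho4 => ?_
    have hs4 : Step G K c (f + 10) s' s4 := hs03.trans (.of_var hm4 (by omega) ho4)
    have hctx4 := hs4.ctx (by omega) hctx'
    have hcap4 : s4.var 15 = s.var 15 := (hs4.var 15 (by omega)).trans hv4
    have hmk : Marked s4.mem (insert u Y) := by
      rw [Marked, hm4, hm3, hm2, Function.update_self]
      omega
    have hins : insert u Y ⊆ W' := Finset.insert_subset hvW hI.sub'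
    -- The target of the inner search is the weight of `Y`, so `hj` is exactly its bound on the gap
    -- between capacity and target.
    have hcall := hp s4 (insert u Y) W' hctx4 (hs4.table ht') (hcap4 ▸ hcap)
      (by rw [ho4 _ (by omega), ho3 _ (by omega), hv2, hv1]) (by rw [ho4 _ (by omega), hv3]) hins
      (hcap4.symm ▸ hwu) (by rw [hcap4, hv4']; exact hj) hmk
    refine (Tr.seq (t₁ := t) (t₂ := 5) (hcall.imp le_rfl ?_)).imp (by omega) fun _ h => h
    rintro s5 ⟨hs5, T, hvT, hmT, hD⟩
    rw [hv4', hcap4] at hD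
    have hs05 := hs4.trans hs5
    have hctx5 := hs05.ctx (by omega) hctx'
    have hc2 : (Expr.le (.weight K (.glob (f + 10))) (.weight K (.glob f))).eval s5 [] =
        if wt G K T ≤ wt G K Y then 1 else 0 := by
      rw [eval_le, eval_weight hctx5 (S := T) (by simp [eval, hvT]),
        eval_weight hctx5 (S := Y) (by simp only [eval]; rw [hs05.var _ (by omega), hvY])]
    refine Tr.ite (fun h => ?_) (fun h => ?_)
    swap
    · refine hincr s5 _ (hs05.mono (by omega)) (hs05.var _ (by omega)) (hs05.var _ (by omega))
        ((hs05.var _ (by omega)).trans hI.idxVar) fun h1 h2 X h3 h4 h5 h6 => ?_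
      by_contra hcon
      rw [hc2, if_pos (hD.complete X h4 h6 (not_lt.1 hcon))] at h
      exact one_ne_zero h
    have hle : wt G K T ≤ wt G K Y := by
      by_contra hcon
      rw [hc2, if_neg hcon] at h
      exact h rfl
    have huT : u ∈ T := hD.reach.subset (Finset.mem_insert_self _ _)
    refine Tr.asg_seq (x := enc T) (by omega) (by simp [eval, hvT]) (enc_lt_two_pow hM _)
      fun s6 hm6 hv6 ho6 => ?_
    have hs6 : Step G K c (f + 3) s5 s6 := .of_var hm6 (by omega) ho6
    have hctx6 := hs6.ctx (by omega) hctx5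
    have hidx6 : s6.var (f + 4) = u := by
      rw [ho6 _ (by omega), hs05.var _ (by omega), hI.idxVar]
    refine Tr.asg_seq (x := enc (T.erase u)) (by omega) ?_ (enc_lt_two_pow hM _)
      fun s7 hm7 hv7 ho7 => ?_
    · simp only [eval]
      rw [eval_pow2 hctx6.order (by simp [eval, hidx6]), ho6 _ (by omega), hvT, enc_erase huT]
      simp [eval, hidx6]
    refine Tr.asg (x := 0) (by omega) rfl (by positivity) fun s8 hm8 hv8 ho8 => ?_
    have hs8 : Step G K c (f + 3) s' s8 := ((hs05.mono (by omega)).trans hs6).trans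
      ((Step.of_var hm7 (by omega) ho7).trans (.of_var hm8 (by omega) ho8))
    have hTW' : T ⊆ W' := hD.subset
    -- Success: restart at index `0` within `T.erase u`, which is smaller than `W'` because it lacks
    -- `u`.
    refine ⟨_, ?_, T.erase u, 0, ⟨hI.step.trans hs8, ?_, hv8, by omega, ?_, ?_, ?_, ?_⟩, le_rfl⟩
    · have h1 : (T.erase u).card + 1 ≤ W'.card := by
        rw [Finset.card_erase_add_one huT]
        exact Finset.card_le_card hTW'
      have := Nat.mul_le_mul_right (n + 1) h1
      rw [Nat.add_one_mul] at this
      omega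
    · rw [ho8 _ (by omega), hv7]
    · exact ((Finset.erase_subset _ _).trans hTW').trans hI.sub
    · intro x hx
      refine Finset.mem_erase.2 ⟨fun h => hvY' (h ▸ hx), hD.reach.subset
        (Finset.mem_insert_of_mem hx)⟩
    · intro w hw; omega
    · refine Or.inr ⟨T, u, ?_, rfl, huT, hvY', hTW'.trans hI.sub, hD.tight,
        .head u hvY' hwu hD.reach, hle, ?_⟩
      · rw [ho8 _ (by omega), ho7 _ (by omega), hv6]
      · rw [Marked, hm8, hm7, hm6]; exact hmT
  · have hcard : W.card ≤ n := by simpa using Finset.card_le_univ W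
    refine ⟨W, 0, hinit, ?_⟩
    have := Nat.mul_le_mul_right (n + 1) hcard
    rw [Nat.add_one_mul]
    omega

/-- The invariant of the loop in `descend`. -/
structure DescendInv (G : SimpleGraph (Fin n)) (K c f : ℕ) (s₀ : Store) (S W Y : Finset (Fin n))
    (s : Store) : Prop where
  step : Step G K c f s₀ s
  setVar : s.var f = enc Y
  univVar : s.var (f + 1) = enc W
  target : s.var (f + 2) = s₀.var (f + 2)
  reach : Reach (wt G K) (s₀.var 15) S Y
  sub : Y ⊆ W
  tight : Tight (wt G K) S Y
  marked : Marked s.mem Y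
  flag : s.var (f + 6) = wt G K Y - s₀.var (f + 2) ∨
    (s.var (f + 6) = 0 ∧ Stuck (wt G K) (s₀.var 15) W Y)

/-- Replacing `Y` by tight, no heavier supersets preserves both reachability and tightness over `S`.
The depth `j` bounds the gap between capacity and target, which closes by at least one in each
nested call. -/
theorem descend_spec (hM : 2 * n + K + 10 ≤ M) (j : ℕ) {f : ℕ} (hf : 16 ≤ f) :
    Descends G K c M j f (descendSteps n j) (descend K j f) := by
  have hsub := submod_wt (G := G) K
  induction j generalizing f with
  | zero =>
    intro s S W hctx ht hcap hS hW hSW hw hj hmark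
    -- At depth `0` the capacity does not exceed the target, so `S` already meets it.
    exact Tr.skip ⟨.refl _ _, S, hS, hmark, .refl S, hSW, .refl S, fun _ _ _ _ => by omega⟩
  | succ j ih =>
    intro s S W hctx ht hcap hS hW hSW hw hj hmark
    have hflag : ∀ (q : Store) (Y : Finset (Fin n)), Ctx G q → q.var f = enc Y →
        (Expr.sub (.weight K (.glob f)) (.glob (f + 2))).eval q [] =
          wt G K Y - q.var (f + 2) := by
      intro q Y hq hY
      simp only [eval]
      rw [eval_weight hq (S := Y) (by simp [eval, hY])]
    rw [descend, descendSteps]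
    refine Tr.asg_seq (x := wt G K S - s.var (f + 2)) (by omega) (hflag s S hctx hS)
      (small_lt_two_pow hM (by have := wt_le (G := G) K S; omega)) fun s1 hm1 hv1 ho1 => ?_
    have hs1 : Step G K c f s s1 := .of_var hm1 (by omega) ho1
    refine (Tr.whl (t := lightenSteps n (descendSteps n j) + 3) (m := n + 1)
      (I := fun m s' => ∃ Y, DescendInv G K c f s S W Y s' ∧
        (s'.var (f + 6) = 0 ∨ n + 1 - Y.card ≤ m)) ?_ ?_).imp le_rfl ?_
    · rintro m s' ⟨Y, hI, hm⟩ h0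
      have h0' : s'.var (f + 6) ≠ 0 := h0
      have hm := hm.resolve_left h0'
      have hcard : Y.card ≤ n := by simpa using Finset.card_le_univ Y
      have hgo := hI.flag.resolve_right fun h => h0' h.1
      have hcap' : s'.var 15 = s.var 15 := hI.step.var 15 (by omega)
      have hctx' := hI.step.ctx (by omega) hctx
      -- A nonzero flag means that `Y` is still above the target, so the capacity exceeds the weight
      -- of `Y` by at most `j`.
      refine (Tr.seq (t₂ := 3) ((lighten_spec hM hf (ih (f := f + 10) (by omega)) hctx'
        (hI.step.table ht) (hcap' ▸ hcap) hI.setVar hI.univVar hI.sub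
        (by omega) hI.marked).imp le_rfl ?_)).imp (by omega) fun _ h => h
      rintro s2 ⟨hs2, hres⟩
      have hctx2 := hs2.ctx (by omega) hctx'
      have hstep2 := hI.step.trans (hs2.mono (by omega))
      rw [hcap'] at hres
      refine Tr.ite (fun h => ?_) (fun h => ?_)
      · replace hres := hres.resolve_left fun h' => h h'.1
        clear h
        obtain ⟨T, hvT, hmT, hT⟩ := hres
        refine Tr.asg_seq (x := enc T) (by omega) (by simp [eval, hvT]) (enc_lt_two_pow hM _)
          fun s3 hm3 hv3 ho3 => ?_
        have hs3 : Step G K c f s2 s3 := .of_var hm3 le_rfl ho3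
        have hθ : s3.var (f + 2) = s.var (f + 2) := by
          rw [ho3 _ (by omega), hs2.var _ (by omega), hI.target]
        refine Tr.asg (x := wt G K T - s.var (f + 2)) (by omega)
          (hθ ▸ hflag s3 T (hs3.ctx (by omega) hctx2) hv3)
          (small_lt_two_pow hM (by have := wt_le (G := G) K T; omega)) fun s4 hm4 hv4 ho4 => ?_
        have hlt := Finset.card_lt_card hT.ssubset
        refine ⟨n + 1 - T.card, by omega, T, ⟨hstep2.trans (hs3.trans (.of_var hm4 (by omega) ho4)),
          ?_, ?_, ?_, hI.reach.trans hT.reach, hT.subset, hI.tight.trans hsub hI.reach.subset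
          hT.tight hT.ssubset.subset, ?_, Or.inl hv4⟩, Or.inr le_rfl⟩
        · rw [ho4 _ (by omega), hv3]
        · rw [ho4 _ (by omega), ho3 _ (by omega), hs2.var _ (by omega), hI.univVar]
        · rw [ho4 _ (by omega), hθ]
        · rw [Marked, hm4, hm3]; exact hmT
      · have hst : Stuck (wt G K) (s.var 15) W Y := by
          rcases hres with h' | ⟨T, hvT, -, hT⟩
          · exact h'.2
          · have : enc T = 0 := hvT ▸ h
            rw [enc_eq_zero] at this
            have h1 := hT.ssubset
            rw [this] at h1
            exact absurd h1 (Finset.not_ssubset_empty _)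
        refine Tr.asg (x := 0) (by omega) rfl (by positivity) fun s3 hm3 hv3 ho3 => ?_
        refine ⟨0, by omega, Y, ⟨hstep2.trans (.of_var hm3 (by omega) ho3), ?_, ?_, ?_, hI.reach,
          hI.sub, hI.tight, ?_, Or.inr ⟨hv3, hst⟩⟩, Or.inl hv3⟩
        · rw [ho3 _ (by omega), hs2.var _ (by omega), hI.setVar]
        · rw [ho3 _ (by omega), hs2.var _ (by omega), hI.univVar]
        · rw [ho3 _ (by omega), hs2.var _ (by omega), hI.target]
        · rw [Marked, hm3]; exact hs2.marked _ hI.marked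
    · refine ⟨S, ⟨hs1, ?_, ?_, ?_, .refl S, hSW, .refl S, ?_, Or.inl hv1⟩, Or.inr (by omega)⟩
      · rw [ho1 _ (by omega), hS]
      · rw [ho1 _ (by omega), hW]
      · rw [ho1 _ (by omega)]
      · rw [Marked, hm1]; exact hmark
    · rintro s' ⟨⟨m, Y, hI, -⟩, h0⟩
      have h0' : s'.var (f + 6) = 0 := h0
      refine ⟨hI.step, Y, hI.setVar, hI.marked, hI.reach, hI.sub, hI.tight, fun T hTW hT hle => ?_⟩
      rcases hI.flag with h | ⟨-, h⟩
      · omega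
      -- A light set `T` reached from `S` can be joined to `Y`. Either `T ∪ Y = Y`, and `Y` is no
      -- heavier than `T`; or stuckness makes `Y` lighter than the union, hence lighter than `T`.
      · obtain ⟨h1, h2⟩ := hT.exchange hsub hI.tight hI.reach.subset
        by_cases heq : T ∪ Y = Y
        · rw [heq] at h2; omega
        · have := h _ (Finset.ssubset_iff_subset_ne.2 ⟨Finset.subset_union_right, Ne.symm heq⟩)
            (Finset.union_subset hTW hI.sub) h1
          omega

/-! ### A round: all sets that can be reached within a capacity -/

/-- Replaces the set in variable `20` by a set that cannot be lightened any more. -/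
def normalize (K : ℕ) : Cmd :=
  .seq (.asg 23 (.const 1)) <| .whl (.glob 23) <|
  .seq (.asg 15 (.add (.weight K (.glob 20)) (.const K))) <|
  .seq (.asg 21 (.glob 1)) <|
  .seq (lighten K (descend K K 30) 20) <|
  .ite (.glob 23) (.asg 20 (.glob 23)) .skip

/-- Number of steps of `normalize`. -/
def normalizeSteps (n K : ℕ) : ℕ := (n + 1) * (lightenSteps n (descendSteps n K) + 5) + 2

/-- The invariant of the loop in `normalize`. -/
structure NormalizeInv (G : SimpleGraph (Fin n)) (K c : ℕ) (s₀ : Store) (Y Z : Finset (Fin n))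
    (s : Store) : Prop where
  step : Step G K c 15 s₀ s
  setVar : s.var 20 = enc Z
  sub : Y ⊆ Z
  le : wt G K Z ≤ wt G K Y
  tight : Tight (wt G K) Y Z
  marked : Marked s.mem Z
  flag : s.var 23 = 0 → Stuck (wt G K) (wt G K Z + K) Finset.univ Z

/-- The capacity follows the current weight, with slack exactly `K`. The resulting stuckness thus
does not depend on the round, which is what the count of listed sets needs. -/
theorem normalize_spec (hM : 2 * n + K + 10 ≤ M) {s : Store} {Y : Finset (Fin n)}
    (hctx : Ctx G s) (ht : Table G K c s.mem) (hY : s.var 20 = enc Y) (hc : wt G K Y + K ≤ c)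
    (hK : wt G K Y ≤ n) (hmark : Marked s.mem Y) :
    Tr M (normalize K) s (normalizeSteps n K) fun s' => Step G K c 15 s s' ∧
      ∃ Z, s'.var 20 = enc Z ∧ Y ⊆ Z ∧ wt G K Z ≤ wt G K Y ∧ Tight (wt G K) Y Z ∧
        Marked s'.mem Z ∧ Stuck (wt G K) (wt G K Z + K) Finset.univ Z := by
  have hsub := submod_wt (G := G) K
  rw [normalize, normalizeSteps]
  refine Tr.asg_seq (x := 1) (by omega) rfl (small_lt_two_pow hM (by omega))
    fun s1 hm1 hv1 ho1 => ?_
  refine (Tr.whl (t := lightenSteps n (descendSteps n K) + 4) (m := n + 1)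
    (I := fun m s' => ∃ Z, NormalizeInv G K c s Y Z s' ∧
      (s'.var 23 = 0 ∨ n + 1 - Z.card ≤ m)) ?_ ?_).imp le_rfl ?_
  · rintro m s' ⟨Z, hI, hm⟩ h0
    have hm := hm.resolve_left h0
    have hcard : Z.card ≤ n := by simpa using Finset.card_le_univ Z
    have hctx' := hI.step.ctx (by omega) hctx
    have hle := hI.le
    refine Tr.asg_seq (x := wt G K Z + K) (by omega) ?_ (small_lt_two_pow hM (by omega))
      fun s2 hm2 hv2 ho2 => ?_
    · simp only [eval]; rw [eval_weight hctx' (S := Z) (by simp [eval, hI.setVar])]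
    refine Tr.asg_seq (x := enc (Finset.univ : Finset (Fin n))) (by omega) ?_
      (enc_lt_two_pow hM _) fun s3 hm3 hv3 ho3 => ?_
    · simp only [eval]; rw [ho2 _ (by omega), hctx'.full]
    have hs3 : Step G K c 15 s' s3 := (Step.of_var hm2 le_rfl ho2).trans (.of_var hm3 (by omega) ho3)
    have hctx3 := hs3.ctx (by omega) hctx'
    have hcap3 : s3.var 15 = wt G K Z + K := by rw [ho3 _ (by omega), hv2]
    have hset3 : s3.var 20 = enc Z := by rw [ho3 _ (by omega), ho2 _ (by omega), hI.setVar]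
    refine (Tr.seq (t₂ := 2) ((lighten_spec hM (by omega) (descend_spec hM K (f := 30) (by omega))
      hctx3 (hs3.table (hI.step.table ht)) (by omega) hset3 hv3 (Finset.subset_univ _)
      (by omega) (by rw [Marked, hm3, hm2]; exact hI.marked)).imp le_rfl ?_)).imp (by omega)
      fun _ h => h
    rintro s4 ⟨hs4, hres⟩
    rw [hcap3] at hres
    have hstep4 : Step G K c 15 s s4 := (hI.step.trans hs3).trans (hs4.mono (by omega))
    have hset4 : s4.var 20 = enc Z := by rw [hs4.var _ (by omega), hset3]
    refine Tr.ite (fun h => ?_) (fun h => ?_)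
    · replace hres := hres.resolve_left fun h' => h h'.1
      obtain ⟨T, hvT, hmT, hT⟩ := hres
      have hlt := Finset.card_lt_card hT.ssubset
      refine Tr.asg (x := enc T) (by omega) (by simp only [eval]; exact hvT) (enc_lt_two_pow hM _)
        fun s5 hm5 hv5 ho5 => ⟨n + 1 - T.card, by omega, T, ⟨hstep4.trans (.of_var hm5 (by omega) ho5),
          hv5, hI.sub.trans hT.ssubset.subset, hT.le.trans hI.le,
          hI.tight.trans hsub hI.sub hT.tight hT.ssubset.subset, ?_, ?_⟩, Or.inr le_rfl⟩
      · rw [Marked, hm5]; exact hmT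
      · intro h5
        have h6 : s5.var 23 = s4.var 23 := ho5 _ (by omega)
        exact absurd (show s4.var 23 = 0 from h6 ▸ h5) h
    · refine Tr.skip ⟨0, by omega, Z, ⟨hstep4, hset4, hI.sub, hI.le, hI.tight, ?_, fun _ => ?_⟩,
        Or.inl h⟩
      · exact hs4.marked _ (hs3.marked _ hI.marked)
      · rcases hres with h' | ⟨T, hvT, -, hT⟩
        · exact h'.2
        · have : enc T = 0 := hvT ▸ h
          rw [enc_eq_zero] at this
          have h1 := hT.ssubset
          rw [this] at h1
          exact absurd h1 (Finset.not_ssubset_empty _)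
  · refine ⟨Y, ⟨.of_var hm1 (by omega) ho1, ?_, Finset.Subset.refl _, le_rfl, .refl Y, ?_, ?_⟩,
      Or.inr (by omega)⟩
    · rw [ho1 _ (by omega), hY]
    · rw [Marked, hm1]; exact hmark
    · intro h; rw [hv1] at h; exact absurd h one_ne_zero
  · rintro s' ⟨⟨m, Z, hI, -⟩, h0⟩
    exact ⟨hI.step, Z, hI.setVar, hI.sub, hI.le, hI.tight, hI.marked, hI.flag h0⟩

/-- The sets that a round may put into the queue. -/
def Listed (G : SimpleGraph (Fin n)) (K k : ℕ) (X : Finset (Fin n)) : Prop :=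
  X = ∅ ∨ wt G K X ≤ k ∧ Stuck (wt G K) (wt G K X + K) Finset.univ X

/-- The queue and the table of visited sets. -/
structure Queue (k : ℕ) (q : List (Finset (Fin n))) (m : ℕ → ℕ) : Prop where
  items : ∀ (i : ℕ) (h : i < q.length), m (3 * blk n + i) = enc q[i]
  seen : ∀ X : Finset (Fin n), m (2 * blk n + enc X) = k + 1 ↔ X ∈ q
  le : ∀ X : Finset (Fin n), m (2 * blk n + enc X) ≤ k + 1
  nodup : q.Nodup

/-- The state of the search between two rounds. -/
structure Search (G : SimpleGraph (Fin n)) (K c k : ℕ) (s : Store) : Prop where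
  ctx : Ctx G s
  table : Table G K c s.mem
  level : s.var 3 = k
  empty : Marked s.mem (∅ : Finset (Fin n))

/-- The state of the search in a round. -/
structure RoundInv (G : SimpleGraph (Fin n)) (K c k : ℕ) (q : List (Finset (Fin n)))
    (s : Store) : Prop extends Search G K c k s where
  queue : Queue k q s.mem
  tail : s.var 5 = q.length
  listed : ∀ X ∈ q, Listed G K k X
  marked : ∀ X ∈ q, Marked s.mem X

/-- Searches write only to variables from `6` on and to the table of reached sets, away from the
queue and the visited table. -/
theorem RoundInv.of_step {k : ℕ} {q : List (Finset (Fin n))} {s s' : Store}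
    (h : RoundInv G K c k q s) (hs : Step G K c 6 s s') : RoundInv G K c k q s' := by
  refine ⟨⟨hs.ctx (by omega) h.ctx, hs.table h.table, by rw [hs.var 3 (by omega), h.level],
    hs.marked _ h.empty⟩, ⟨fun i hi => ?_, fun X => ?_, fun X => ?_, h.queue.nodup⟩,
    by rw [hs.var 5 (by omega), h.tail], h.listed, fun X hX => hs.marked _ (h.marked X hX)⟩
  · rw [hs.mem _ (by omega), h.queue.items i hi]
  · rw [hs.mem _ (by omega), h.queue.seen]
  · rw [hs.mem _ (by omega)]; exact h.queue.le X

theorem length_le_two_pow {q : List (Finset (Fin n))} (h : q.Nodup) : q.length ≤ 2 ^ n := by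
  classical
  have := List.toFinset_card_of_nodup h
  rw [← this]
  simpa using Finset.card_le_univ q.toFinset

theorem two_pow_lt_blk (n : ℕ) : 2 ^ n < blk n :=
  Nat.pow_lt_pow_right (by omega) (by omega)

/-- Puts the set in variable `20` into the queue unless it has been there. -/
def enqueue : Cmd :=
  .ite (.eq (.load (.add (.add (.glob 2) (.glob 2)) (.glob 20))) (.add (.glob 3) (.const 1))) .skip <|
  .seq (.sto (.add (.add (.glob 2) (.glob 2)) (.glob 20)) (.add (.glob 3) (.const 1))) <|
  .seq (.sto (.add (.add (.add (.glob 2) (.glob 2)) (.glob 2)) (.glob 5)) (.glob 20)) <|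
  .asg 5 (.add (.glob 5) (.const 1))

/-- The stamp `k + 1` means visited in the present round. Stamps of earlier rounds are smaller, so
the table never has to be cleared. -/
theorem enqueue_spec (hM : 2 * n + K + 10 ≤ M) {k : ℕ} (hk : k ≤ n) {q : List (Finset (Fin n))}
    {s : Store} {X : Finset (Fin n)} (h : RoundInv G K c k q s) (hX : s.var 20 = enc X)
    (hL : Listed G K k X) (hmark : Marked s.mem X) :
    Tr M enqueue s 5 fun s' => (∀ r < 15, r ≠ 5 → s'.var r = s.var r) ∧
      ∃ q', q <+: q' ∧ X ∈ q' ∧ RoundInv G K c k q' s' := by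
  have hD : s.var 2 = blk n := h.ctx.block
  have hcond : (Expr.eq (.load (.add (.add (.glob 2) (.glob 2)) (.glob 20)))
      (.add (.glob 3) (.const 1))).eval s [] = if X ∈ q then 1 else 0 := by
    rw [eval_eq]
    simp only [eval, hD, hX, h.level]
    rw [← two_mul]
    have := h.queue.seen X
    by_cases hq : X ∈ q
    · rw [if_pos hq, if_pos (this.2 hq)]
    · rw [if_neg hq, if_neg (fun h' => hq (this.1 h'))]
  refine Tr.ite (fun h' => ?_) (fun h' => ?_)
  · refine Tr.skip ⟨fun _ _ _ => rfl, q, List.prefix_rfl, ?_, h⟩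
    by_contra hcon
    rw [hcond, if_neg hcon] at h'
    exact h' rfl
  have hXq : X ∉ q := by
    intro hcon
    rw [hcond, if_pos hcon] at h'
    exact one_ne_zero h'
  have hlen := length_le_two_pow h.queue.nodup
  have hblk := two_pow_lt_blk n
  have hencX := enc_lt_blk X
  refine Tr.sto_seq (y := 2 * blk n + enc X) (x := k + 1) (by simp only [eval]; omega)
    (by simp only [eval, h.level]) (small_lt_two_pow hM (by omega)) fun s1 hv1 hm1 => ?_
  refine Tr.sto_seq (y := 3 * blk n + q.length) (x := enc X)
    (by simp only [eval, hv1, h.tail]; omega)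
    (by simp only [eval, hv1, hX]) (enc_lt_two_pow hM _) fun s2 hv2 hm2 => ?_
  refine Tr.asg (x := q.length + 1) (by omega) (by simp only [eval, hv2, hv1, h.tail])
    (lt_two_pow_of_le (show q.length + 1 < 2 ^ (n + 2) by
      rw [pow_add]; have := Nat.one_le_two_pow (n := n); omega) (by omega)) fun s3 hm3 hv3 ho3 => ?_
  have hvar : ∀ r, r ≠ 5 → s3.var r = s.var r := fun r hr => by rw [ho3 r hr, hv2, hv1]
  have hmem : s3.mem = Function.update (Function.update s.mem (2 * blk n + enc X) (k + 1))
    (3 * blk n + q.length) (enc X) := by rw [hm3, hm2, hm1]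
  have hother : ∀ a, a < 2 * blk n → s3.mem a = s.mem a := fun a ha => by
    rw [hmem, Function.update_of_ne (by omega), Function.update_of_ne (by omega)]
  have hM2 : ∀ Y : Finset (Fin n), s3.mem (blk n + enc Y) = s.mem (blk n + enc Y) := fun Y => by
    have := enc_lt_blk Y
    exact hother _ (by omega)
  have hmk : ∀ Y : Finset (Fin n), Marked s3.mem Y ↔ Marked s.mem Y := fun Y => by
    rw [Marked, hM2, Marked]
  have hseen : ∀ Y : Finset (Fin n), s3.mem (2 * blk n + enc Y) =
      if Y = X then k + 1 else s.mem (2 * blk n + enc Y) := fun Y => by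
    have := enc_lt_blk Y
    rw [hmem, Function.update_of_ne (by omega)]
    by_cases hYX : Y = X
    · rw [if_pos hYX, hYX, Function.update_self]
    · have : enc Y ≠ enc X := fun h => hYX (enc_injective h)
      rw [if_neg hYX, Function.update_of_ne (by omega)]
  refine ⟨fun r _ hr => hvar r hr, q ++ [X], List.prefix_append _ _, by simp, ⟨⟨?_, ?_, ?_, ?_⟩,
    ⟨?_, ?_, ?_, ?_⟩, ?_, ?_, ?_⟩⟩
  · exact h.ctx.of_agree (fun r hr => hvar r (by omega)) fun a ha => hother a (by omega)
  · intro Y hY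
    rw [hmk] at hY
    rcases h.table Y hY with h1 | ⟨v, h1, h2, h3, h4⟩
    · exact Or.inl h1
    · exact Or.inr ⟨v, h1, by rw [hM2, h2], (hmk _).2 h3, h4⟩
  · rw [hvar 3 (by omega), h.level]
  · exact (hmk _).2 h.empty
  · intro i hi
    simp only [List.length_append, List.length_singleton] at hi
    rw [hmem]
    by_cases hiq : i < q.length
    · rw [Function.update_of_ne (by omega), Function.update_of_ne (by omega), h.queue.items i hiq,
        List.getElem_append_left hiq]
    · have : i = q.length := by omega
      subst this
      rw [Function.update_self, List.getElem_concat_length rfl]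
  · intro Y
    rw [hseen]
    by_cases hYX : Y = X
    · simp [hYX]
    · simp [hYX, h.queue.seen]
  · intro Y
    rw [hseen]
    split_ifs
    · exact le_rfl
    · exact h.queue.le Y
  · exact List.nodup_append.2 ⟨h.queue.nodup, by simp, by
      intro a ha b hb
      rw [List.mem_singleton] at hb
      exact fun h => hXq (hb ▸ h ▸ ha)⟩
  · rw [hv3]; simp
  · intro Y hY
    rcases List.mem_append.1 hY with h1 | h1
    · exact h.listed Y h1
    · rw [List.mem_singleton.1 h1]; exact hL
  · intro Y hY
    rw [hmk]
    rcases List.mem_append.1 hY with h1 | h1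
    · exact h.marked Y h1
    · rw [List.mem_singleton.1 h1]; exact hmark

/-- Explores the extension of the set in variable `6` by the vertex in variable `7`. -/
def visit (K : ℕ) : Cmd :=
  .ite (.bit (.glob 6) (.glob 7)) .skip <|
  .seq (.asg 20 (.add (.glob 6) (.pow2 (.glob 7)))) <|
  .ite (.le (.weight K (.glob 20)) (.add (.glob 3) (.const K)))
    (.seq (.sto (.add (.glob 2) (.glob 20)) (.add (.glob 7) (.const 1))) <|
      .seq (.asg 21 (.glob 1)) <| .seq (.asg 22 (.glob 3)) <|
      .seq (.asg 15 (.add (.glob 3) (.const K))) <|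
      .seq (descend K K 20) <|
      .ite (.le (.weight K (.glob 20)) (.glob 3)) (.seq (normalize K) enqueue) .skip)
    .skip

/-- Number of steps of `visit`. -/
def visitSteps (n K : ℕ) : ℕ := descendSteps n K + (normalizeSteps n K + 20)

/-- Extending `S` by `v` need not be considered any more. -/
def Explored (w : Finset (Fin n) → ℕ) (cap : ℕ) (q : List (Finset (Fin n))) (S : Finset (Fin n))
    (v : Fin n) : Prop :=
  v ∉ S → w (insert v S) ≤ cap → Reach w cap (insert v S) Finset.univ →
    ∃ T ∈ q, insert v S ⊆ T ∧ Reach w cap T Finset.univ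

theorem Explored.mono {w : Finset (Fin n) → ℕ} {cap : ℕ} {q q' : List (Finset (Fin n))}
    {S : Finset (Fin n)} {v : Fin n} (h : Explored w cap q S v) (hq : q <+: q') :
    Explored w cap q' S v := fun h1 h2 h3 =>
  let ⟨T, h4, h5⟩ := h h1 h2 h3
  ⟨T, hq.subset h4, h5⟩

/-- Dropping the extension is justified in each case: its weight exceeds the capacity, or the search
shows that the full set is out of reach, or it is replaced by a tight superset in the queue. -/
theorem visit_spec (hM : 2 * n + K + 10 ≤ M) {k : ℕ} (hk : k ≤ n) (hc : k + K ≤ c)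
    {q : List (Finset (Fin n))} {s : Store} {S : Finset (Fin n)} {v : Fin n}
    (h : RoundInv G K c k q s) (hS : s.var 6 = enc S) (hv : s.var 7 = v) (hmS : Marked s.mem S) :
    Tr M (visit K) s (visitSteps n K) fun s' => (∀ r < 15, r ≠ 5 → s'.var r = s.var r) ∧
      ∃ q', q <+: q' ∧ RoundInv G K c k q' s' ∧ Explored (wt G K) (k + K) q' S v := by
  have hsub := submod_wt (G := G) K
  have hbit : (Expr.bit (.glob 6) (.glob 7)).eval s [] = if v ∈ S then 1 else 0 :=
    eval_bit h.ctx.order (by simp [eval, hS]) (by simp [eval, hv])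
  have hdesc := descend_spec (G := G) (K := K) (c := c) hM K (f := 20) (by omega)
  have hnorm : ∀ {s : Store} {Y : Finset (Fin n)}, _ → _ → _ → _ → _ → _ → _ :=
    fun {s Y} => normalize_spec (G := G) (K := K) (c := c) hM (s := s) (Y := Y)
  rw [visitSteps]
  generalize descendSteps n K = d at hdesc ⊢
  generalize normalizeSteps n K = d' at hnorm ⊢
  refine (Tr.ite (t := d + (d' + 15)) (fun h' => ?_)
    (fun h' => ?_)).imp (by omega) fun _ h => h
  · refine Tr.skip ⟨fun _ _ _ => rfl, q, List.prefix_rfl, h, fun hvS => ?_⟩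
    rw [hbit, if_neg hvS] at h'
    exact absurd rfl h'
  have hvS : v ∉ S := by
    intro hcon
    rw [hbit, if_pos hcon] at h'
    exact one_ne_zero h'
  set Z := insert v S with hZ
  refine Tr.asg_seq (x := enc Z) (by omega) ?_ (enc_lt_two_pow hM _) fun s1 hm1 hv1 ho1 => ?_
  · simp only [eval]
    rw [eval_pow2 h.ctx.order (by simp [eval, hv]), hS, hZ, enc_insert hvS]
    simp [eval, hv]
  have hs1 : Step G K c 15 s s1 := .of_var hm1 (by omega) ho1
  have hctx1 := hs1.ctx (by omega) h.ctx
  have hcond : (Expr.le (.weight K (.glob 20)) (.add (.glob 3) (.const K))).eval s1 [] =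
      if wt G K Z ≤ k + K then 1 else 0 := by
    have e : (Expr.add (.glob 3) (.const K)).eval s1 [] = k + K := by
      simp only [eval]; rw [hs1.var 3 (by omega), h.level]
    rw [eval_le, eval_weight hctx1 (S := Z) (by simp [eval, hv1]), e]
  refine Tr.ite (fun h' => ?_) (fun h' => ?_)
  swap
  · refine Tr.skip ⟨fun r hr _ => hs1.var r hr, q, List.prefix_rfl, h.of_step (hs1.mono (by omega)),
      fun _ hw => ?_⟩
    rw [hcond, if_pos hw] at h'
    exact absurd h' one_ne_zero
  have hw : wt G K Z ≤ k + K := by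
    by_contra hcon
    rw [hcond, if_neg hcon] at h'
    exact h' rfl
  refine Tr.sto_seq (y := blk n + enc Z) (x := v + 1) ?_ ?_
    (small_lt_two_pow hM (by omega)) fun s2 hv2 hm2 => ?_
  · simp only [eval]; rw [hctx1.block, hv1]; rfl
  · simp only [eval]; rw [hs1.var _ (by omega), hv]
  have hs2 : Step G K c 15 s1 s2 := by
    refine .of_mark hv2 hm2 (Finset.mem_insert_self _ _) ?_ (hw.trans hc)
    rw [Finset.erase_insert hvS]
    exact hs1.marked _ hmS
  have hs02 := hs1.trans hs2
  refine Tr.asg_seq (x := enc (Finset.univ : Finset (Fin n))) (by omega) ?_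
    (enc_lt_two_pow hM _) fun s3 hm3 hv3 ho3 => ?_
  · simp only [eval]; exact (hs02.ctx (by omega) h.ctx).full
  refine Tr.asg_seq (x := k) (by omega) ?_ (small_lt_two_pow hM (by omega))
    fun s4 hm4 hv4 ho4 => ?_
  · simp only [eval]; rw [ho3 _ (by omega), hs02.var _ (by omega), h.level]
  refine Tr.asg_seq (x := k + K) (by omega) ?_ (small_lt_two_pow hM (by omega))
    fun s5 hm5 hv5 ho5 => ?_
  · simp only [eval]; rw [ho4 _ (by omega), ho3 _ (by omega), hs02.var _ (by omega), h.level]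
  have hs05 : Step G K c 15 s s5 := (hs02.trans (.of_var hm3 (by omega) ho3)).trans
    ((Step.of_var hm4 (by omega) ho4).trans (.of_var hm5 (by omega) ho5))
  have hctx5 := hs05.ctx (by omega) h.ctx
  have hθ : s5.var 22 = k := by rw [ho5 _ (by omega), hv4]
  refine (Tr.seq (t₂ := d' + 8) ((hdesc s5 Z Finset.univ hctx5 (hs05.table h.table) (hv5 ▸ hc) ?_ ?_ (Finset.subset_univ _)
    (hv5.symm ▸ hw) (by show s5.var 15 ≤ s5.var 22 + K; omega) ?_).imp le_rfl ?_)).imp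
    (by show _ ≤ d + (d' + 9); omega) fun _ h => h
  · rw [ho5 _ (by omega), ho4 _ (by omega), ho3 _ (by omega), hv2, hv1]
  · show s5.var 21 = _
    rw [ho5 _ (by omega), ho4 _ (by omega), hv3]
  · rw [Marked, hm5, hm4, hm3, hm2, Function.update_self]; omega
  rintro s6 ⟨hs6, Y, hvY, hmY, hD⟩
  rw [hv5] at hD
  have hDc := hD.complete
  rw [show s5.var (20 + 2) = k from hθ] at hDc
  have hs06 : Step G K c 15 s s6 := hs05.trans (hs6.mono (by omega))
  have hctx6 := hs06.ctx (by omega) h.ctx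
  have hcond2 : (Expr.le (.weight K (.glob 20)) (.glob 3)).eval s6 [] =
      if wt G K Y ≤ k then 1 else 0 := by
    have e : (Expr.glob 3).eval s6 [] = k := by
      simp only [eval]; rw [hs06.var 3 (by omega), h.level]
    rw [eval_le, eval_weight hctx6 (S := Y) (by simp [eval, hvY]), e]
  refine Tr.ite (fun h' => ?_) (fun h' => ?_)
  swap
  · refine Tr.skip ⟨fun r hr _ => hs06.var r hr, q, List.prefix_rfl,
      h.of_step (hs06.mono (by omega)), fun _ _ hr => ?_⟩
    -- The full set has weight `0` and so always meets the target `k`; a failed search refutes its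
    -- reachability.
    have := hDc Finset.univ (Finset.Subset.refl _) hr (by rw [wt_univ]; omega)
    rw [hcond2, if_pos this] at h'
    exact absurd h' one_ne_zero
  have hwY : wt G K Y ≤ k := by
    by_contra hcon
    rw [hcond2, if_neg hcon] at h'
    exact h' rfl
  refine (Tr.seq (t₂ := 5) ((hnorm hctx6 (hs06.table h.table) hvY (by omega)
    (hwY.trans hk) hmY).imp le_rfl ?_)).imp (by omega) fun _ h => h
  rintro s7 ⟨hs7, T, hvT, hYT, hwT, htT, hmT, hst⟩
  have hs07 : Step G K c 15 s s7 := hs06.trans hs7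
  refine (enqueue_spec hM hk (h.of_step (hs07.mono (by omega))) hvT
    (Or.inr ⟨hwT.trans hwY, hst⟩) hmT).imp le_rfl ?_
  rintro s8 ⟨hv8, q', hq, hTq, hI⟩
  refine ⟨fun r hr hr5 => by rw [hv8 r hr hr5, hs07.var r hr], q', hq, hI, fun _ _ hr =>
    ⟨T, hTq, hD.reach.subset.trans hYT, ?_⟩⟩
  -- Both replacements, of `Z` by `Y` and of `Y` by `T`, are tight.
  exact (hr.of_tight hsub hD.tight hD.reach.subset).of_tight hsub htT hYT

/-- One round of the search, for the capacity in variable `3`. -/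
def round (K : ℕ) : Cmd :=
  .seq (.asg 4 (.const 0)) <| .seq (.asg 5 (.const 0)) <| .seq (.asg 20 (.const 0)) <|
  .seq enqueue <|
  .whl (.sub (.glob 5) (.glob 4)) <|
  .seq (.asg 6 (.load (.add (.add (.add (.glob 2) (.glob 2)) (.glob 2)) (.glob 4)))) <|
  .seq (.asg 4 (.add (.glob 4) (.const 1))) <|
  .seq (.asg 7 (.const 0)) <|
  .whl (.sub (.glob 0) (.glob 7)) <|
  .seq (visit K) (.asg 7 (.add (.glob 7) (.const 1)))

/-- Number of steps of `round` if at most `N` sets are listed. -/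
def roundSteps (n K N : ℕ) : ℕ := N * (n * (visitSteps n K + 2) + 5) + 10

/-- The invariant of the loops in `round`: the first `h` sets of the queue are explored. -/
structure RoundLoop (G : SimpleGraph (Fin n)) (K c k h : ℕ) (q : List (Finset (Fin n)))
    (s : Store) : Prop extends RoundInv G K c k q s where
  head : s.var 4 = h
  explored : ∀ (i : ℕ) (hi : i < q.length), i < h → ∀ v, Explored (wt G K) (k + K) q q[i] v

/-- From a queued set from which the full set can be reached, exploration leads to a strictly larger
one in the queue with the same property; this can only end at the full set. -/
theorem univ_mem_of_explored {w : Finset (Fin n) → ℕ} {cap : ℕ} {q : List (Finset (Fin n))}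
    (h0 : ∅ ∈ q) (hr : Reach w cap ∅ Finset.univ)
    (hq : ∀ S ∈ q, ∀ v, Explored w cap q S v) : Finset.univ ∈ q := by
  suffices H : ∀ m, ∀ S ∈ q, Reach w cap S Finset.univ → n - S.card ≤ m → Finset.univ ∈ q from
    H n ∅ h0 hr (by omega)
  intro m
  induction m with
  | zero =>
    intro S hS _ hm
    have h1 : S.card ≤ n := by simpa using Finset.card_le_univ S
    have : S = Finset.univ := Finset.eq_univ_of_card S (by simp; omega)
    exact this ▸ hS
  | succ m ih =>
    intro S hS hSr hm
    cases hSr with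
    | refl => exact hS
    | head v hv hc hr =>
      obtain ⟨T, hT, hsub, hTr⟩ := hq S hS v hv hc hr
      refine ih T hT hTr ?_
      have := Finset.card_le_card hsub
      rw [Finset.card_insert_of_notMem hv] at this
      omega

/-- The queue never repeats a set, so the outer loop runs at most `N` times; when it ends, every
queued set has been explored in all directions. -/
theorem round_spec (hM : 2 * n + K + 10 ≤ M) {k N : ℕ} (hk : k ≤ n) (hc : k + K ≤ c)
    (hN : ∀ q : List (Finset (Fin n)), q.Nodup → (∀ X ∈ q, Listed G K k X) → q.length ≤ N)
    {s : Store} (hs : Search G K c k s)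
    (hold : ∀ X : Finset (Fin n), s.mem (2 * blk n + enc X) ≤ k) :
    Tr M (round K) s (roundSteps n K N) fun s' => Search G K c k s' ∧
      (∀ X : Finset (Fin n), s'.mem (2 * blk n + enc X) ≤ k + 1) ∧
      (Reach (wt G K) (k + K) ∅ Finset.univ → Marked s'.mem (Finset.univ : Finset (Fin n))) := by
  rw [round, roundSteps]
  refine Tr.asg_seq (t := N * (n * (visitSteps n K + 2) + 5) + 9) (x := 0) (by omega) rfl
    (by positivity) fun s1 hm1 hv1 ho1 => ?_
  refine Tr.asg_seq (x := 0) (by omega) rfl (by positivity) fun s2 hm2 hv2 ho2 => ?_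
  refine Tr.asg_seq (x := 0) (by omega) rfl (by positivity) fun s3 hm3 hv3 ho3 => ?_
  have hmem3 : s3.mem = s.mem := by rw [hm3, hm2, hm1]
  have hvar3 : ∀ r < 4, s3.var r = s.var r := fun r hr => by
    rw [ho3 _ (by omega), ho2 _ (by omega), ho1 _ (by omega)]
  have hI3 : RoundInv G K c k [] s3 := by
    refine ⟨⟨hs.ctx.of_agree (fun r hr => hvar3 r (by omega)) fun a _ => by rw [hmem3],
      hmem3 ▸ hs.table, by rw [hvar3 3 (by omega), hs.level], hmem3 ▸ hs.empty⟩,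
      ⟨fun i hi => absurd hi (by simp), fun X => ?_, fun X => ?_, List.nodup_nil⟩, ?_, by simp,
      by simp⟩
    · have := hold X
      rw [hmem3]
      simp only [List.not_mem_nil, iff_false]
      omega
    · have := hold X
      rw [hmem3]; omega
    · rw [ho3 _ (by omega), hv2]; rfl
  refine (Tr.seq (t₂ := N * (n * (visitSteps n K + 2) + 5) + 1) ((enqueue_spec hM hk hI3
    (X := ∅) (by rw [hv3, enc_empty]) (Or.inl rfl) (by rw [Marked, hmem3]; exact hs.empty)).imp
    le_rfl ?_)).imp (by omega) fun _ h => h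
  rintro s4 ⟨hv4, q4, -, h0, hI4⟩
  refine (Tr.whl (t := n * (visitSteps n K + 2) + 4) (m := N)
    (I := fun m s' => ∃ q h, RoundLoop G K c k h q s' ∧ ∅ ∈ q ∧ h ≤ q.length ∧ N - h ≤ m)
    ?_ ?_).imp le_rfl ?_
  · rintro m s' ⟨q, h, hI, h0, hle, hm⟩ hne
    have hlt : h < q.length := by
      simp only [eval] at hne
      rw [hI.tail, hI.head] at hne
      omega
    have hlen := hN q hI.queue.nodup hI.listed
    refine Tr.asg_seq (x := enc q[h]) (by omega) ?_ (enc_lt_two_pow hM _) fun s5 hm5 hv5 ho5 => ?_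
    · simp only [eval]
      rw [hI.ctx.block, hI.head, ← hI.queue.items h hlt]
      congr 1
      show blk n + blk n + blk n + h = _
      ring
    refine Tr.asg_seq (x := h + 1) (by omega) ?_ ?_ fun s6 hm6 hv6 ho6 => ?_
    · simp only [eval]; rw [ho5 _ (by omega), hI.head]
    · have := length_le_two_pow hI.queue.nodup
      refine lt_two_pow_of_le (show h + 1 < 2 ^ (n + 1) by rw [pow_succ]; omega) (by omega)
    refine Tr.asg_seq (x := 0) (by omega) rfl (by positivity) fun s7 hm7 hv7 ho7 => ?_
    have hmem7 : s7.mem = s'.mem := by rw [hm7, hm6, hm5]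
    have hvar7 : ∀ r, r ≠ 4 → r ≠ 6 → r ≠ 7 → s7.var r = s'.var r := fun r h4 h6 h7 => by
      rw [ho7 _ h7, ho6 _ h4, ho5 _ h6]
    have hI7 : RoundInv G K c k q s7 :=
      ⟨⟨hI.ctx.of_agree (fun r hr => hvar7 r (by omega) (by omega) (by omega))
        fun a _ => by rw [hmem7], hmem7 ▸ hI.table,
        by rw [hvar7 3 (by omega) (by omega) (by omega), hI.level], hmem7 ▸ hI.empty⟩,
        hmem7 ▸ hI.queue, by rw [hvar7 5 (by omega) (by omega) (by omega), hI.tail], hI.listed,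
        hmem7 ▸ hI.marked⟩
    have hmS : Marked s7.mem q[h] := hI7.marked _ (List.getElem_mem hlt)
    refine (Tr.whl (t := visitSteps n K + 1) (m := n)
      (I := fun m s'' => ∃ q' v, q <+: q' ∧ RoundInv G K c k q' s'' ∧ s''.var 4 = h + 1 ∧
        s''.var 6 = enc q[h] ∧ s''.var 7 = v ∧ v ≤ n ∧ n - v ≤ m ∧ Marked s''.mem q[h] ∧
        ∀ u : Fin n, (u : ℕ) < v → Explored (wt G K) (k + K) q' q[h] u) ?_ ?_).imp le_rfl ?_
    · rintro m' s'' ⟨q', v, hpre, hI', h4, h6, h7, hvn, hm', hmk, hex⟩ hne'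
      have hvlt : v < n := by
        simp only [eval] at hne'
        rw [hI'.ctx.order, h7] at hne'
        omega
      refine (Tr.seq (t₂ := 1) ((visit_spec hM hk hc hI' h6 (v := ⟨v, hvlt⟩) h7 hmk).imp
        le_rfl ?_))
      rintro s8 ⟨hv8, q'', hpre', hI8, hex8⟩
      refine Tr.asg (x := v + 1) (by omega) ?_ (small_lt_two_pow hM (by omega))
        fun s9 hm9 hv9 ho9 => ?_
      · simp only [eval]; rw [hv8 7 (by omega) (by omega), h7]
      refine ⟨n - (v + 1), by omega, q'', v + 1, hpre.trans hpre', hI8.of_step (.of_var hm9 (by omega) ho9),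
        ?_, ?_, hv9, by omega, le_rfl, ?_, fun u hu => ?_⟩
      · rw [ho9 _ (by omega), hv8 4 (by omega) (by omega), h4]
      · rw [ho9 _ (by omega), hv8 6 (by omega) (by omega), h6]
      · rw [hm9]
        exact hI8.marked _ (hpre'.subset (hpre.subset (List.getElem_mem hlt)))
      · by_cases huv : (u : ℕ) = v
        · have : u = ⟨v, hvlt⟩ := Fin.ext huv
          rw [this]; exact hex8
        · exact (hex u (by omega)).mono hpre'
    · refine ⟨q, 0, List.prefix_rfl, hI7, ?_, ?_, hv7, by omega, by omega, hmS,
        fun u hu => by omega⟩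
      · rw [ho7 _ (by omega), hv6]
      · rw [ho7 _ (by omega), ho6 _ (by omega), hv5]
    · rintro s'' ⟨⟨m', q', v, hpre, hI', h4, h6, h7, hvn, hm', hmk, hex⟩, hz⟩
      have hveq : v = n := by
        simp only [eval] at hz
        rw [hI'.ctx.order, h7] at hz
        omega
      refine ⟨N - (h + 1), by omega, q', h + 1, ⟨hI', h4, ?_⟩, hpre.subset h0, ?_, le_rfl⟩
      · intro i hi hih v
        by_cases hieq : i = h
        · subst hieq
          rw [← hpre.getElem hlt]
          exact hex v (by omega)
        · rw [← hpre.getElem (show i < q.length by omega)]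
          exact (hI.explored i (by omega) (by omega) v).mono hpre
      · have := hpre.length_le; omega
  · refine ⟨q4, 0, ⟨hI4, ?_, fun i _ hi => by omega⟩, h0, by omega, by omega⟩
    rw [hv4 4 (by omega) (by omega), ho3 _ (by omega), ho2 _ (by omega), hv1]
  · rintro s' ⟨⟨m, q, h, hI, h0, hle, -⟩, hz⟩
    have hh : h = q.length := by
      simp only [eval] at hz
      rw [hI.tail, hI.head] at hz
      omega
    refine ⟨hI.toSearch, hI.queue.le, fun hr => ?_⟩
    refine hI.marked _ (univ_mem_of_explored h0 hr fun S hS v => ?_)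
    obtain ⟨i, hi, rfl⟩ := List.getElem_of_mem hS
    exact hI.explored i hi (by omega) v

/-! ### Asymptotics -/

/-- The number of subsets of an `n`-set of size at most `n / d`. -/
def smallSets (n d : ℕ) : ℕ := (Finset.univ.filter fun S : Finset (Fin n) => d * S.card ≤ n).card

/-- In the generating function `∑ x ^ S.card = (1 + x) ^ n`, every counted set contributes at least
`x ^ (n / d)`, as `x ≤ 1`. -/
theorem smallSets_le (n : ℕ) {d : ℕ} (hd : 0 < d) {x : ℝ} (hx : 0 < x) (hx1 : x ≤ 1) :
    (smallSets n d : ℝ) ≤ ((1 + x) * x ^ (-(1 / d : ℝ))) ^ n := by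
  have h : (smallSets n d : ℝ) * (x ^ (1 / d : ℝ)) ^ n ≤ (1 + x) ^ n := by
    have h1 : ∑ S : Finset (Fin n), x ^ S.card = (1 + x) ^ n := by
      have := Finset.sum_pow_mul_eq_add_pow x 1 (Finset.univ : Finset (Fin n))
      simp only [one_pow, mul_one, Finset.powerset_univ, Finset.card_univ, Fintype.card_fin] at this
      rw [this, add_comm]
    rw [← h1, smallSets, ← nsmul_eq_mul, ← Finset.sum_const]
    refine (Finset.sum_le_sum fun S hS => ?_).trans
      (Finset.sum_le_sum_of_subset_of_nonneg (Finset.filter_subset _ _) fun S _ _ => by positivity)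
    rw [← Real.rpow_natCast, ← Real.rpow_natCast, ← Real.rpow_mul hx.le]
    refine Real.rpow_le_rpow_of_exponent_ge hx hx1 ?_
    have h2 : ((d * S.card : ℕ) : ℝ) ≤ n := by exact_mod_cast (Finset.mem_filter.1 hS).2
    have h3 : (0 : ℝ) < d := by exact_mod_cast hd
    push_cast at h2
    rw [one_div, inv_mul_eq_div, le_div_iff₀ h3]
    linarith
  rw [mul_pow, Real.rpow_neg hx.le, inv_pow, ← div_eq_mul_inv, le_div_iff₀ (by positivity)]
  exact h

/-- For fixed `x` the base tends to `1 + x` as `K` grows, and `x` can be taken small. -/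
theorem exists_rate {r : ℝ} (hr : 1 < r) :
    ∃ K : ℕ, 0 < K ∧ ∀ n : ℕ, (smallSets n (K + 1) : ℝ) ≤ r ^ n := by
  obtain ⟨x, hx0, hx1, hxr⟩ : ∃ x : ℝ, 0 < x ∧ x ≤ 1 ∧ 1 + x < r := by
    refine ⟨min 1 ((r - 1) / 2), lt_min one_pos (by linarith), min_le_left _ _, ?_⟩
    have := min_le_right 1 ((r - 1) / 2)
    linarith
  have ht : Tendsto (fun K : ℕ => (1 + x) * x ^ (-(1 / ((K : ℝ) + 1)))) atTop (nhds (1 + x)) := by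
    have h1 : Tendsto (fun K : ℕ => -(1 / ((K : ℝ) + 1))) atTop (nhds 0) := by
      simpa using (tendsto_one_div_add_atTop_nhds_zero_nat (𝕜 := ℝ)).neg
    have h2 := ((Real.continuous_const_rpow hx0.ne').tendsto 0).comp h1
    rw [Real.rpow_zero] at h2
    simpa using h2.const_mul (1 + x)
  obtain ⟨K, hK, hK0⟩ := ((ht.eventually (gt_mem_nhds hxr)).and (eventually_gt_atTop 0)).exists
  refine ⟨K, hK0, fun n => (smallSets_le n K.succ_pos hx0 hx1).trans ?_⟩
  refine pow_le_pow_left₀ (by positivity) ?_ n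
  push_cast
  exact hK.le

theorem smallSets_three_le :
    ∃ r : ℝ, 1 ≤ r ∧ r < 1.89 ∧ ∀ n : ℕ, (smallSets n 3 : ℝ) ≤ r ^ n := by
  -- The base is `(3 / 2) * 2 ^ (1 / 3)`. Its cube is `6.75`, just below `1.89 ^ 3`.
  refine ⟨(1 + 1 / 2) * (1 / 2 : ℝ) ^ (-(1 / (3 : ℕ) : ℝ)), ?_, ?_,
    fun n => smallSets_le n (by norm_num) (by norm_num) (by norm_num)⟩
  · have : (1 : ℝ) ≤ (1 / 2 : ℝ) ^ (-(1 / (3 : ℕ) : ℝ)) :=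
      Real.one_le_rpow_of_pos_of_le_one_of_nonpos (by norm_num) (by norm_num) (by norm_num)
    linarith
  · refine lt_of_pow_lt_pow_left₀ 3 (by norm_num) ?_
    rw [mul_pow, ← Real.rpow_natCast, ← Real.rpow_natCast ((1 / 2 : ℝ) ^ _),
      ← Real.rpow_mul (by norm_num)]
    norm_num

/-- The number of sets that a round lists. -/
def listBound (K n : ℕ) : ℕ := 3 * smallSets n 3 * smallSets n (K + 1) + 2

theorem exists_listBound_isBigO :
    ∃ K : ℕ, 0 < K ∧ ∀ p : ℕ → ℕ, PolyBdd p →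
      (fun n : ℕ => ((p n * listBound K n : ℕ) : ℝ)) =O[atTop] fun n : ℕ => (1.89 : ℝ) ^ n := by
  obtain ⟨r, hr1, hr2, hr⟩ := smallSets_three_le
  have hq : 1 < 1.89 / r := by rw [lt_div_iff₀ (by linarith)]; linarith
  -- The gap between `r` and `1.89` is split: `q` pays for the choice of components, and the rest
  -- absorbs the polynomial.
  obtain ⟨q, hq1, hq2⟩ := exists_between hq
  obtain ⟨K, hK0, hK⟩ := exists_rate hq1
  have hrq : r * q < 1.89 := by rw [lt_div_iff₀ (by linarith)] at hq2; linarith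
  have hrq1 : 1 ≤ r * q := one_le_mul_of_one_le_of_one_le hr1 hq1.le
  refine ⟨K, hK0, fun p ⟨c, hp⟩ => ?_⟩
  have h1 : (fun n : ℕ => ((p n * listBound K n : ℕ) : ℝ)) =O[atTop]
      fun n : ℕ => ((n : ℝ) ^ c * (r * q) ^ n) := by
    -- For `n ≥ 1` one has `n + 2 ≤ 3 * n`; the factor `5` is the `3 + 2` of `listBound`.
    refine IsBigO.of_bound (3 ^ c * 5) (eventually_atTop.2 ⟨1, fun n hn => ?_⟩)
    rw [Real.norm_of_nonneg (by positivity), Real.norm_of_nonneg (by positivity)]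
    have hn' : (1 : ℝ) ≤ n := by exact_mod_cast hn
    have h2 : (p n : ℝ) ≤ 3 ^ c * (n : ℝ) ^ c := by
      have : (p n : ℝ) ≤ ((n : ℝ) + 2) ^ c := by exact_mod_cast hp n
      rw [← mul_pow]
      exact this.trans (pow_le_pow_left₀ (by positivity) (by linarith) c)
    have h3 : (listBound K n : ℝ) ≤ 5 * (r * q) ^ n := by
      have h4 : (smallSets n 3 : ℝ) * smallSets n (K + 1) ≤ (r * q) ^ n := by
        rw [mul_pow]
        exact mul_le_mul (hr n) (hK n) (by positivity) (by positivity)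
      have h5 : 1 ≤ (r * q) ^ n := one_le_pow₀ hrq1
      rw [listBound]
      push_cast
      nlinarith
    push_cast
    calc (p n : ℝ) * listBound K n ≤ (3 ^ c * (n : ℝ) ^ c) * (5 * (r * q) ^ n) :=
          mul_le_mul h2 h3 (by positivity) (by positivity)
      _ = _ := by ring
  refine h1.trans ?_
  have h2 : (fun n : ℕ => (n : ℝ) ^ c) =O[atTop] fun n : ℕ => (1.89 / (r * q)) ^ n :=
    (isLittleO_pow_const_const_pow_of_one_lt (R := ℝ) c (by
      rw [lt_div_iff₀ (by linarith)]; linarith)).isBigO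
  refine (h2.mul (isBigO_refl (fun n : ℕ => (r * q) ^ n) atTop)).congr_right fun n => ?_
  rw [← mul_pow, div_mul_cancel₀ _ (by linarith)]

/-! ### The number of listed sets -/

/-- A set with outer neighbourhood `nb G X` that cannot be extended by few vertices without
enlarging the neighbourhood. -/
def Closed (G : SimpleGraph (Fin n)) (K : ℕ) (X : Finset (Fin n)) : Prop :=
  ∀ C : Finset (Fin n), C.Nonempty → Disjoint X C → C.card ≤ K → ¬ nb G C ⊆ X ∪ nb G X

theorem Reach.of_forall {α : Type*} [DecidableEq α] {w : Finset α → ℕ} {c : ℕ} {S T : Finset α}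
    (hST : S ⊆ T) (h : ∀ X, S ⊆ X → X ⊆ T → w X ≤ c) : Reach w c S T := by
  induction hm : (T \ S).card generalizing S with
  | zero =>
    rw [Finset.card_eq_zero, Finset.sdiff_eq_empty_iff_subset] at hm
    rw [Finset.Subset.antisymm hST hm]
    exact .refl _
  | succ m ih =>
    obtain ⟨v, hv⟩ := Finset.card_pos.1 (show 0 < (T \ S).card by omega)
    obtain ⟨hvT, hvS⟩ := Finset.mem_sdiff.1 hv
    have hsub := Finset.insert_subset hvT hST
    refine .head v hvS (h _ (Finset.subset_insert _ _) hsub) (ih hsub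
      (fun X hX => h X ((Finset.subset_insert _ _).trans hX)) ?_)
    rw [Finset.sdiff_insert, Finset.card_erase_of_mem hv, hm, Nat.add_sub_cancel]

/-- If the neighbours of `C` lay in `X ∪ nb G X`, adding `C` vertex by vertex would create no outer
neighbours besides those of `X` and at most `K` vertices of `C`, and would end with no more outer
neighbours than `X` has. This contradicts stuckness. -/
theorem Stuck.closed {X : Finset (Fin n)} (hX : X ≠ Finset.univ)
    (h : Stuck (wt G K) (wt G K X + K) Finset.univ X) : Closed G K X := by
  intro C hC hd hcard hnb
  have hlt : X ⊂ X ∪ C := by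
    refine lt_of_le_of_ne Finset.subset_union_left fun heq => ?_
    obtain ⟨v, hv⟩ := hC
    exact Finset.disjoint_left.1 hd (heq ▸ Finset.mem_union_right X hv) hv
  have hw := wt_of_ne (G := G) (K := K) hX
  have hr : Reach (wt G K) (wt G K X + K) X (X ∪ C) := by
    refine Reach.of_forall hlt.subset fun Y hXY hYC => ?_
    rw [hw, add_assoc, add_comm K K, ← add_assoc]
    refine wt_le_of_card_nb ((Finset.card_le_card (t := nb G X ∪ C) fun v hv => ?_).trans
      ((Finset.card_union_le _ _).trans (by omega)))
    obtain ⟨hvY, u, hu, huv⟩ := mem_nb.1 hv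
    rw [Finset.mem_union]
    rcases Finset.mem_union.1 (hYC hu) with h1 | h1
    · exact Or.inl (mem_nb.2 ⟨fun h => hvY (hXY h), u, h1, huv⟩)
    · by_cases hvC : v ∈ C
      · exact Or.inr hvC
      · rcases Finset.mem_union.1 (hnb (mem_nb.2 ⟨hvC, u, h1, huv⟩)) with h2 | h2
        · exact absurd (hXY h2) hvY
        · exact Or.inl h2
  refine absurd (h _ hlt (Finset.subset_univ _) hr) (not_lt.2 ?_)
  rw [hw]
  refine wt_le_of_card_nb (Finset.card_le_card fun v hv => ?_)
  obtain ⟨hvY, u, hu, huv⟩ := mem_nb.1 hv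
  rw [Finset.mem_union, not_or] at hvY
  rcases Finset.mem_union.1 hu with h1 | h1
  · exact mem_nb.2 ⟨hvY.1, u, h1, huv⟩
  · exact (Finset.mem_union.1 (hnb (mem_nb.2 ⟨hvY.2, u, h1, huv⟩))).resolve_left hvY.1

/-! ### Recovering a closed set from its boundary or from the remaining vertices -/

/-- The graph without the edges at vertices of `B`. -/
def avoid (G : SimpleGraph (Fin n)) (B : Finset (Fin n)) : SimpleGraph (Fin n) where
  Adj u v := G.Adj u v ∧ u ∉ B ∧ v ∉ B
  symm := ⟨fun _ _ h => ⟨h.1.symm, h.2.2, h.2.1⟩⟩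
  loopless := ⟨fun v h => G.loopless.irrefl v h.1⟩

open Classical in
/-- The vertices of the component of `v` in `avoid G B`. -/
noncomputable def component (G : SimpleGraph (Fin n)) (B : Finset (Fin n)) (v : Fin n) :
    Finset (Fin n) :=
  Finset.univ.filter fun u => (avoid G B).Reachable v u

theorem mem_component {B : Finset (Fin n)} {u v : Fin n} :
    u ∈ component G B v ↔ (avoid G B).Reachable v u := by
  simp [component]

theorem reachable_induction {H : SimpleGraph (Fin n)} {P : Fin n → Prop}
    (hP : ∀ u v, H.Adj u v → P u → P v) {u v : Fin n} (h : H.Reachable u v) (hu : P u) : P v := by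
  obtain ⟨p⟩ := h
  induction p with
  | nil => exact hu
  | cons ha _ ih => exact ih (hP _ _ ha hu)

/-- An edge that leaves `X` ends in `nb G X`, so `X` is a union of components once the edges at its
boundary are removed. -/
theorem mem_iff_of_reachable {X : Finset (Fin n)} {u v : Fin n}
    (h : (avoid G (nb G X)).Reachable u v) : u ∈ X ↔ v ∈ X := by
  have key : ∀ u v, (avoid G (nb G X)).Adj u v → u ∈ X → v ∈ X := fun u v ha hu => by
    by_contra hv
    exact ha.2.2 (mem_nb.2 ⟨hv, u, hu, ha.1⟩)
  exact ⟨reachable_induction key h, reachable_induction key h.symm⟩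

open Classical in
/-- The vertices outside `B` whose component in `avoid G B` is small or meets `M`. -/
noncomputable def ofSeparator (G : SimpleGraph (Fin n)) (K : ℕ) (B M : Finset (Fin n)) :
    Finset (Fin n) :=
  Finset.univ.filter fun v =>
    v ∉ B ∧ ((component G B v).card ≤ K ∨ ∃ m ∈ M, m ∈ component G B v)

/-- `M` takes one representative from each component in `X` with more than `K` vertices. These
components are disjoint, which bounds `M`. -/
theorem Closed.exists_ofSeparator {X : Finset (Fin n)} (h : Closed G K X) :
    ∃ M : Finset (Fin n), (K + 1) * M.card ≤ n ∧ X = ofSeparator G K (nb G X) M := by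
  classical
  set H := avoid G (nb G X) with hH
  set rep : Fin n → Fin n := fun v => (H.connectedComponentMk v).out with hrep
  have hrepr : ∀ v, H.Reachable v (rep v) := fun v =>
    SimpleGraph.ConnectedComponent.exact ((Quot.out_eq (H.connectedComponentMk v)).symm)
  have hrepeq : ∀ u v, H.Reachable u v → rep u = rep v := fun u v huv => by
    rw [hrep]; simp only; rw [SimpleGraph.ConnectedComponent.sound huv]
  refine ⟨Finset.univ.filter fun v => v ∈ X ∧ K < (component G (nb G X) v).card ∧ rep v = v,
    ?_, ?_⟩
  · set M := Finset.univ.filter fun v => v ∈ X ∧ K < (component G (nb G X) v).card ∧ rep v = v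
    have hd : (M : Set (Fin n)).PairwiseDisjoint (component G (nb G X)) := by
      intro a ha b hb hab
      refine Finset.disjoint_left.2 fun u hua hub => hab ?_
      rw [mem_component] at hua hub
      rw [← (Finset.mem_filter.1 (Finset.mem_coe.1 ha)).2.2.2,
        ← (Finset.mem_filter.1 (Finset.mem_coe.1 hb)).2.2.2]
      exact hrepeq a b (hua.trans hub.symm)
    have h1 := Finset.card_biUnion hd
    have h2 : (M.biUnion (component G (nb G X))).card ≤ n := by
      simpa using Finset.card_le_univ (M.biUnion (component G (nb G X)))
    rw [h1] at h2
    have h3 := Finset.card_nsmul_le_sum M (fun v => (component G (nb G X) v).card) (K + 1)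
      fun v hv => (Finset.mem_filter.1 hv).2.2.1
    rw [smul_eq_mul, mul_comm] at h3
    exact h3.trans h2
  · ext v
    simp only [ofSeparator, Finset.mem_filter, Finset.mem_univ, true_and, mem_component]
    constructor
    · intro hv
      refine ⟨fun hb => (mem_nb.1 hb).1 hv, ?_⟩
      by_cases hs : (component G (nb G X) v).card ≤ K
      · exact Or.inl hs
      · have hr := hrepr v
        refine Or.inr ⟨rep v, ⟨(mem_iff_of_reachable hr).1 hv, ?_, (hrepeq _ _ hr).symm⟩, hr⟩
        rw [show component G (nb G X) (rep v) = component G (nb G X) v by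
          ext u
          rw [mem_component, mem_component]
          exact ⟨hr.trans, hr.symm.trans⟩]
        omega
    · rintro ⟨hvB, hs | ⟨m, hm, hr⟩⟩
      · by_contra hvX
        -- A small component outside `X` has all its outer neighbours in `nb G X`, which closedness
        -- forbids.
        refine h (component G (nb G X) v) ⟨v, mem_component.2 (.refl v)⟩
          (Finset.disjoint_left.2 fun u hu hur => hvX
            ((mem_iff_of_reachable (mem_component.1 hur)).2 hu)) hs fun y hy => ?_
        obtain ⟨hy, u, hu, huy⟩ := mem_nb.1 hy
        refine Finset.mem_union_right _ ?_
        by_contra hyB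
        have huB : u ∉ nb G X :=
          reachable_induction (P := fun u => u ∉ nb G X) (H := avoid G (nb G X))
            (fun a b ha _ => ha.2.2) (mem_component.1 hu) hvB
        exact hy (mem_component.2 ((mem_component.1 hu).trans
          (SimpleGraph.Adj.reachable (G := avoid G (nb G X)) ⟨huy, huB, hyB⟩)))
      · exact (mem_iff_of_reachable hr).2 hm.1

/-- The vertices outside `R` and not adjacent to `R`. -/
noncomputable def ofRest (G : SimpleGraph (Fin n)) (R : Finset (Fin n)) : Finset (Fin n) :=
  (R ∪ nb G R)ᶜ

/-- The remainder has the same outer neighbours as `X`. A boundary vertex without a neighbour in the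
remainder would, as a one-element set, violate closedness; this is where `0 < K` enters. -/
theorem Closed.eq_ofRest {X : Finset (Fin n)} (hK : 0 < K) (h : Closed G K X) :
    X = ofRest G (X ∪ nb G X)ᶜ := by
  have key : nb G (X ∪ nb G X)ᶜ = nb G X := by
    ext b
    constructor
    · intro hb
      obtain ⟨h1, u, h2, h3⟩ := mem_nb.1 hb
      rw [Finset.mem_compl, not_not] at h1
      rw [Finset.mem_compl] at h2
      refine (Finset.mem_union.1 h1).resolve_left fun hbX => h2 ?_
      rw [Finset.mem_union]
      by_cases huX : u ∈ X
      · exact Or.inl huX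
      · exact Or.inr (mem_nb.2 ⟨huX, b, hbX, h3.symm⟩)
    · intro hb
      have hb' := mem_nb.1 hb
      refine mem_nb.2 ⟨by simp [hb], ?_⟩
      by_contra hcon
      push Not at hcon
      refine h {b} ⟨b, Finset.mem_singleton_self b⟩ (Finset.disjoint_singleton_right.2 hb'.1)
        (by rwa [Finset.card_singleton]) fun y hy => ?_
      obtain ⟨-, u, hu, huy⟩ := mem_nb.1 hy
      rw [Finset.mem_singleton] at hu
      subst hu
      by_contra hy'
      exact hcon y (Finset.mem_compl.2 hy') huy.symm
  rw [ofRest, key]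
  ext v
  by_cases hv : v ∈ nb G X
  · simp [hv, (mem_nb.1 hv).1]
  · simp [hv]

theorem one_le_smallSets (n d : ℕ) : 1 ≤ smallSets n d :=
  Finset.card_pos.2 ⟨∅, by simp⟩

/-- `X`, its boundary and the remainder partition the vertices, so one of them has at most `n / 3`
elements. The cases give `A`, its image under `ofRest`, and the sets built from a separator with
chosen components; `∅` and the full set account for the extra `2`. -/
theorem listed_length_le (hK : 0 < K) {k : ℕ} {q : List (Finset (Fin n))} (hq : q.Nodup)
    (h : ∀ X ∈ q, Listed G K k X) : q.length ≤ listBound K n := by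
  classical
  set A := Finset.univ.filter fun S : Finset (Fin n) => 3 * S.card ≤ n with hA
  set B := Finset.univ.filter fun S : Finset (Fin n) => (K + 1) * S.card ≤ n with hB
  have hsub : q.toFinset ⊆ ({∅, Finset.univ} : Finset (Finset (Fin n))) ∪
      (A ∪ (A.image (ofRest G) ∪ (A ×ˢ B).image fun p => ofSeparator G K p.1 p.2)) := by
    intro X hX
    rw [List.mem_toFinset] at hX
    simp only [Finset.mem_union, Finset.mem_insert, Finset.mem_singleton, Finset.mem_image]
    rcases h X hX with h1 | ⟨-, h1⟩
    · exact Or.inl (Or.inl h1)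
    by_cases hXu : X = Finset.univ
    · exact Or.inl (Or.inr hXu)
    have hcl := h1.closed hXu
    have hd : Disjoint X (nb G X) := Finset.disjoint_right.2 fun v hv => (mem_nb.1 hv).1
    have hsum := Finset.card_add_card_compl (X ∪ nb G X)
    rw [Finset.card_union_of_disjoint hd, Fintype.card_fin] at hsum
    refine Or.inr ?_
    by_cases c1 : 3 * X.card ≤ n
    · exact Or.inl (by simpa [hA] using c1)
    by_cases c2 : 3 * (X ∪ nb G X)ᶜ.card ≤ n
    · exact Or.inr (Or.inl ⟨_, by simpa only [hA, Finset.mem_filter, Finset.mem_univ, true_and]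
        using c2, (hcl.eq_ofRest hK).symm⟩)
    · obtain ⟨M, hM, hXM⟩ := hcl.exists_ofSeparator
      refine Or.inr (Or.inr ⟨(nb G X, M), Finset.mem_product.2 ⟨?_, ?_⟩, hXM.symm⟩)
      · simp only [hA, Finset.mem_filter, Finset.mem_univ, true_and]; omega
      · simpa only [hB, Finset.mem_filter, Finset.mem_univ, true_and] using hM
  have h1 := Finset.card_le_card hsub
  rw [List.toFinset_card_of_nodup hq] at h1
  have h2 := Finset.card_union_le ({∅, Finset.univ} : Finset (Finset (Fin n)))
    (A ∪ (A.image (ofRest G) ∪ (A ×ˢ B).image fun p => ofSeparator G K p.1 p.2))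
  have h3 := Finset.card_union_le A
    (A.image (ofRest G) ∪ (A ×ˢ B).image fun p => ofSeparator G K p.1 p.2)
  have h4 := Finset.card_union_le (A.image (ofRest G))
    ((A ×ˢ B).image fun p => ofSeparator G K p.1 p.2)
  have h5 : (A.image (ofRest G)).card ≤ A.card := Finset.card_image_le
  have h6 : ((A ×ˢ B).image fun p => ofSeparator G K p.1 p.2).card ≤ A.card * B.card :=
    Finset.card_image_le.trans (Finset.card_product _ _).le
  have h7 := Finset.card_le_two (a := (∅ : Finset (Fin n))) (b := Finset.univ)
  have h8 : A.card ≤ A.card * B.card := Nat.le_mul_of_pos_right _ (one_le_smallSets n (K + 1))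
  have h9 : listBound K n = 3 * (A.card * B.card) + 2 := by rw [listBound, mul_assoc]; rfl
  omega

/-! ### Layouts and expansions -/

/-- The vertex `v` lies on an edge that meets no other edge. -/
def OnIsolatedEdge (G : SimpleGraph (Fin n)) (v : Fin n) : Prop :=
  ∃ u, G.Adj v u ∧ (∀ y, G.Adj v y → y = u) ∧ ∀ y, G.Adj u y → y = v

theorem OnIsolatedEdge.of_adj {u v : Fin n} (h : OnIsolatedEdge G u) (huv : G.Adj u v) :
    OnIsolatedEdge G v := by
  obtain ⟨w, h1, h2, h3⟩ := h
  rw [← h2 v huv] at h3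
  exact ⟨u, huv.symm, h3, fun y hy => (h2 y hy).trans (h2 v huv).symm⟩

open Classical in
/-- The vertices that have all their edges in `F` or lie on an isolated edge. -/
noncomputable def finished (G : SimpleGraph (Fin n)) (F : Set (Sym2 (Fin n))) : Finset (Fin n) :=
  Finset.univ.filter fun v => (∀ u, G.Adj v u → s(v, u) ∈ F) ∨ OnIsolatedEdge G v

theorem mem_finished {F : Set (Sym2 (Fin n))} {v : Fin n} :
    v ∈ finished G F ↔ (∀ u, G.Adj v u → s(v, u) ∈ F) ∨ OnIsolatedEdge G v := by
  simp [finished]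

theorem not_mem_finished {F : Set (Sym2 (Fin n))} {v : Fin n} (h : v ∉ finished G F) :
    (∃ u, G.Adj v u ∧ s(v, u) ∉ F) ∧ ¬ OnIsolatedEdge G v := by
  rw [mem_finished, not_or] at h
  push Not at h
  exact h

/-- An outer neighbour is unfinished, so it has an edge outside `F`. Its finished neighbour cannot
lie on an isolated edge, so the edge between them is in `F`. -/
theorem nb_finished_subset (F : Set (Sym2 (Fin n))) : (nb G (finished G F) : Set (Fin n)) ⊆ mid G F := by
  intro y hy
  obtain ⟨h1, u, hu, huy⟩ := mem_nb.1 (Finset.mem_coe.1 hy)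
  obtain ⟨⟨z, hz, hzF⟩, hiso⟩ := not_mem_finished h1
  refine ⟨⟨s(u, y), ?_, by simp⟩, s(y, z), ⟨hz, hzF⟩, by simp⟩
  rcases mem_finished.1 hu with h | h
  · exact h y huy
  · exact absurd (h.of_adj huy) hiso

theorem card_nb_finished_le (F : Set (Sym2 (Fin n))) :
    (nb G (finished G F)).card ≤ (mid G F).ncard := by
  rw [← Set.ncard_coe_finset]
  exact Set.ncard_le_ncard (nb_finished_subset F) (Set.toFinite _)

/-- Before any edge occurs, the finished vertices with a neighbour lie on isolated edges. Completing
each such edge before going on keeps at most one outer neighbour. -/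
theorem reach_finished_empty (hc : 1 + K ≤ c) : Reach (wt G K) c ∅ (finished G ∅) := by
  suffices H : ∀ m, ∀ X ⊆ finished G ∅, (nb G X).card ≤ 1 → (finished G ∅ \ X).card = m →
      Reach (wt G K) c X (finished G ∅) from
    H _ ∅ (Finset.empty_subset _) (by
      rw [show nb G ∅ = ∅ by ext v; simp [mem_nb]]; simp) rfl
  intro m
  induction m with
  | zero =>
    intro X hX _ hm
    rw [Finset.card_eq_zero, Finset.sdiff_eq_empty_iff_subset] at hm
    rw [Finset.Subset.antisymm hX hm]
    exact .refl _
  | succ m ih =>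
    intro X hX hnb hm
    have hiso : ∀ u ∈ finished G ∅, ∀ v, G.Adj u v → OnIsolatedEdge G u := fun u hu v huv =>
      (mem_finished.1 hu).resolve_left fun h => h v huv
    obtain ⟨v, hv, hv1⟩ : ∃ v ∈ finished G ∅ \ X, (nb G (insert v X)).card ≤ 1 := by
      rcases (nb G X).eq_empty_or_nonempty with h0 | ⟨b, hb⟩
      · obtain ⟨v, hv⟩ := Finset.card_pos.1 (show 0 < (finished G ∅ \ X).card by omega)
        refine ⟨v, hv, Finset.card_le_one.2 fun a ha b hb => ?_⟩
        have key : ∀ a ∈ nb G (insert v X), G.Adj v a := fun a ha => by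
          obtain ⟨h1, u, h2, h3⟩ := mem_nb.1 ha
          rcases Finset.mem_insert.1 h2 with rfl | h2
          · exact h3
          · have : a ∈ nb G X := mem_nb.2 ⟨fun h => h1 (Finset.mem_insert_of_mem h), u, h2, h3⟩
            rw [h0] at this
            exact absurd this (Finset.notMem_empty a)
        obtain ⟨w, -, h, -⟩ := hiso v (Finset.mem_sdiff.1 hv).1 a (key a ha)
        exact (h a (key a ha)).trans (h b (key b hb)).symm
      · obtain ⟨hbX, u, hu, hub⟩ := mem_nb.1 hb
        have hib := (hiso u (hX hu) b hub).of_adj hub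
        refine ⟨b, Finset.mem_sdiff.2 ⟨mem_finished.2 (Or.inr hib), hbX⟩, ?_⟩
        rw [show nb G (insert b X) = ∅ from Finset.eq_empty_of_forall_notMem fun a ha => ?_]
        · simp
        obtain ⟨h1, y, h2, h3⟩ := mem_nb.1 ha
        rcases Finset.mem_insert.1 h2 with rfl | h2
        · obtain ⟨w, -, h, -⟩ := hib
          rw [h a h3, ← h u hub.symm] at h1
          exact h1 (Finset.mem_insert_of_mem hu)
        · have ha' : a ∈ nb G X := mem_nb.2 ⟨fun h => h1 (Finset.mem_insert_of_mem h), y, h2, h3⟩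
          rw [Finset.card_le_one.1 hnb a ha' b hb] at h1
          exact h1 (Finset.mem_insert_self _ _)
    obtain ⟨h1, h2⟩ := Finset.mem_sdiff.1 hv
    refine .head v h2 ((wt_le_of_card_nb hv1).trans hc)
      (ih _ (Finset.insert_subset h1 hX) hv1 ?_)
    rw [Finset.sdiff_insert, Finset.card_erase_of_mem hv, hm, Nat.add_sub_cancel]

/-- Adding the edge `u v` to `F`. -/
theorem reach_finished_insert {q : ℕ} {F : Set (Sym2 (Fin n))} {u v : Fin n} (huv : G.Adj u v)
    (hF : (mid G F).ncard ≤ q) (hF' : (mid G (insert s(u, v) F)).ncard ≤ q) :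
    Reach (wt G K) (q + K) (finished G F) (finished G (insert s(u, v) F)) := by
  set D := finished G F with hD
  set D' := finished G (insert s(u, v) F) with hD'
  have hsub : D ⊆ D' := fun x hx => by
    rcases mem_finished.1 hx with h | h
    · exact mem_finished.2 (Or.inl fun y hy => Set.mem_insert_of_mem _ (h y hy))
    · exact mem_finished.2 (Or.inr h)
  have hnew : ∀ x ∈ D', x ∉ D → x = u ∨ x = v := fun x hx hxD => by
    obtain ⟨⟨z, hz, hzF⟩, hiso⟩ := not_mem_finished hxD
    have h1 := (mem_finished.1 hx).resolve_right hiso z hz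
    have h2 : x ∈ s(u, v) := by
      rw [← (Set.mem_insert_iff.1 h1).resolve_right hzF]; simp
    simpa using h2
  have hw' : wt G K D' ≤ q + K := wt_le_of_card_nb ((card_nb_finished_le _).trans hF')
  by_cases hu : u ∈ D' ∧ u ∉ D
  · by_cases hv : v ∈ D' ∧ v ∉ D
    · have hD'' : D' = insert v (insert u D) := by
        ext x
        simp only [Finset.mem_insert]
        constructor
        · intro hx
          by_cases hxD : x ∈ D
          · exact Or.inr (Or.inr hxD)
          · rcases hnew x hx hxD with h | h
            · exact Or.inr (Or.inl h)
            · exact Or.inl h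
        · rintro (rfl | rfl | hx)
          · exact hv.1
          · exact hu.1
          · exact hsub hx
      -- If both ends finish at once, they enter one after the other, and in between `v` may be an
      -- extra outer neighbour. There is room for it: the edge is not isolated, so `u` or `v` lies
      -- in `mid G F`, and neither lies in the new middle set.
      have hcard : (mid G (insert s(u, v) F)).ncard + 1 ≤ (mid G F).ncard := by
        have hiu := (not_mem_finished hu.2).2
        have hiv := (not_mem_finished hv.2).2
        have hfu := (mem_finished.1 hu.1).resolve_right hiu
        have hfv := (mem_finished.1 hv.1).resolve_right hiv
        have hnF : s(u, v) ∉ F := fun hcon => by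
          obtain ⟨⟨z, hz, hzF⟩, -⟩ := not_mem_finished hu.2
          rcases Set.mem_insert_iff.1 (hfu z hz) with h | h
          · exact hzF (h ▸ hcon)
          · exact hzF h
        have hold : ∀ x z, s(x, z) ∈ insert s(u, v) F → s(x, z) ≠ s(u, v) → s(x, z) ∈ F :=
          fun x z h hne => (Set.mem_insert_iff.1 h).resolve_left hne
        obtain ⟨x, hx, hxu⟩ : ∃ x ∈ mid G F, x = u ∨ x = v := by
          by_contra hcon
          push Not at hcon
          refine hiu ⟨v, huv, fun y hy => ?_, fun y hy => ?_⟩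
          · by_contra hne
            have h1 : s(u, y) ≠ s(u, v) := fun h => hne (Sym2.congr_right.1 h)
            exact (hcon u ⟨⟨s(u, y), hold _ _ (hfu y hy) h1, by simp⟩, s(u, v), ⟨huv, hnF⟩,
              by simp⟩).1 rfl
          · by_contra hne
            have h1 : s(v, y) ≠ s(u, v) := fun h => hne (Sym2.congr_right.1 (h.trans Sym2.eq_swap))
            exact (hcon v ⟨⟨s(v, y), hold _ _ (hfv y hy) h1, by simp⟩, s(u, v), ⟨huv, hnF⟩,
              by simp⟩).2 rfl
        have hout : ∀ y ∈ mid G (insert s(u, v) F), y ≠ u ∧ y ≠ v := by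
          rintro y ⟨-, e, ⟨he, heF⟩, hye⟩
          induction e with
          | _ a b =>
            rw [SimpleGraph.mem_edgeSet] at he
            constructor
            · rintro rfl
              rcases Sym2.mem_iff.1 hye with rfl | rfl
              · exact heF (hfu b he)
              · rw [show s(a, y) = s(y, a) from Sym2.eq_swap] at heF
                exact heF (hfu a he.symm)
            · rintro rfl
              rcases Sym2.mem_iff.1 hye with rfl | rfl
              · exact heF (hfv b he)
              · rw [show s(a, y) = s(y, a) from Sym2.eq_swap] at heF
                exact heF (hfv a he.symm)
        have hxn : x ∉ mid G (insert s(u, v) F) := fun h => by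
          rcases hxu with rfl | rfl
          · exact (hout _ h).1 rfl
          · exact (hout _ h).2 rfl
        rw [← Set.ncard_insert_of_notMem hxn (Set.toFinite _)]
        refine Set.ncard_le_ncard (Set.insert_subset hx fun y hy => ?_) (Set.toFinite _)
        obtain ⟨⟨e, he, hye⟩, f, ⟨hf, hfF⟩, hyf⟩ := id hy
        refine ⟨⟨e, ?_, hye⟩, f, ⟨hf, fun h => hfF (Set.mem_insert_of_mem _ h)⟩, hyf⟩
        refine (Set.mem_insert_iff.1 he).resolve_left ?_
        rintro rfl
        have := hout y hy
        rcases Sym2.mem_iff.1 hye with h | h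
        · exact this.1 h
        · exact this.2 h
      rw [hD''] at hw' ⊢
      refine .head u hu.2 (wt_le_of_card_nb ?_) (.head v ?_ hw' (.refl _))
      · refine (Finset.card_le_card (t := insert v (nb G D')) fun y hy => ?_).trans
          ((Finset.card_insert_le _ _).trans ?_)
        · obtain ⟨h1, z, h2, h3⟩ := mem_nb.1 hy
          by_cases hyv : y = v
          · exact hyv ▸ Finset.mem_insert_self _ _
          · refine Finset.mem_insert_of_mem (mem_nb.2 ⟨?_, z, ?_, h3⟩)
            · rw [hD'', Finset.mem_insert]; exact not_or.2 ⟨hyv, h1⟩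
            · rw [hD'']; exact Finset.mem_insert_of_mem h2
        · have := card_nb_finished_le (G := G) (insert s(u, v) F)
          rw [← hD'] at this
          omega
      · rw [Finset.mem_insert]
        exact not_or.2 ⟨huv.ne', hv.2⟩
    · have hD'' : D' = insert u D := by
        ext x
        rw [Finset.mem_insert]
        constructor
        · intro hx
          by_cases hxD : x ∈ D
          · exact Or.inr hxD
          · rcases hnew x hx hxD with h | h
            · exact Or.inl h
            · exact absurd ⟨h ▸ hx, h ▸ hxD⟩ hv
        · rintro (rfl | hx)
          · exact hu.1
          · exact hsub hx
      rw [hD''] at hw' ⊢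
      exact .head u hu.2 hw' (.refl _)
  · by_cases hv : v ∈ D' ∧ v ∉ D
    · have hD'' : D' = insert v D := by
        ext x
        rw [Finset.mem_insert]
        constructor
        · intro hx
          by_cases hxD : x ∈ D
          · exact Or.inr hxD
          · rcases hnew x hx hxD with h | h
            · exact absurd ⟨h ▸ hx, h ▸ hxD⟩ hu
            · exact Or.inl h
        · rintro (rfl | hx)
          · exact hv.1
          · exact hsub hx
      rw [hD''] at hw' ⊢
      exact .head v hv.2 hw' (.refl _)
    · have hD'' : D' = D := by
        refine Finset.Subset.antisymm (fun x hx => ?_) hsub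
        by_contra hxD
        rcases hnew x hx hxD with rfl | rfl
        · exact hu ⟨hx, hxD⟩
        · exact hv ⟨hx, hxD⟩
      rw [hD'']
      exact .refl _

/-- The first `i` edges of a layout. -/
def Layout.first (π : Layout G) (i : ℕ) : Set (Sym2 (Fin n)) :=
  {e | ∃ j : Fin G.edgeSet.ncard, (j : ℕ) < i ∧ (π j : Sym2 (Fin n)) = e}

theorem Layout.first_succ (π : Layout G) (i : Fin G.edgeSet.ncard) :
    π.first (i + 1) = π.upTo i := by
  ext e
  simp only [Layout.first, Layout.upTo, Set.mem_ofPred_eq, Nat.lt_succ_iff, Fin.le_def]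

theorem Layout.ncard_mid_upTo_le (π : Layout G) (i : Fin G.edgeSet.ncard) :
    (mid G (π.upTo i)).ncard ≤ π.width :=
  Finset.le_sup (f := fun i => (mid G (π.upTo i)).ncard) (Finset.mem_univ i)

theorem Layout.first_zero (π : Layout G) : π.first 0 = ∅ := by
  ext e; simp [Layout.first]

theorem Layout.reach_finished (π : Layout G) (i : ℕ) (hi : i ≤ G.edgeSet.ncard) :
    (mid G (π.first i)).ncard ≤ π.width ∧
      Reach (wt G K) (max π.width 1 + K) ∅ (finished G (π.first i)) := by
  induction i with
  | zero =>
    rw [π.first_zero]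
    refine ⟨?_, reach_finished_empty (Nat.add_le_add_right (le_max_right _ _) K)⟩
    rw [show mid G ∅ = ∅ by ext v; simp [mid, endVertices]]
    simp
  | succ i ih =>
    obtain ⟨h1, h2⟩ := ih (by omega)
    have h3 : (mid G (π.first (i + 1))).ncard ≤ π.width := by
      rw [π.first_succ ⟨i, hi⟩]; exact π.ncard_mid_upTo_le _
    refine ⟨h3, h2.trans ?_⟩
    have h4 : π.first (i + 1) = insert (π ⟨i, hi⟩ : Sym2 (Fin n)) (π.first i) := by
      ext e
      simp only [Layout.first, Set.mem_ofPred_eq, Set.mem_insert_iff]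
      constructor
      · rintro ⟨j, hj, rfl⟩
        by_cases hji : (j : ℕ) = i
        · exact Or.inl (by congr 2; exact Fin.ext hji)
        · exact Or.inr ⟨j, by omega, rfl⟩
      · rintro (rfl | ⟨j, hj, rfl⟩)
        · exact ⟨⟨i, hi⟩, by simp, rfl⟩
        · exact ⟨j, by omega, rfl⟩
    rw [h4] at h3 ⊢
    have h5 := (π ⟨i, hi⟩).2
    revert h3 h5
    generalize (π ⟨i, hi⟩ : Sym2 (Fin n)) = e
    induction e with
    | _ u v =>
      intro h3 h5
      exact reach_finished_insert h5 (h1.trans (le_max_left _ _)) (h3.trans (le_max_left _ _))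

theorem Layout.reach_univ (π : Layout G) (K : ℕ) :
    Reach (wt G K) (max π.width 1 + K) ∅ Finset.univ := by
  have h := (π.reach_finished (K := K) _ le_rfl).2
  rwa [show finished G (π.first G.edgeSet.ncard) = Finset.univ from
    Finset.eq_univ_of_forall fun v => mem_finished.2 (Or.inl fun u hu =>
      ⟨π.symm ⟨s(v, u), hu⟩, Fin.isLt _, by simp⟩)] at h

theorem Layout.mem_edgeSet (π : Layout G) (i : Fin G.edgeSet.ncard) :
    (π i : Sym2 (Fin n)) ∈ G.edgeSet := (π i).2

/-- If some layout has width `0`, then all layouts do. -/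
theorem Layout.width_eq_zero (π π' : Layout G) (h : π.width = 0) : π'.width = 0 := by
  -- Width `0` forces the edges to be pairwise disjoint: a shared vertex would be in the middle set
  -- right after the earlier of the two edges.
  have key : ∀ e ∈ G.edgeSet, ∀ f ∈ G.edgeSet, ∀ v : Fin n, v ∈ e → v ∈ f → e = f := by
    intro e he f hf v hve hvf
    by_contra hne
    obtain ⟨i, hi⟩ := π.surjective ⟨e, he⟩
    obtain ⟨j, hj⟩ := π.surjective ⟨f, hf⟩
    wlog hij : i < j generalizing e f i j with H
    · refine H f hf e he hvf hve (Ne.symm hne) j hj i hi ?_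
      refine lt_of_le_of_ne (not_lt.1 hij) ?_
      rintro rfl
      rw [hi] at hj
      exact hne (congrArg Subtype.val hj)
    have h1 : v ∈ mid G (π.upTo i) := by
      refine ⟨⟨e, ⟨i, le_rfl, by rw [hi]⟩, hve⟩, f, ⟨hf, ?_⟩, hvf⟩
      rintro ⟨l, hl, hlf⟩
      have : l = j := π.injective (Subtype.ext (by rw [hlf, hj]))
      exact absurd (this ▸ hl) (not_le.2 hij)
    have h2 := π.ncard_mid_upTo_le i
    rw [h, Nat.le_zero, Set.ncard_eq_zero (Set.toFinite _)] at h2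
    rw [h2] at h1
    exact h1
  rw [Layout.width, ← Nat.bot_eq_zero, Finset.sup_eq_bot_iff]
  intro i _
  rw [Nat.bot_eq_zero, Set.ncard_eq_zero (Set.toFinite _)]
  refine Set.eq_empty_of_forall_notMem ?_
  rintro v ⟨⟨e, he, hve⟩, f, ⟨hf, hfn⟩, hvf⟩
  have he' : e ∈ G.edgeSet := by
    obtain ⟨j, -, rfl⟩ := he
    exact π'.mem_edgeSet j
  exact hfn (key e he' f hf v hve hvf ▸ he)

/-- A layout whose width exceeds the least capacity of an expansion by at most one is nearly
optimal. -/
theorem Layout.width_le_linearWidth_add_one (π : Layout G) {p : ℕ}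
    (hp : ∀ k, Reach (wt G K) (k + K) ∅ Finset.univ → p ≤ k) (hπ : π.width ≤ p + 1) :
    linearWidth G ≤ π.width ∧ π.width ≤ linearWidth G + 1 := by
  refine ⟨Nat.sInf_le ⟨π, le_rfl⟩, ?_⟩
  obtain ⟨π', hπ'⟩ : ∃ π' : Layout G, π'.width ≤ linearWidth G :=
    Nat.sInf_mem (s := {k | ∃ π : Layout G, π.width ≤ k}) ⟨_, π, le_rfl⟩
  -- The expansion of a layout needs capacity at least `1`, so width `0` is treated apart.
  by_cases h0 : π'.width = 0
  · rw [π'.width_eq_zero π h0]; omega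
  · have := hp _ (π'.reach_univ K)
    rw [max_eq_left (by omega)] at this
    omega

/-! ### All rounds -/

/-- Rounds for the capacities `0`, `1`, … until the full vertex set is reached. -/
def rounds (K : ℕ) : Cmd :=
  .seq (.asg 3 (.const 0)) <| .seq (.sto (.glob 2) (.const 1)) <|
  .whl (.not (.load (.add (.glob 2) (.glob 1)))) <|
  .seq (round K) (.asg 3 (.add (.glob 3) (.const 1)))

/-- Number of steps of `rounds` if at most `N` sets are listed in a round. -/
def roundsSteps (n K N : ℕ) : ℕ := (n + 1) * (roundSteps n K N + 2) + 3

/-- No round beyond capacity `p` is needed, so the single capacity `p + K` is valid for all table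
entries, including those left by earlier rounds. -/
theorem rounds_spec (hM : 2 * n + K + 10 ≤ M) {N p : ℕ} (hpn : p ≤ n)
    (hp : Reach (wt G K) (p + K) ∅ Finset.univ)
    (hN : ∀ (k : ℕ) (q : List (Finset (Fin n))), q.Nodup → (∀ X ∈ q, Listed G K k X) →
      q.length ≤ N)
    {s : Store} (hctx : Ctx G s) (h0 : ∀ a, blk n ≤ a → s.mem a = 0) :
    Tr M (rounds K) s (roundsSteps n K N) fun s' => Ctx G s' ∧ Table G K (p + K) s'.mem ∧
      Marked s'.mem (Finset.univ : Finset (Fin n)) := by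
  rw [rounds, roundsSteps]
  refine Tr.asg_seq (x := 0) (by omega) rfl (by positivity) fun s1 hm1 hv1 ho1 => ?_
  refine Tr.sto_seq (y := blk n) (x := 1) ?_ rfl (small_lt_two_pow hM (by omega))
    fun s2 hv2 hm2 => ?_
  · simp only [eval]; rw [ho1 _ (by omega)]; exact hctx.block
  have hblk : ∀ X : Finset (Fin n), Marked s2.mem X ↔ X = ∅ := fun X => by
    rw [Marked, hm2, hm1]
    by_cases hX : X = ∅
    · simp [hX, enc_empty]
    · have : enc X ≠ 0 := fun h => hX (enc_eq_zero.1 h)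
      rw [Function.update_of_ne (by omega), h0 _ (by omega)]
      simp [hX]
  have hpos : 0 < blk n := Nat.two_pow_pos _
  have hctx2 : Ctx G s2 := hctx.of_agree
    (fun r hr => by rw [hv2, ho1 _ (by omega)])
    (fun a ha => by rw [hm2, hm1, Function.update_of_ne (by omega)])
  refine (Tr.whl (t := roundSteps n K N + 1) (m := n + 1)
    (I := fun m s' => ∃ k, Search G K (p + K) k s' ∧
      (∀ X : Finset (Fin n), s'.mem (2 * blk n + enc X) ≤ k) ∧
      (Marked s'.mem (Finset.univ : Finset (Fin n)) ∨ k ≤ p ∧ p + 1 - k ≤ m)) ?_ ?_).imp le_rfl ?_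
  · rintro m s' ⟨k, hS, hold, hk⟩ hne
    have hun : ¬ Marked s'.mem (Finset.univ : Finset (Fin n)) := fun h => by
      refine hne ?_
      simp only [Expr.not, eval]
      rw [hS.ctx.block, hS.ctx.full]
      exact Nat.sub_eq_zero_of_le (Nat.one_le_iff_ne_zero.2 h)
    replace hk := hk.resolve_left hun
    refine Tr.seq ((round_spec hM (hk.1.trans hpn) (Nat.add_le_add_right hk.1 K) (hN k) hS
      hold).imp le_rfl ?_)
    rintro s3 ⟨hS3, hold3, hu3⟩
    refine Tr.asg (t := 0) (x := k + 1) (by omega) ?_ (small_lt_two_pow hM (by omega))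
      fun s4 hm4 hv4 ho4 => ?_
    · simp only [eval]; rw [hS3.level]
    have hS4 : Search G K (p + K) (k + 1) s4 :=
      ⟨hS3.ctx.of_agree (fun r hr => ho4 _ (by omega)) fun a _ => by rw [hm4],
        hm4 ▸ hS3.table, hv4, hm4 ▸ hS3.empty⟩
    have hold4 : ∀ X : Finset (Fin n), s4.mem (2 * blk n + enc X) ≤ k + 1 := fun X =>
      hm4 ▸ hold3 X
    -- The round for `p` must mark the full set; an earlier round either does so too or just brings
    -- `k` closer to `p`.
    by_cases hkp : k = p
    · exact ⟨0, by omega, k + 1, hS4, hold4, Or.inl (hm4 ▸ hu3 (hkp ▸ hp))⟩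
    · exact ⟨p + 1 - (k + 1), by omega, k + 1, hS4, hold4, Or.inr ⟨by omega, le_rfl⟩⟩
  · refine ⟨0, ⟨hctx2, fun X hX => Or.inl ((hblk X).1 hX), by rw [hv2, hv1],
      (hblk ∅).2 rfl⟩, fun X => ?_, Or.inr ⟨by omega, by omega⟩⟩
    rw [hm2, hm1, Function.update_of_ne (by omega), h0 _ (by omega)]
  · rintro s' ⟨⟨m, k, hS, -, -⟩, hz⟩
    refine ⟨hS.ctx, hS.table, fun h => ?_⟩
    simp only [Expr.not, eval] at hz
    rw [hS.ctx.block, hS.ctx.full] at hz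
    rw [blk] at h
    omega

/-! ### Lists of edges -/

/-- The edges with ends in a list. -/
def edgesOf (L : List (Fin n × Fin n)) : Set (Sym2 (Fin n)) :=
  {e | ∃ p ∈ L, s(p.1, p.2) = e}

theorem edgesOf_append (L : List (Fin n × Fin n)) (p : Fin n × Fin n) :
    edgesOf (L ++ [p]) = insert s(p.1, p.2) (edgesOf L) := by
  ext e
  simp only [edgesOf, Set.mem_ofPred_eq, Set.mem_insert_iff, List.mem_append, List.mem_singleton]
  constructor
  · rintro ⟨q, h | rfl, rfl⟩
    · exact Or.inr ⟨q, h, rfl⟩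
    · exact Or.inl rfl
  · rintro (rfl | ⟨q, h, rfl⟩)
    · exact ⟨p, Or.inr rfl, rfl⟩
    · exact ⟨q, Or.inl h, rfl⟩

/-- The width of a list of edges. -/
noncomputable def listWidth (G : SimpleGraph (Fin n)) (L : List (Fin n × Fin n)) : ℕ :=
  (Finset.range L.length).sup fun i => (mid G (edgesOf (L.take (i + 1)))).ncard

theorem listWidth_append (L : List (Fin n × Fin n)) (p : Fin n × Fin n) :
    listWidth G (L ++ [p]) = max (listWidth G L) (mid G (edgesOf (L ++ [p]))).ncard := by
  rw [listWidth, List.length_append, List.length_singleton, Finset.range_add_one,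
    Finset.sup_insert, List.take_of_length_le (by simp), max_comm, listWidth]
  congr 1
  refine Finset.sup_congr rfl fun i hi => ?_
  rw [List.take_append_of_le_length (by have := Finset.mem_range.1 hi; omega)]

/-- The list contains each edge at most once. -/
structure EdgeList (G : SimpleGraph (Fin n)) (L : List (Fin n × Fin n)) : Prop where
  adj : ∀ p ∈ L, G.Adj p.1 p.2
  nodup : (L.map fun p => s(p.1, p.2)).Nodup

theorem EdgeList.length_le {L : List (Fin n × Fin n)} (h : EdgeList G L) : L.length ≤ n * n := by
  classical
  have h1 := List.toFinset_card_of_nodup (List.Nodup.of_map _ h.nodup)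
  rw [← h1]
  simpa using Finset.card_le_univ L.toFinset

theorem EdgeList.append {L : List (Fin n × Fin n)} (h : EdgeList G L) {p : Fin n × Fin n}
    (hp : G.Adj p.1 p.2) (hn : s(p.1, p.2) ∉ edgesOf L) : EdgeList G (L ++ [p]) := by
  refine ⟨fun q hq => ?_, ?_⟩
  · rcases List.mem_append.1 hq with h1 | h1
    · exact h.adj q h1
    · rw [List.mem_singleton.1 h1]; exact hp
  · rw [List.map_append, List.nodup_append]
    refine ⟨h.nodup, by simp, ?_⟩
    intro a ha b hb hab
    obtain ⟨q, hq, rfl⟩ := List.mem_map.1 ha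
    rw [List.map_singleton, List.mem_singleton] at hb
    exact hn ⟨q, hq, hab.trans hb⟩

theorem EdgeList.subset {L : List (Fin n × Fin n)} (h : EdgeList G L) :
    edgesOf L ⊆ G.edgeSet := by
  rintro e ⟨p, hp, rfl⟩
  exact h.adj p hp

/-- A list of all edges is a layout. -/
theorem EdgeList.exists_layout {L : List (Fin n × Fin n)} (h : EdgeList G L)
    (hall : ∀ u v, G.Adj u v → s(u, v) ∈ edgesOf L) :
    G.edgeSet.ncard = L.length ∧ ∃ π : Layout G, π.width = listWidth G L ∧
      ∀ (i : Fin G.edgeSet.ncard) (hi : (i : ℕ) < L.length),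
        (π i : Sym2 (Fin n)) = s((L[(i : ℕ)]).1, (L[(i : ℕ)]).2) := by
  classical
  set l := L.map fun p => s(p.1, p.2) with hl
  have hmem : ∀ e, e ∈ l ↔ e ∈ G.edgeSet := fun e => by
    constructor
    · intro he
      obtain ⟨p, hp, rfl⟩ := List.mem_map.1 he
      exact h.adj p hp
    · induction e with
      | _ u v =>
        intro he
        obtain ⟨p, hp, hpe⟩ := hall u v he
        exact List.mem_map.2 ⟨p, hp, hpe⟩
  have hll : l.length = L.length := List.length_map _
  let eqv : Fin l.length ≃ G.edgeSet :=
    (List.Nodup.getEquiv l h.nodup).trans (Equiv.subtypeEquivRight hmem)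
  have hcard : G.edgeSet.ncard = l.length := by
    rw [← Nat.card_coe_set_eq, ← Nat.card_congr eqv, Nat.card_fin]
  set π : Layout G := (finCongr hcard).trans eqv with hπ
  have hval : ∀ (i : Fin G.edgeSet.ncard) (hi : (i : ℕ) < L.length),
      (π i : Sym2 (Fin n)) = s((L[(i : ℕ)]).1, (L[(i : ℕ)]).2) := fun i hi => by
    simp [hπ, eqv, hl]
  have hup : ∀ i, π.upTo i = edgesOf (L.take (i + 1)) := fun i => by
    ext e
    simp only [Layout.upTo, edgesOf, Set.mem_ofPred_eq]
    constructor
    · rintro ⟨j, hj, rfl⟩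
      have hjl : (j : ℕ) < L.length := by have := j.isLt; omega
      refine ⟨L[(j : ℕ)], ?_, (hval j hjl).symm⟩
      rw [List.mem_take_iff_getElem]
      exact ⟨j, by have : (j : ℕ) ≤ i := hj; omega, rfl⟩
    · rintro ⟨p, hp, rfl⟩
      rw [List.mem_take_iff_getElem] at hp
      obtain ⟨j, hj, rfl⟩ := hp
      refine ⟨⟨j, by omega⟩, ?_, hval ⟨j, by omega⟩ (by simp only; omega)⟩
      rw [Fin.le_def]; simp only; omega
  refine ⟨hcard.trans hll, π, ?_, hval⟩
  rw [Layout.width, listWidth]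
  refine le_antisymm (Finset.sup_le fun i _ => ?_) (Finset.sup_le fun i hi => ?_)
  · rw [hup]
    exact Finset.le_sup (f := fun i => (mid G (edgesOf (L.take (i + 1)))).ncard)
      (Finset.mem_range.2 (by have := i.isLt; omega))
  · have hi' := Finset.mem_range.1 hi
    have := π.ncard_mid_upTo_le ⟨i, by omega⟩
    rw [hup] at this
    exact this

/-! ### The edges that are put out before a given moment -/

/-- The edge `x y` is put out before the step for the set `X`, its last vertex `v`, and the
vertex number `u`. -/
def Emitted (X : Finset (Fin n)) (v : Fin n) (u : ℕ) (x y : Fin n) : Prop :=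
  x ∉ X ∧ y ∉ X ∨ x = v ∧ y ∉ X ∧ (y : ℕ) < u ∨ y = v ∧ x ∉ X ∧ (x : ℕ) < u

/-- The list holds the edges that are put out before a given moment. -/
def Complete (G : SimpleGraph (Fin n)) (L : List (Fin n × Fin n)) (P : Fin n → Fin n → Prop) :
    Prop :=
  ∀ x y, G.Adj x y → (s(x, y) ∈ edgesOf L ↔ P x y)

theorem Complete.congr {L : List (Fin n × Fin n)} {P Q : Fin n → Fin n → Prop}
    (h : Complete G L P) (hPQ : ∀ x y, G.Adj x y → (P x y ↔ Q x y)) : Complete G L Q :=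
  fun x y hxy => (h x y hxy).trans (hPQ x y hxy)

theorem Complete.mid_eq {L : List (Fin n × Fin n)} {P : Fin n → Fin n → Prop}
    (hL : EdgeList G L) (h : Complete G L P) :
    mid G (edgesOf L) = {x | (∃ y, G.Adj x y ∧ P x y) ∧ ∃ y, G.Adj x y ∧ ¬ P x y} := by
  ext x
  simp only [mid, endVertices, Set.mem_inter_iff, Set.mem_ofPred_eq]
  refine and_congr ⟨?_, ?_⟩ ⟨?_, ?_⟩
  · rintro ⟨e, he, hxe⟩
    obtain ⟨y, rfl⟩ := hxe
    have hxy : G.Adj x y := hL.subset he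
    exact ⟨y, hxy, (h x y hxy).1 he⟩
  · rintro ⟨y, hxy, hP⟩
    exact ⟨s(x, y), (h x y hxy).2 hP, by simp⟩
  · rintro ⟨e, he, hxe⟩
    obtain ⟨y, rfl⟩ := hxe
    have hxy : G.Adj x y := he.1
    exact ⟨y, hxy, fun hP => he.2 ((h x y hxy).2 hP)⟩
  · rintro ⟨y, hxy, hP⟩
    exact ⟨s(x, y), ⟨hxy, fun he => hP ((h x y hxy).1 he)⟩, by simp⟩

/-- A middle vertex in `X` lies on an edge already put out and so is `v`. One outside `X` lies on an
edge not yet put out, whose other end must be in `X`, and so is an outer neighbour. -/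
theorem ncard_mid_le_of_emitted {L : List (Fin n × Fin n)} {X : Finset (Fin n)} {v : Fin n} {u : ℕ}
    (hL : EdgeList G L) (h : Complete G L (Emitted X v u)) :
    (mid G (edgesOf L)).ncard ≤ (nb G X).card + 1 := by
  refine le_trans ?_ (Finset.card_insert_le v (nb G X))
  rw [← Set.ncard_coe_finset, h.mid_eq hL]
  refine Set.ncard_le_ncard ?_ (Set.toFinite _)
  rintro x ⟨⟨y, -, hy⟩, z, hxz, hz⟩
  rw [Finset.mem_coe, Finset.mem_insert]
  by_cases hx : x ∈ X
  · rcases hy with h1 | h1 | h1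
    · exact absurd hx h1.1
    · exact Or.inl h1.1
    · exact absurd hx h1.2.1
  · refine Or.inr (mem_nb.2 ⟨hx, z, ?_, hxz.symm⟩)
    by_contra hzX
    exact hz (Or.inl ⟨hx, hzX⟩)

theorem emitted_zero {X : Finset (Fin n)} {v x y : Fin n} :
    x ∉ X ∧ y ∉ X ↔ Emitted X v 0 x y := by
  simp [Emitted]

/-- Once all `u` have been passed, the state is that at the start of the step for the preceding set
`X.erase v`. -/
theorem emitted_last {X : Finset (Fin n)} {v x y : Fin n} (hxy : x ≠ y) :
    Emitted X v n x y ↔ x ∉ X.erase v ∧ y ∉ X.erase v := by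
  simp only [Emitted, Finset.mem_erase, Fin.is_lt, and_true, not_and_or, not_not]
  by_cases hx : x = v
  · have : y ≠ v := fun h => hxy (hx.trans h.symm)
    tauto
  · by_cases hy : y = v <;> tauto

theorem emitted_succ_of_not {X : Finset (Fin n)} {v u x y : Fin n} (h : ¬ (u ∉ X ∧ G.Adj v u))
    (hxy : G.Adj x y) : Emitted X v u x y ↔ Emitted X v (u + 1) x y := by
  have key : ∀ a b, G.Adj a b → (a = v ∧ b ∉ X ∧ (b : ℕ) < u ↔ a = v ∧ b ∉ X ∧ (b : ℕ) < u + 1) := by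
    intro a b hab
    refine ⟨fun ⟨h1, h2, h3⟩ => ⟨h1, h2, by omega⟩, fun ⟨h1, h2, h3⟩ => ⟨h1, h2, ?_⟩⟩
    by_contra hbu
    have : b = u := Fin.ext (by omega)
    subst this
    exact h ⟨h2, h1 ▸ hab⟩
  rw [Emitted, Emitted, key x y hxy, key y x hxy.symm]

theorem emitted_succ {X : Finset (Fin n)} {v u x y : Fin n} (hu : u ∉ X) :
    Emitted X v (u + 1) x y ↔ s(x, y) = s(v, u) ∨ Emitted X v u x y := by
  have key : ∀ a b : Fin n, a = v ∧ b ∉ X ∧ (b : ℕ) < u + 1 ↔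
      (a = v ∧ b ∉ X ∧ (b : ℕ) < u) ∨ a = v ∧ b = u := by
    intro a b
    constructor
    · rintro ⟨h1, h2, h3⟩
      by_cases hbu : (b : ℕ) = u
      · exact Or.inr ⟨h1, Fin.ext hbu⟩
      · exact Or.inl ⟨h1, h2, by omega⟩
    · rintro (⟨h1, h2, h3⟩ | ⟨h1, rfl⟩)
      · exact ⟨h1, h2, by omega⟩
      · exact ⟨h1, hu, by omega⟩
  rw [Emitted, Emitted, key x y, key y x, Sym2.eq_iff]
  tauto

theorem not_emitted {X : Finset (Fin n)} {v u : Fin n} (hv : v ∈ X) : ¬ Emitted X v u v u := by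
  rintro (h | h | h)
  · exact h.1 hv
  · exact lt_irrefl _ h.2.2
  · exact h.2.1 hv

namespace Expr

/-- Whether the edge `x y` has been put out, for the set in variable `20`, its last vertex in
variable `21`, and the vertex number in variable `22`. -/
def emitted (x y : Expr) : Expr :=
  or (and (not (bit (.glob 20) x)) (not (bit (.glob 20) y))) <|
  or (and (eq x (.glob 21)) (and (not (bit (.glob 20) y)) (not (le (.glob 22) y))))
    (and (eq y (.glob 21)) (and (not (bit (.glob 20) x)) (not (le (.glob 22) x))))

theorem eval_emitted {s : Store} {ρ : List ℕ} {X : Finset (Fin n)} {v i j : Fin n} {u : ℕ}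
    [Decidable (Emitted X v u i j)] (hn : s.var 0 = n) (hX : s.var 20 = enc X)
    (hv : s.var 21 = v) (hu : s.var 22 = u) {x y : Expr} (hx : x.eval s ρ = i)
    (hy : y.eval s ρ = j) : (emitted x y).eval s ρ = if Emitted X v u i j then 1 else 0 := by
  have hb : ∀ {z : Expr} {l : Fin n}, z.eval s ρ = l →
      (not (bit (.glob 20) z)).eval s ρ = if l ∉ X then 1 else 0 := fun {z l} hz =>
    eval_not (eval_bit hn (by simp [eval, hX]) hz)
  have hl : ∀ {z : Expr} {l : Fin n}, z.eval s ρ = l →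
      (not (le (.glob 22) z)).eval s ρ = if ¬ u ≤ l then 1 else 0 := fun {z l} hz =>
    eval_not (by rw [eval_le, hz]; simp [eval, hu])
  have he : ∀ {z : Expr} {l : Fin n}, z.eval s ρ = l →
      (eq z (.glob 21)).eval s ρ = if l = v then 1 else 0 := fun {z l} hz => by
    rw [eval_eq, hz]; simp only [eval, hv, Fin.ext_iff]
  refine (eval_or (eval_and (hb hx) (hb hy)) (eval_or (eval_and (he hx) (eval_and (hb hy) (hl hy)))
    (eval_and (he hy) (eval_and (hb hx) (hl hx))))).trans (if_congr ?_ rfl rfl)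
  simp only [Emitted, not_le]

/-- The number of vertices that have both edges that have been put out and others. -/
def midCard : Expr :=
  count (and (any (and (adj (.var 2) (.var 0)) (emitted (.var 2) (.var 0))))
    (any (and (adj (.var 2) (.var 0)) (not (emitted (.var 2) (.var 0))))))

theorem eval_midCard {s : Store} {X : Finset (Fin n)} {v : Fin n} {u : ℕ} (h : Ctx G s)
    (hX : s.var 20 = enc X) (hv : s.var 21 = v) (hu : s.var 22 = u) {L : List (Fin n × Fin n)}
    (hL : EdgeList G L) (hc : Complete G L (Emitted X v u)) :
    midCard.eval s [] = (mid G (edgesOf L)).ncard := by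
  classical
  rw [hc.mid_eq hL]
  refine (eval_count (p := fun x => (∃ y, G.Adj x y ∧ Emitted X v u x y) ∧
    ∃ y, G.Adj x y ∧ ¬ Emitted X v u x y) h.order ?_).trans ?_
  · intro x a
    refine eval_and (eval_any h.order fun y b => ?_) (eval_any h.order fun y b => ?_)
    · exact eval_and (eval_adj_ctx h (by simp [eval]) (by simp [eval]))
        (eval_emitted h.order hX hv hu (by simp [eval]) (by simp [eval]))
    · exact eval_and (eval_adj_ctx h (by simp [eval]) (by simp [eval]))
        (eval_not (eval_emitted h.order hX hv hu (by simp [eval]) (by simp [eval])))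
  · rw [← Set.ncard_coe_finset]
    congr 1
    ext x
    simp

end Expr

/-! ### Putting out the layout -/

/-- Four times the block size. -/
def farBlock : Expr := .add (.add (.glob 2) (.glob 2)) (.add (.glob 2) (.glob 2))

/-- Puts out the edge between the vertices in variables `21` and `22` if it is there and the
second vertex is not in the set in variable `20`; goes to the next vertex. -/
def emitEdge : Cmd :=
  .ite (.and (.not (.bit (.glob 20) (.glob 22))) (.adj (.glob 21) (.glob 22)))
    (.seq (.sto (.add farBlock (.add (.glob 23) (.glob 23))) (.glob 21)) <|
      .seq (.sto (.add (.add farBlock (.add (.glob 23) (.glob 23))) (.const 1)) (.glob 22)) <|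
      .seq (.asg 23 (.add (.glob 23) (.const 1))) <|
      .seq (.asg 22 (.add (.glob 22) (.const 1))) <|
      .asg 24 (.add (.glob 24) (.sub .midCard (.glob 24))))
    (.asg 22 (.add (.glob 22) (.const 1)))

/-- Puts out all edges, in the order of an expansion read backwards. -/
def emit : Cmd :=
  .seq (.asg 20 (.glob 1)) <| .seq (.asg 23 (.const 0)) <| .seq (.asg 24 (.const 0)) <|
  .whl (.glob 20) <|
  .seq (.asg 21 (.sub (.load (.add (.glob 2) (.glob 20))) (.const 1))) <|
  .seq (.asg 22 (.const 0)) <|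
  .seq (.whl (.sub (.glob 0) (.glob 22)) emitEdge)
    (.asg 20 (.sub (.glob 20) (.pow2 (.glob 21))))

/-- The state while edges are put out. -/
structure Written (G : SimpleGraph (Fin n)) (m₀ : ℕ → ℕ) (p : ℕ) (L : List (Fin n × Fin n))
    (s : Store) : Prop where
  low : ∀ a < 2 * blk n, s.mem a = m₀ a
  ctx : Ctx G s
  edges : EdgeList G L
  count : s.var 23 = L.length
  cells : ∀ (i : ℕ) (h : i < L.length),
    s.mem (4 * blk n + 2 * i) = L[i].1 ∧ s.mem (4 * blk n + 2 * i + 1) = L[i].2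
  width : s.var 24 = listWidth G L
  bound : listWidth G L ≤ p + 1

theorem Written.of_var {m₀ : ℕ → ℕ} {p r : ℕ} {L : List (Fin n × Fin n)} {s s' : Store}
    (h : Written G m₀ p L s) (hm : s'.mem = s.mem) (hv : ∀ q, q ≠ r → s'.var q = s.var q)
    (hr : 3 ≤ r) (hr' : r ≠ 23) (hr'' : r ≠ 24) : Written G m₀ p L s' := by
  refine ⟨hm ▸ h.low, h.ctx.of_agree (fun q hq => hv q (by omega)) fun a _ => by rw [hm], h.edges,
    ?_, hm ▸ h.cells, ?_, h.bound⟩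
  · rw [hv _ hr'.symm, h.count]
  · rw [hv _ hr''.symm, h.width]

theorem eval_farBlock {s : Store} (h : s.var 2 = blk n) : farBlock.eval s [] = 4 * blk n := by
  simp only [farBlock, eval, h]; omega

theorem listWidth_le (L : List (Fin n × Fin n)) : listWidth G L ≤ n :=
  Finset.sup_le fun i _ => by
    simpa using Set.ncard_le_card (mid G (edgesOf (L.take (i + 1))))

/-- The table bounds the outer neighbours of `X` by `p`; during its step the last vertex `v` adds at
most one to the middle set, whence `p + 1`. -/
theorem emitEdge_spec (hM : 2 * n + K + 10 ≤ M) {m₀ : ℕ → ℕ} {p : ℕ} {L : List (Fin n × Fin n)}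
    {s : Store} {X : Finset (Fin n)} {v u : Fin n} (h : Written G m₀ p L s) (hX : s.var 20 = enc X)
    (hv : s.var 21 = v) (hu : s.var 22 = u) (hvX : v ∈ X) (hc : Complete G L (Emitted X v u))
    (hp : (nb G X).card ≤ p) :
    Tr M emitEdge s 6 fun s' => s'.var 20 = enc X ∧ s'.var 21 = v ∧ s'.var 22 = u + 1 ∧
      ∃ L', Written G m₀ p L' s' ∧ Complete G L' (Emitted X v (u + 1)) := by
  classical
  have hcond : (Expr.and (.not (.bit (.glob 20) (.glob 22))) (.adj (.glob 21) (.glob 22))).eval s [] =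
      if u ∉ X ∧ G.Adj v u then 1 else 0 :=
    eval_and (eval_not (eval_bit h.ctx.order (by simp [eval, hX]) (by simp [eval, hu])))
      (eval_adj_ctx h.ctx (by simp [eval, hv]) (by simp [eval, hu]))
  have hun := u.isLt
  have hvn := v.isLt
  have hlow : ∀ a, 4 * blk n ≤ a → ∀ b < 2 * blk n, b ≠ a := fun a ha b hb => by omega
  refine Tr.ite (t := 5) (fun h' => ?_) (fun h' => ?_)
  swap
  · have hn : ¬ (u ∉ X ∧ G.Adj v u) := fun hcon => by
      rw [hcond, if_pos hcon] at h'
      exact one_ne_zero h'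
    refine Tr.asg (x := u + 1) (by omega) (by simp only [eval, hu])
      (small_lt_two_pow hM (by omega)) fun s1 hm1 hv1 ho1 => ?_
    exact ⟨by rw [ho1 _ (by omega), hX], by rw [ho1 _ (by omega), hv], hv1, L,
      h.of_var hm1 ho1 (by omega) (by omega) (by omega),
      hc.congr fun x y hxy => emitted_succ_of_not hn hxy⟩
  obtain ⟨huX, hvu⟩ : u ∉ X ∧ G.Adj v u := by
    by_contra hcon
    rw [hcond, if_neg hcon] at h'
    exact h' rfl
  have hD := eval_farBlock h.ctx.block
  refine Tr.sto_seq (t := 4) (y := 4 * blk n + 2 * L.length) (x := v)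
    (by simp only [eval]; rw [hD, h.count]; omega) (by simp only [eval, hv])
    (small_lt_two_pow hM (by omega)) fun s1 hv1 hm1 => ?_
  refine Tr.sto_seq (y := 4 * blk n + 2 * L.length + 1) (x := u)
    (by simp only [eval]; rw [eval_farBlock (hv1 ▸ h.ctx.block), hv1, h.count]; omega)
    (by simp only [eval, hv1, hu]) (small_lt_two_pow hM (by omega)) fun s2 hv2 hm2 => ?_
  set L' := L ++ [(v, u)] with hL'
  have hedge : EdgeList G L' := h.edges.append hvu fun hcon =>
    not_emitted hvX ((hc v u hvu).1 hcon)
  have hlen : L'.length = L.length + 1 := by simp [hL']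
  have hsq := sq_lt_blk n
  have hlen' := hedge.length_le
  refine Tr.asg_seq (x := L'.length) (by omega)
    (by simp only [eval, hv2, hv1, h.count, hlen])
    (lt_two_pow_of_le (show L'.length < 2 ^ (2 * n + 2) by rw [← blk]; omega) (by omega))
    fun s3 hm3 hv3 ho3 => ?_
  refine Tr.asg_seq (x := u + 1) (by omega)
    (by simp only [eval]; rw [ho3 _ (by omega), hv2, hv1, hu])
    (small_lt_two_pow hM (by omega)) fun s4 hm4 hv4 ho4 => ?_
  have hmem : s4.mem = Function.update (Function.update s.mem (4 * blk n + 2 * L.length) v)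
      (4 * blk n + 2 * L.length + 1) u := by rw [hm4, hm3, hm2, hm1]
  have hvar : ∀ r, r ≠ 23 → r ≠ 22 → s4.var r = s.var r := fun r h1 h2 => by
    rw [ho4 _ h2, ho3 _ h1, hv2, hv1]
  have hlow4 : ∀ a < 2 * blk n, s4.mem a = s.mem a := fun a ha => by
    rw [hmem, Function.update_of_ne (by omega), Function.update_of_ne (by omega)]
  have hctx4 : Ctx G s4 := h.ctx.of_agree (fun r hr => hvar r (by omega) (by omega))
    fun a ha => hlow4 a (by omega)
  have hc4 : Complete G L' (Emitted X v (u + 1)) := fun x y hxy => by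
    rw [hL', edgesOf_append, Set.mem_insert_iff, emitted_succ huX, hc x y hxy]
  have hmid := ncard_mid_le_of_emitted hedge hc4
  have hX4 : s4.var 20 = enc X := by rw [hvar _ (by omega) (by omega), hX]
  have hvv4 : s4.var 21 = v := by rw [hvar _ (by omega) (by omega), hv]
  have hnb : (nb G X).card ≤ n := by simpa using Finset.card_le_univ (nb G X)
  have hwidth : listWidth G L' = max (listWidth G L) (mid G (edgesOf L')).ncard :=
    listWidth_append L (v, u)
  have hle : listWidth G L' ≤ p + 1 := by
    rw [hwidth]; exact max_le h.bound (hmid.trans (by omega))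
  -- With truncated subtraction, `w + (m - w)` is the maximum of `w` and `m`.
  refine Tr.asg (x := listWidth G L') (by omega) ?_
    (small_lt_two_pow hM ((listWidth_le L').trans (by omega))) fun s5 hm5 hv5 ho5 => ?_
  · simp only [eval]
    rw [eval_midCard hctx4 hX4 hvv4 hv4 hedge hc4, hvar _ (by omega) (by omega), h.width, hwidth]
    omega
  refine ⟨by rw [ho5 _ (by omega), hX4], by rw [ho5 _ (by omega), hvv4],
    by rw [ho5 _ (by omega), hv4], L', ⟨fun a ha => ?_, ?_, hedge, ?_, ?_, hv5, hle⟩, hc4⟩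
  · rw [hm5, hlow4 a ha, h.low a ha]
  · exact hctx4.of_agree (fun r hr => ho5 _ (by omega)) fun a _ => by rw [hm5]
  · rw [ho5 _ (by omega), ho4 _ (by omega), hv3]
  · intro i hi
    rw [hm5, hmem]
    by_cases hiL : i < L.length
    · have := h.cells i hiL
      have e : L'[i] = L[i] := List.getElem_append_left hiL
      rw [Function.update_of_ne (by omega), Function.update_of_ne (by omega),
        Function.update_of_ne (by omega), Function.update_of_ne (by omega), e]
      exact this
    · have : i = L.length := by omega
      subst this
      have e : L'[L.length] = (v, u) := List.getElem_concat_length rfl _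
      rw [Function.update_of_ne (by omega), Function.update_self, Function.update_self, e]
      exact ⟨rfl, rfl⟩

/-- Number of steps of `emit`. -/
def emitSteps (n : ℕ) : ℕ := n * (n * 7 + 5) + 4

/-- The table is followed from the full set down to `∅` through the recorded last vertices. Between
two steps exactly the edges with both ends outside the current set have been put out. -/
theorem emit_spec (hM : 2 * n + K + 10 ≤ M) {p : ℕ} {s : Store} (hctx : Ctx G s)
    (ht : Table G K (p + K) s.mem) (hmark : Marked s.mem (Finset.univ : Finset (Fin n))) :
    Tr M emit s (emitSteps n) fun s' => ∃ L, Written G s.mem p L s' ∧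
      Complete G L fun _ _ => True := by
  rw [emit, emitSteps]
  refine Tr.asg_seq (x := enc (Finset.univ : Finset (Fin n))) (by omega) hctx.full
    (enc_lt_two_pow hM _) fun s1 hm1 hv1 ho1 => ?_
  refine Tr.asg_seq (x := 0) (by omega) rfl (by positivity) fun s2 hm2 hv2 ho2 => ?_
  refine Tr.asg_seq (x := 0) (by omega) rfl (by positivity) fun s3 hm3 hv3 ho3 => ?_
  have hmem3 : s3.mem = s.mem := by rw [hm3, hm2, hm1]
  have hW3 : Written G s.mem p [] s3 := by
    refine ⟨fun a _ => by rw [hmem3], hctx.of_agree (fun r hr => ?_) fun a _ => by rw [hmem3],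
      ⟨by simp, by simp⟩, ?_, fun i hi => absurd hi (by simp), ?_, by simp [listWidth]⟩
    · rw [ho3 _ (by omega), ho2 _ (by omega), ho1 _ (by omega)]
    · rw [ho3 _ (by omega), hv2]; rfl
    · rw [hv3]; simp [listWidth]
  refine (Tr.whl (t := n * 7 + 4) (m := n)
    (I := fun m s' => ∃ L X, Written G s.mem p L s' ∧ s'.var 20 = enc X ∧ Marked s.mem X ∧
      Complete G L (fun x y => x ∉ X ∧ y ∉ X) ∧ X.card ≤ m) ?_ ?_).imp le_rfl ?_
  · rintro m s' ⟨L, X, hW, hX, hmX, hc, hm⟩ hne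
    have hX0 : X ≠ ∅ := by
      rintro rfl
      exact hne (by simp only [eval]; rw [hX, enc_empty])
    obtain ⟨v, hvX, hcell, hmX', hw⟩ := (ht X hmX).resolve_left hX0
    have hvn := v.isLt
    refine Tr.asg_seq (x := v) (by omega) ?_ (small_lt_two_pow hM (by omega))
      fun s4 hm4 hv4 ho4 => ?_
    · simp only [eval]
      have hX' := enc_lt_blk X
      rw [hX, hW.ctx.block, ← blk, hW.low _ (by omega), hcell]
      omega
    refine Tr.asg_seq (x := 0) (by omega) rfl (by positivity) fun s5 hm5 hv5 ho5 => ?_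
    have hW5 := (hW.of_var hm4 ho4 (by omega) (by omega) (by omega)).of_var hm5 ho5 (by omega)
      (by omega) (by omega)
    refine Tr.seq (t₁ := n * 7 + 1) (t₂ := 1) ?_
    refine (Tr.whl (t := 6) (m := n)
      (I := fun m s' => ∃ L u, Written G s.mem p L s' ∧ s'.var 20 = enc X ∧ s'.var 21 = v ∧
        s'.var 22 = u ∧ u ≤ n ∧ n - u ≤ m ∧ Complete G L (Emitted X v u)) ?_ ?_).imp le_rfl ?_
    · rintro m' s' ⟨L, u, hW, hX, hv, hu, hun, hm', hc⟩ hne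
      have hlt : u < n := by
        simp only [eval] at hne
        rw [hW.ctx.order, hu] at hne
        omega
      refine (emitEdge_spec hM hW hX hv (u := ⟨u, hlt⟩) hu hvX hc
        (card_nb_of_wt_le hw)).imp le_rfl ?_
      rintro s6 ⟨h1, h2, h3, L', h4, h5⟩
      exact ⟨n - (u + 1), by omega, L', u + 1, h4, h1, h2, h3, hlt, le_rfl, h5⟩
    · refine ⟨L, 0, hW5, ?_, ?_, hv5, by omega, by omega, hc.congr fun x y _ => emitted_zero⟩
      · rw [ho5 _ (by omega), ho4 _ (by omega), hX]
      · rw [ho5 _ (by omega), hv4]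
    · rintro s6 ⟨⟨m', L', u, hW6, hX6, hv6, hu6, hun, -, hc6⟩, hz⟩
      have hu : u = n := by
        simp only [eval] at hz
        rw [hW6.ctx.order, hu6] at hz
        omega
      subst hu
      refine Tr.asg (t := 0) (x := enc (X.erase v)) (by omega) ?_ (enc_lt_two_pow hM _)
        fun s7 hm7 hv7 ho7 => ?_
      · simp only [eval]
        rw [eval_pow2 hW6.ctx.order (by simp only [eval]; omega), hX6, enc_erase hvX]
        simp [eval, hv6]
      refine ⟨(X.erase v).card, ?_, L', X.erase v, hW6.of_var hm7 ho7 (by omega) (by omega)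
        (by omega), hv7, hmX', hc6.congr fun x y hxy => emitted_last hxy.ne, le_rfl⟩
      exact (Finset.card_erase_lt_of_mem hvX).trans_le hm
  · refine ⟨[], Finset.univ, hW3, ?_, hmark, fun x y _ => by simp [edgesOf], ?_⟩
    · rw [ho3 _ (by omega), ho2 _ (by omega), hv1]
    · simp
  · rintro s' ⟨⟨m, L, X, hW, hX, -, hc, -⟩, hz⟩
    have hX0 : X = ∅ := enc_eq_zero.1 (hX.symm.trans hz)
    subst hX0
    exact ⟨L, hW, hc.congr fun x y _ => by simp⟩

/-- Copies the result to the beginning of the memory. -/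
def copyOut : Cmd :=
  .seq (.sto (.const 0) (.glob 24)) <| .seq (.sto (.const 1) (.glob 23)) <|
  .seq (.asg 25 (.const 0)) <|
  .whl (.sub (.add (.glob 23) (.glob 23)) (.glob 25)) <|
  .seq (.sto (.add (.const 2) (.glob 25)) (.load (.add farBlock (.glob 25))))
    (.asg 25 (.add (.glob 25) (.const 1)))

/-- Number of steps of `copyOut`. -/
def copySteps (n : ℕ) : ℕ := 2 * (n * n) * 3 + 4

/-- The copy may overwrite the input and tables, which are no longer needed, but it ends below the
fourth block boundary and so never reaches the cells still to be copied. -/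
theorem copyOut_spec (hM : 2 * n + K + 10 ≤ M) {m₀ : ℕ → ℕ} {p : ℕ} {L : List (Fin n × Fin n)}
    {s : Store} (h : Written G m₀ p L s) :
    Tr M copyOut s (copySteps n) fun s' => s'.mem 0 = listWidth G L ∧ s'.mem 1 = L.length ∧
      ∀ (i : ℕ) (hi : i < L.length), s'.mem (2 + 2 * i) = L[i].1 ∧ s'.mem (3 + 2 * i) = L[i].2 := by
  have hsq := sq_lt_blk n
  have hlen := h.edges.length_le
  have hw := listWidth_le (G := G) L
  have hsrc : ∀ j < 2 * L.length, s.mem (4 * blk n + j) < n := fun j hj => by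
    rcases Nat.even_or_odd' j with ⟨i, rfl | rfl⟩
    · rw [(h.cells i (by omega)).1]; exact Fin.isLt _
    · rw [← add_assoc, (h.cells i (by omega)).2]; exact Fin.isLt _
  have hlt : ∀ x, x < 2 * blk n → x < 2 ^ M := fun x hx =>
    lt_two_pow_of_le (m := 2 * n + 3) (by rwa [pow_succ', ← blk]) (by omega)
  rw [copyOut, copySteps]
  refine Tr.sto_seq (y := 0) (x := listWidth G L) rfl h.width (small_lt_two_pow hM (by omega))
    fun s1 hv1 hm1 => ?_
  refine Tr.sto_seq (y := 1) (x := L.length) rfl (by simp only [eval, hv1, h.count])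
    (hlt _ (by omega)) fun s2 hv2 hm2 => ?_
  refine Tr.asg_seq (x := 0) (by omega) rfl (by positivity) fun s3 hm3 hv3 ho3 => ?_
  have hmem3 : s3.mem = Function.update (Function.update s.mem 0 (listWidth G L)) 1 L.length := by
    rw [hm3, hm2, hm1]
  refine (Tr.whl (t := 2) (m := 2 * (n * n))
    (I := fun m s' => ∃ j, s'.var 25 = j ∧ s'.var 23 = L.length ∧ s'.var 2 = blk n ∧
      j ≤ 2 * L.length ∧ 2 * L.length - j ≤ m ∧ s'.mem 0 = listWidth G L ∧ s'.mem 1 = L.length ∧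
      (∀ i < j, s'.mem (2 + i) = s.mem (4 * blk n + i)) ∧
      ∀ a, 4 * blk n ≤ a → s'.mem a = s.mem a) ?_ ?_).imp (by omega) ?_
  · rintro m s' ⟨j, hj, hl, hD, hjl, hm, h0, h1, hi, ha⟩ hne
    have hjlt : j < 2 * L.length := by
      simp only [eval] at hne
      rw [hl, hj] at hne
      omega
    have hsj := hsrc j hjlt
    refine Tr.sto_seq (t := 1) (y := 2 + j) (x := s.mem (4 * blk n + j))
      (by simp only [eval, hj]) ?_ (small_lt_two_pow hM (by omega)) fun s4 hv4 hm4 => ?_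
    · simp only [eval]
      rw [eval_farBlock hD, hj, ha _ (by omega)]
    refine Tr.asg (x := j + 1) (by omega) (by simp only [eval, hv4, hj]) (hlt _ (by omega))
      fun s5 hm5 hv5 ho5 => ?_
    refine ⟨2 * L.length - (j + 1), by omega, j + 1, hv5, by rw [ho5 _ (by omega), hv4, hl],
      by rw [ho5 _ (by omega), hv4, hD], hjlt, le_rfl, ?_, ?_, fun i hij => ?_, fun a ha' => ?_⟩
    · rw [hm5, hm4, Function.update_of_ne (by omega), h0]
    · rw [hm5, hm4, Function.update_of_ne (by omega), h1]
    · rw [hm5, hm4]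
      by_cases hieq : i = j
      · rw [hieq, Function.update_self]
      · rw [Function.update_of_ne (by omega), hi i (by omega)]
    · rw [hm5, hm4, Function.update_of_ne (by omega), ha a ha']
  · refine ⟨0, hv3, ?_, ?_, by omega, by omega, ?_, ?_, fun i hi => by omega, fun a ha => ?_⟩
    · rw [ho3 _ (by omega), hv2, hv1, h.count]
    · rw [ho3 _ (by omega), hv2, hv1, h.ctx.block, blk]
    · rw [hmem3, Function.update_of_ne (by omega), Function.update_self]
    · rw [hmem3, Function.update_self]
    · rw [hmem3, Function.update_of_ne (by omega), Function.update_of_ne (by omega)]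
  · rintro s' ⟨⟨m, j, hj, hl, -, hjl, -, h0, h1, hi, -⟩, hz⟩
    simp only [eval] at hz
    rw [hl, hj] at hz
    refine ⟨h0, h1, fun i hiL => ?_⟩
    have hcell := h.cells i hiL
    rw [hi _ (by omega), show 3 + 2 * i = 2 + (2 * i + 1) by omega, hi _ (by omega), ← add_assoc]
    exact hcell

/-! ### The algorithm -/

/-- Computes the full vertex set and the block size. -/
def setup : Cmd :=
  .seq (.asg 1 (.sub (.pow2 (.glob 0)) (.const 1))) <|
  .seq (.asg 2 (.loop (.pow2 (.glob 0)) (.add (.var 1) (.var 1)))) <|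
  .seq (.asg 2 (.add (.glob 2) (.glob 2))) (.asg 2 (.add (.glob 2) (.glob 2)))

theorem setup_spec (hM : 2 * n + K + 10 ≤ M) {s : Store} (h0 : s.var 0 = n) :
    Tr M setup s 4 fun s' => s'.mem = s.mem ∧ s'.var 0 = n ∧
      s'.var 1 = enc (Finset.univ : Finset (Fin n)) ∧ s'.var 2 = blk n := by
  refine Tr.asg_seq (x := enc (Finset.univ : Finset (Fin n))) (by omega) ?_ (enc_lt_two_pow hM _)
    fun s1 hm1 hv1 ho1 => ?_
  · simp only [eval]
    rw [eval_pow2 h0 (by simp [eval, h0]), enc_univ]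
    simp only [eval, h0]
  have h01 : s1.var 0 = n := by rw [ho1 _ (by omega), h0]
  have hpow : ∀ m, m < M → 2 ^ m < 2 ^ M := fun m hm => Nat.pow_lt_pow_right (by omega) hm
  refine Tr.asg_seq (x := 2 ^ (2 * n)) (by omega) ?_ (hpow _ (by omega)) fun s2 hm2 hv2 ho2 => ?_
  · simp only [eval, h01]
    rw [eval_pow2 h01 (by simp [eval, h01])]
    simp only [eval, h01, List.getD_cons_succ, List.getD_cons_zero]
    have H : ∀ j : ℕ, Nat.rec (motive := fun _ => ℕ) (2 ^ n) (fun _ x => x + x) j =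
        2 ^ (n + j) := fun j => by
      induction j with
      | zero => rfl
      | succ j ih => simp only [ih]; rw [← add_assoc, pow_succ]; omega
    rw [H, two_mul]
  refine Tr.asg_seq (x := 2 ^ (2 * n + 1)) (by omega) (by simp only [eval, hv2]; rw [pow_succ]; omega)
    (hpow _ (by omega)) fun s3 hm3 hv3 ho3 => ?_
  refine Tr.asg (t := 0) (x := blk n) (by omega)
    (by simp only [eval, hv3]; rw [blk, pow_succ _ (2 * n + 1)]; omega)
    (hpow _ (by omega)) fun s4 hm4 hv4 ho4 => ?_
  refine ⟨by rw [hm4, hm3, hm2, hm1], ?_, ?_, hv4⟩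
  · rw [ho4 _ (by omega), ho3 _ (by omega), ho2 _ (by omega), h01]
  · rw [ho4 _ (by omega), ho3 _ (by omega), ho2 _ (by omega), hv1]

/-- Division by `n` recovers the row and then the column from a cell address, so distinct pairs have
distinct cells. -/
theorem inputState_adj (G : SimpleGraph (Fin n)) [DecidableRel G.Adj] (i j : Fin n) :
    (inputState G).mem (1 + i * n + j) = if G.Adj i j then 1 else 0 := by
  have key : (∃ i' j' : Fin n, G.Adj i' j' ∧ 1 + (i : ℕ) * n + j = 1 + (i' : ℕ) * n + j') ↔
      G.Adj i j := by
    refine ⟨?_, fun h => ⟨i, j, h, rfl⟩⟩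
    rintro ⟨i', j', h, he⟩
    have hi : (i : ℕ) = i' := by
      have h1 : ((j : ℕ) + i * n) / n = (j' + i' * n) / n := by congr 1; omega
      rwa [Nat.add_mul_div_right _ _ (by omega), Nat.add_mul_div_right _ _ (by omega),
        Nat.div_eq_of_lt j.isLt, Nat.div_eq_of_lt j'.isLt, zero_add, zero_add] at h1
    rw [hi] at he
    have hj : (j : ℕ) = j' := by omega
    rwa [Fin.ext hi, Fin.ext hj]
  simp only [inputState]
  rw [if_neg (by omega)]
  by_cases h : G.Adj i j
  · rw [if_pos h, if_pos (key.2 h)]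
  · rw [if_neg h, if_neg (mt key.1 h)]

theorem inputState_eq_zero (G : SimpleGraph (Fin n)) {a : ℕ} (ha : blk n ≤ a) :
    (inputState G).mem a = 0 := by
  have hsq := sq_lt_blk n
  simp only [inputState]
  rw [if_neg (by omega), if_neg]
  rintro ⟨i, j, -, he⟩
  have h1 : (i : ℕ) * n ≤ n * n := Nat.mul_le_mul_right n i.isLt.le
  have := j.isLt
  omega

theorem inputState_le (G : SimpleGraph (Fin n)) (a : ℕ) : (inputState G).mem a ≤ n + 1 := by
  simp only [inputState]
  split_ifs <;> omega

/-- The algorithm, for a store that holds the number of vertices in variable `0`. -/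
def algorithm (K : ℕ) : Cmd := .seq setup <| .seq (rounds K) <| .seq emit copyOut

/-- Number of steps of `algorithm`. -/
def algorithmSteps (K n : ℕ) : ℕ :=
  4 + (roundsSteps n K (listBound K n) + (emitSteps n + copySteps n))

theorem algorithm_spec (hM : 2 * n + K + 10 ≤ M) (hK : 0 < K) {s : Store} (h0 : s.var 0 = n)
    (hmem : s.mem = (inputState G).mem) :
    Tr M (algorithm K) s (algorithmSteps K n) fun s' => ∃ (k : ℕ) (π : Layout G),
      s'.mem 0 = k ∧ s'.mem 1 = G.edgeSet.ncard ∧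
      (∀ i : Fin G.edgeSet.ncard, ∃ u v : Fin n,
        (π i : Sym2 (Fin n)) = s(u, v) ∧ s'.mem (2 + 2 * i) = u ∧ s'.mem (3 + 2 * i) = v) ∧
      π.width = k ∧ linearWidth G ≤ k ∧ k ≤ linearWidth G + 1 := by
  classical
  -- Capacity `n` always suffices, as no set has more than `n` outer neighbours.
  have hex : ∃ k, Reach (wt G K) (k + K) ∅ Finset.univ :=
    ⟨n, .of_forall (Finset.empty_subset _) fun X _ _ => wt_le K X⟩
  set p := Nat.find hex with hp
  have hpr : Reach (wt G K) (p + K) ∅ Finset.univ := Nat.find_spec hex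
  have hpn : p ≤ n := Nat.find_min' hex (.of_forall (Finset.empty_subset _) fun X _ _ => wt_le K X)
  refine Tr.seq ((setup_spec hM h0).imp le_rfl ?_)
  rintro s1 ⟨hm1, hn1, hfull, hblk⟩
  rw [hmem] at hm1
  have hctx1 : Ctx G s1 := ⟨hn1, hfull, hblk, fun i j => by rw [hm1, inputState_adj]⟩
  refine Tr.seq ((rounds_spec hM hpn hpr (fun k q => listed_length_le hK) hctx1
    fun a ha => by rw [hm1, inputState_eq_zero G ha]).imp le_rfl ?_)
  rintro s2 ⟨hctx2, ht2, hmark2⟩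
  refine Tr.seq ((emit_spec hM hctx2 ht2 hmark2).imp le_rfl ?_)
  rintro s3 ⟨L, hW, hc⟩
  refine (copyOut_spec hM hW).imp le_rfl ?_
  rintro s4 ⟨hw, hl, hcells⟩
  obtain ⟨hcard, π, hπ, hval⟩ := hW.edges.exists_layout fun u v huv => (hc u v huv).2 trivial
  have hfin := π.width_le_linearWidth_add_one (K := K) (p := p)
    (fun k hk => Nat.find_min' hex hk) (hπ ▸ hW.bound)
  refine ⟨π.width, π, hw.trans hπ.symm, hl.trans hcard.symm, fun i => ?_, rfl, hfin⟩
  have hi : (i : ℕ) < L.length := by have := i.isLt; omega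
  exact ⟨_, _, hval i hi, hcells i hi⟩

/-- The program. -/
def program (K : ℕ) : Program :=
  .seq (.instr (.const 1 0)) (.seq (.instr (.load 0 1)) (algorithm K).compile)

/-- A bound for the running time of the program. -/
def runTime (K n : ℕ) : ℕ :=
  n + 2 + algorithmSteps K n * (algorithm K).unit n (2 * n + K + 10)

theorem program_spec (hK : 0 < K) (G : SimpleGraph (Fin n)) :
    ∃ (t : ℕ) (s : RAMState) (k : ℕ) (π : Layout G), Runs (program K) (inputState G) t s ∧
      t ≤ runTime K n ∧ Outputs s k π ∧ π.width = k ∧ linearWidth G ≤ k ∧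
      k ≤ linearWidth G + 1 := by
  set s₀ : Store := ⟨fun r => if r = 0 then n else 0, (inputState G).mem⟩ with hs₀
  obtain ⟨t, ht, s₁, hexec, k, π, h1, h2, h3, h4⟩ :=
    algorithm_spec (G := G) (s := s₀) le_rfl hK (by simp [hs₀]) rfl
  have hlt : n + 1 < 2 ^ (2 * n + K + 10) :=
    lt_of_le_of_lt (by omega) (Nat.lt_two_pow_self (n := 2 * n + K + 10))
  have hfits : Fits n (2 * n + K + 10) s₀ := by
    refine ⟨by simp [hs₀], fun r => ?_, fun a => (inputState_le G a).trans_lt hlt⟩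
    simp only [hs₀]
    split_ifs <;> omega
  set σ : RAMState := (Instr.load 0 1).eval ((Instr.const 1 0).eval (inputState G)) with hσ
  have hrepr : Repr σ s₀ := by
    refine ⟨fun r => ?_, rfl⟩
    by_cases hr : r = 0
    · subst hr
      simp [hσ, hs₀, Instr.eval, inputState]
    · simp only [hσ, hs₀, Instr.eval, inputState, if_neg hr]
      rw [Function.update_of_ne (by omega), Function.update_of_ne (by omega)]
  obtain ⟨-, t', σ', hrun, ht', hrepr'⟩ := hexec.runs hfits hrepr
  refine ⟨_, σ', k, π, .seq (.instr _ _) (.seq (.instr _ _) hrun), ?_, ?_, h4⟩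
  · have hsize : n.size ≤ n := Nat.size_le.2 Nat.lt_two_pow_self
    have hle := Nat.mul_le_mul_right ((algorithm K).unit n (2 * n + K + 10)) ht
    simp [Instr.cost, Instr.eval, inputState, runTime]
    omega
  · rw [Outputs, hrepr'.mem]
    exact ⟨h1, h2, h3⟩

theorem polyBdd_visitSteps (K : ℕ) : PolyBdd fun n => visitSteps n K :=
  (polyBdd_descendSteps K).add ((((PolyBdd.id.add (.const 1)).mul
    ((polyBdd_lightenSteps (polyBdd_descendSteps K)).add (.const 5))).add (.const 2)).add
    (.const 20))

/-- Only the number of listed sets is exponential, and it enters the step count linearly; everything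
else is polynomial for fixed `K`. -/
theorem exists_runTime_le (K : ℕ) :
    ∃ p, PolyBdd p ∧ ∀ n, runTime K n ≤ p n * listBound K n := by
  have hunit : PolyBdd fun n => (algorithm K).unit n (2 * n + K + 10) :=
    polyBdd_unit _ .id ((((PolyBdd.const 2).mul .id).add (.const K)).add (.const 10))
  have hemit : PolyBdd fun n => emitSteps n + copySteps n :=
    ((PolyBdd.id.mul ((PolyBdd.id.mul (.const 7)).add (.const 5))).add (.const 4)).add
      ((((PolyBdd.const 2).mul (PolyBdd.id.mul .id)).mul (.const 3)).add (.const 4))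
  have hrounds : PolyBdd fun n => (n + 1) * ((n * (visitSteps n K + 2) + 5) + 12) + 3 :=
    ((PolyBdd.id.add (.const 1)).mul (((PolyBdd.id.mul ((polyBdd_visitSteps K).add
      (.const 2))).add (.const 5)).add (.const 12))).add (.const 3)
  refine ⟨_, (PolyBdd.id.add (.const 2)).add
    (((PolyBdd.const 4).add (hrounds.add hemit)).mul hunit), fun n => ?_⟩
  have hN : 1 ≤ listBound K n := by rw [listBound]; omega
  rw [runTime, algorithmSteps, roundsSteps, roundSteps]
  generalize listBound K n = N at *
  generalize (algorithm K).unit n (2 * n + K + 10) = U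
  generalize emitSteps n + copySteps n = E
  generalize n * (visitSteps n K + 2) + 5 = V
  obtain ⟨N, rfl⟩ := Nat.exists_eq_add_of_le' hN
  have h1 : 4 + ((n + 1) * ((N + 1) * V + 10 + 2) + 3 + E) ≤
      (4 + ((n + 1) * (V + 12) + 3 + E)) * (N + 1) := by
    have : (4 + ((n + 1) * (V + 12) + 3 + E)) * (N + 1) =
      4 + ((n + 1) * ((N + 1) * V + 10 + 2) + 3 + E) + (12 * (n + 1) + 7 + E) * N := by ring
    omega
  calc _ ≤ (n + 2) * (N + 1) + (4 + ((n + 1) * (V + 12) + 3 + E)) * (N + 1) * U :=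
        Nat.add_le_add (Nat.le_mul_of_pos_right _ N.succ_pos) (Nat.mul_le_mul_right U h1)
    _ = _ := by ring

end LinearWidth

theorem theorem2 :
    ∃ (P : LinearWidth.Program) (T : ℕ → ℕ),
      (fun n : ℕ => (T n : ℝ)) =O[atTop] (fun n : ℕ => (1.89 : ℝ) ^ n) ∧
      ∀ (n : ℕ) (G : SimpleGraph (Fin n)),
        ∃ (t : ℕ) (s : LinearWidth.RAMState) (k : ℕ) (π : LinearWidth.Layout G),
          LinearWidth.Runs P (LinearWidth.inputState G) t s ∧ t ≤ T n ∧
          LinearWidth.Outputs s k π ∧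
          LinearWidth.Layout.width π = k ∧
          LinearWidth.linearWidth G ≤ k ∧ k ≤ LinearWidth.linearWidth G + 1 := by
  obtain ⟨K, hK, hO⟩ := LinearWidth.exists_listBound_isBigO
  obtain ⟨p, hp, hle⟩ := LinearWidth.exists_runTime_le K
  refine ⟨LinearWidth.program K, LinearWidth.runTime K, ?_, fun n G =>
    LinearWidth.program_spec hK G⟩
  refine (IsBigO.of_bound' (Eventually.of_forall fun n => ?_)).trans (hO p hp)
  rw [Real.norm_of_nonneg (by positivity), Real.norm_of_nonneg (by positivity)]
  exact_mod_cast hle n
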